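/- Theorem (the Koszul double bracket). Let $(\mathtt C,\otimes,\mathds 1,\tau)$ be an additive symmetric monoidal category with coequalizers (with $\otimes$ additive in each variable), let $\Sigma$ be an invertible object of $\mathtt C$, and write $\Sigma X=\Sigma\otimes X$. Let $A$ be a unital associative monoid in $\mathtt C$ with product $\mu$, unit $\iota$ and a $\Sigma$-double Poisson bracket, i.e. a morphism $\{\!\{-,-\}\!\}:\Sigma A\otimes\Sigma A\to\Sigma A\otimes A$ which satisfies $\{\!\{-,-\}\!\}=-\Sigma\tau_{A,A}\circ\{\!\{-,-\}\!\}\circ\tau_{\Sigma A,\Sigma A}$, is a derivation in its first variable for the internal bimodule structure of $\Sigma A\otimes A$ (left action on the second factor, right action on the first one), and satisfies the double Jacobi identity $$(\{\!\{-,-\}\!\}\otimes A)(\Sigma A\otimes\{\!\{-,-\}\!\})+\Sigma\tau_{A,A\otimes A}(\{\!\{-,-\}\!\}\otimes A)(\Sigma A\otimes\{\!\{-,-\}\!\})\tau_{\Sigma A\otimes\Sigma A,\Sigma A}+\Sigma\tau_{A\otimes A,A}(\{\!\{-,-\}\!\}\otimes A)(\Sigma A\otimes\{\!\{-,-\}\!\})\tau_{\Sigma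 A,\Sigma A\otimes\Sigma A}=0 .$$ Let $\Omega=\Omega_A$ be the $A$-bimodule of noncommutative $1$-forms, the coequalizer of $\mu\otimes A\otimes A+A\otimes A\otimes\mu$ and $A\otimes\mu\otimes A:A^{\otimes4}\rightrightarrows A^{\otimes3}$ in $A$-bimodules (for the external structures), and $d:A\to\Omega$ the composite of $\iota\otimes A\otimes\iota$ with the projection. Then: 1. There is a unique morphism $\rho^\Omega:\Sigma\Omega\otimes\Sigma A\to\Sigma A\otimes A$ of $A$-bimodules (structure induced by $\Omega$ on the source, internal structure on the target) with $\rho^\Omega\circ(\Sigma d\otimes\Sigma A)=\{\!\{-,-\}\!\}$. 2. There is a unique morphism $\{\!\{-,-\}\!\}^\Omega:\Sigma\Omega\otimes\Sigma\Omega\to\Sigma(\Omega\otimes A\oplus A\otimes\Omega)$ (the Koszul double bracket) with $\{\!\{-,-\}\!\}^\Omega\circ(\Sigma d\otimes\Sigma d)=\Sigma(d\otimes A+A\otimes d)\circ\{\!\{-,-\}\!\}$ which satisfies the antisymmetry (a) and the derivation property (b) below for $M=\Omega$, $\rho=\rho^\Omega$. 3. $(\Omega,\rho^\Omega,\{\!\{-,-\}\!\}^\Omega)$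 is a $\Sigma$-double Lie–Rinehart algebra over $A$. Here an $A$-bimodule $M$, with actions ${}_A\mu$, $\mu_A$, is a $\Sigma$-double Lie–Rinehart algebra for $\rho:\Sigma M\otimes\Sigma A\to\Sigma A\otimes A$ (the anchor) and $B:\Sigma M\otimes\Sigma M\to\Sigma(M\otimes A\oplus A\otimes M)$ with components $B_l$ in $\Sigma M\otimes A$ and $B_r$ in $\Sigma A\otimes M$, if $\rho$ is a morphism of $A$-bimodules as in 1 and a derivation in the second variable for the external structure of $\Sigma A\otimes A$, and: (a) $B\,\tau_{\Sigma M,\Sigma M}=-\Sigma(\tau_{M,A},\tau_{A,M})B$; (b) $B(\Sigma M\otimes\Sigma\,{}_A\mu)=(\Sigma A\otimes{}_A\mu)(\rho\otimes M)+{}_A\mu\,(A\otimes B)(\tau_{\Sigma M\Sigma,A}\otimes M)$ and $B(\Sigma M\otimes\Sigma\mu_A)=\mu_A(B\otimes A)+(\Sigma\mu_A\otimes A)(\tau_{M,\Sigma}\otimes A\otimes A)(M\otimes\rho)(\tau_{\Sigma M\Sigma,M}\otimes A)$, for the external actions on $\Sigma(M\otimes A\oplus A\otimes M)$; (c) with $\rho_\tau=-\Sigma\tau_{A,A}\,\rho\,\tau_{\Sigma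 A,\Sigma M}$, on $\Sigma A\otimes\Sigma M\otimes\Sigma M$: $(\rho_\tau\otimes A)(\Sigma A\otimes B_l)+\Sigma\tau_{A\otimes A,A}(\rho\otimes A)(\Sigma M\otimes\rho)\tau_{\Sigma A,\Sigma M\otimes\Sigma M}+\Sigma\tau_{A,A\otimes A}(\rho\otimes A)(\Sigma M\otimes\rho_\tau)\tau_{\Sigma A\otimes\Sigma M,\Sigma M}=0$; (d) from $(\Sigma M)^{\otimes 3}$ to $\Sigma M\otimes A\otimes A$: $(B_l\otimes A)(\Sigma M\otimes B_l)+\Sigma\tau_{A,M\otimes A}(B_r\otimes A)(\Sigma M\otimes B_l)\tau_{\Sigma M\otimes\Sigma M,\Sigma M}+\Sigma\tau_{A\otimes A,M}(\rho\otimes M)(\Sigma M\otimes B_r)\tau_{\Sigma M,\Sigma M\otimes\Sigma M}=0$. 4. Equivalently, the free $A$-algebra is a linear $\Sigma$-double Poisson algebra: if $\mathtt C$ has countable coproducts and $\otimes$ preserves them, so that the free $A$-algebra $T_A\Omega=\bigoplus_{n\ge0}\Omega^{\otimes_An}$ is defined, then $T_A\Omega$ has a unique $\Sigma$-double Poisson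 bracket which is linear (it vanishes on $\Sigma A\otimes\Sigma A$ and maps $\Sigma\Omega\otimes\Sigma A$ to $\Sigma A\otimes A$ and $\Sigma\Omega\otimes\Sigma\Omega$ to $\Sigma(\Omega\otimes A\oplus A\otimes\Omega)$) and whose restrictions to $\Sigma\Omega\otimes\Sigma A$ and $\Sigma\Omega\otimes\Sigma\Omega$ are $\rho^\Omega$ and $\{\!\{-,-\}\!\}^\Omega$. -/

import Mathlib

open CategoryTheory CategoryTheory.Limits MonoidalCategory MonObj

universe v u

namespace DoubleAlgebra

noncomputable section

section OneForms

variable {C : Type u} [Category.{v} C] [MonoidalCategory C]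

/-- The left action of `A` on `A ⊗ X ⊗ A`, by multiplication on the first factor. -/
def freeL (A : Mon C) (X : C) : A.X ⊗ (A.X ⊗ (X ⊗ A.X)) ⟶ A.X ⊗ (X ⊗ A.X) :=
  (α_ A.X A.X (X ⊗ A.X)).inv ≫ μ[A.X] ▷ (X ⊗ A.X)

/-- The right action of `A` on `A ⊗ X ⊗ A`, by multiplication on the last factor. -/
def freeR (A : Mon C) (X : C) : (A.X ⊗ (X ⊗ A.X)) ⊗ A.X ⟶ A.X ⊗ (X ⊗ A.X) :=
  (α_ A.X (X ⊗ A.X) A.X).hom ≫ A.X ◁ (α_ X A.X A.X).hom ≫ A.X ◁ X ◁ μ[A.X]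

/-- The free `A`-bimodule `A ⊗ X ⊗ A`, with its external bimodule structure. -/
def freeBimod (A : Mon C) (X : C) : Bimod A A where
  X := A.X ⊗ (X ⊗ A.X)
  actLeft := freeL A X
  one_actLeft := by
    rw [freeL, associator_inv_naturality_left_assoc, ← comp_whiskerRight, one_mul]; monoidal
  left_assoc := by
    rw [freeL, associator_inv_naturality_left_assoc, ← comp_whiskerRight, mul_assoc]; monoidal
  actRight := freeR A X
  actRight_one := by
    have h := congrArg (fun k => A.X ◁ X ◁ k) (mul_one A.X)
    simp only [whiskerLeft_comp] at h
    rw [freeR, associator_naturality_right_assoc, ← whiskerLeft_comp_assoc,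
      associator_naturality_right, whiskerLeft_comp_assoc, h]
    monoidal
  right_assoc := by
    have h := congrArg (fun k => A.X ◁ X ◁ ((α_ _ _ _).inv ≫ k)) (mul_assoc A.X)
    simp only [whiskerLeft_comp, Iso.inv_hom_id_assoc] at h
    rw [freeR, associator_naturality_right_assoc, ← whiskerLeft_comp_assoc,
      associator_naturality_right, whiskerLeft_comp_assoc, ← h]
    monoidal
  middle_assoc := by
    have h := whisker_exchange (μ[A.X]) (X ◁ μ[A.X])
    rw [freeL, freeR]
    calc _ = 𝟙 _ ⊗≫ (μ ▷ (X ⊗ A.X ⊗ A.X) ≫ A.X ◁ X ◁ μ) := by monoidal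
      _ = _ := by rw [← h]; monoidal

/-- The bimodule structure on a retract `Q` of (the underlying object of) a bimodule `B` for which
the retraction `π` is bilinear. -/
@[simps]
def bimodOfRetract {A : Mon C} (B : Bimod A A) {Q : C} (π : B.X ⟶ Q) (σ : Q ⟶ B.X)
    (h : σ ≫ π = 𝟙 Q)
    (hl : A.X ◁ π ≫ A.X ◁ σ ≫ B.actLeft ≫ π = B.actLeft ≫ π)
    (hr : π ▷ A.X ≫ σ ▷ A.X ≫ B.actRight ≫ π = B.actRight ≫ π) : Bimod A A where
  X := Q
  actLeft := A.X ◁ σ ≫ B.actLeft ≫ π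
  one_actLeft := by
    rw [← whisker_exchange_assoc, B.one_actLeft_assoc, leftUnitor_naturality_assoc, h,
      Category.comp_id]
  left_assoc := by
    rw [← whisker_exchange_assoc, B.left_assoc_assoc]
    simp only [whiskerLeft_comp, Category.assoc]
    rw [hl]
    simp
  actRight := σ ▷ A.X ≫ B.actRight ≫ π
  actRight_one := by
    rw [whisker_exchange_assoc, B.actRight_one_assoc, rightUnitor_naturality_assoc, h,
      Category.comp_id]
  right_assoc := by
    rw [whisker_exchange_assoc, B.right_assoc_assoc]
    simp only [comp_whiskerRight, Category.assoc]
    rw [hr]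
    simp
  middle_assoc := by
    simp only [comp_whiskerRight, whiskerLeft_comp, Category.assoc]
    rw [hl, hr, B.middle_assoc_assoc]
    simp

/-- Morphisms out of `bimodOfRetract`. -/
@[simps]
def bimodOfRetractDesc {A : Mon C} {B N : Bimod A A} {Q : C} {π : B.X ⟶ Q} {σ : Q ⟶ B.X}
    {h : σ ≫ π = 𝟙 Q}
    {hl : A.X ◁ π ≫ A.X ◁ σ ≫ B.actLeft ≫ π = B.actLeft ≫ π}
    {hr : π ▷ A.X ≫ σ ▷ A.X ≫ B.actRight ≫ π = B.actRight ≫ π}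
    (k : B ⟶ N) (hk : π ≫ σ ≫ k.hom = k.hom) : bimodOfRetract B π σ h hl hr ⟶ N where
  hom := σ ≫ k.hom
  left_act_hom := by
    change (A.X ◁ σ ≫ B.actLeft ≫ π : A.X ⊗ Q ⟶ Q) ≫ (σ ≫ k.hom) =
      A.X ◁ (σ ≫ k.hom) ≫ N.actLeft
    simp [hk]
  right_act_hom := by
    change (σ ▷ A.X ≫ B.actRight ≫ π : Q ⊗ A.X ⟶ Q) ≫ (σ ≫ k.hom) =
      (σ ≫ k.hom) ▷ A.X ≫ N.actRight
    simp [hk]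

variable [Preadditive C] [MonoidalPreadditive C]

/-- The morphism `μ ⊗ A ⊗ A + A ⊗ A ⊗ μ : A⊗⁴ ⟶ A⊗³`. -/
def relSum (A : Mon C) : A.X ⊗ ((A.X ⊗ A.X) ⊗ A.X) ⟶ A.X ⊗ (A.X ⊗ A.X) :=
  A.X ◁ (α_ A.X A.X A.X).hom ≫ (α_ A.X A.X (A.X ⊗ A.X)).inv ≫ μ[A.X] ▷ (A.X ⊗ A.X) +
    A.X ◁ (α_ A.X A.X A.X).hom ≫ A.X ◁ A.X ◁ μ[A.X]

/-- The morphism `A ⊗ μ ⊗ A : A⊗⁴ ⟶ A⊗³`. -/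
def relMid (A : Mon C) : A.X ⊗ ((A.X ⊗ A.X) ⊗ A.X) ⟶ A.X ⊗ (A.X ⊗ A.X) :=
  A.X ◁ μ[A.X] ▷ A.X

/-- `μ ⊗ A ⊗ A + A ⊗ A ⊗ μ` as a morphism of bimodules. -/
def relSumHom (A : Mon C) : freeBimod A (A.X ⊗ A.X) ⟶ freeBimod A A.X where
  hom := relSum A
  left_act_hom := by
    change freeL A (A.X ⊗ A.X) ≫ relSum A = A.X ◁ relSum A ≫ freeL A A.X
    have h1 := whisker_exchange (μ[A.X]) (A.X ◁ μ[A.X])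
    have h2 := congrArg (fun k => k ▷ (A.X ⊗ A.X)) (mul_assoc A.X)
    simp only [comp_whiskerRight] at h2
    simp only [freeL, relSum, Preadditive.comp_add, Preadditive.add_comp,
      MonoidalPreadditive.whiskerLeft_add]
    congr 1
    · calc _ = 𝟙 _ ⊗≫ (μ[A.X] ▷ A.X ▷ (A.X ⊗ A.X) ≫ μ[A.X] ▷ (A.X ⊗ A.X)) := by monoidal
        _ = _ := by rw [h2]; monoidal
    · calc _ = 𝟙 _ ⊗≫ (μ[A.X] ▷ (A.X ⊗ A.X ⊗ A.X) ≫ A.X ◁ A.X ◁ μ[A.X]) := by monoidal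
        _ = _ := by rw [← h1]; monoidal
  right_act_hom := by
    change freeR A (A.X ⊗ A.X) ≫ relSum A = relSum A ▷ A.X ≫ freeR A A.X
    have h1 := whisker_exchange (μ[A.X]) (A.X ◁ μ[A.X])
    have h2 := congrArg (fun k => A.X ◁ A.X ◁ k) (mul_assoc A.X)
    simp only [whiskerLeft_comp] at h2
    simp only [freeR, relSum, Preadditive.comp_add, Preadditive.add_comp,
      MonoidalPreadditive.add_whiskerRight]
    congr 1
    · calc _ = 𝟙 _ ⊗≫ ((A.X ⊗ A.X) ◁ A.X ◁ μ[A.X] ≫ μ[A.X] ▷ (A.X ⊗ A.X)) := by monoidal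
        _ = _ := by rw [h1]; monoidal
    · calc _ = 𝟙 _ ⊗≫ (A.X ◁ A.X ◁ (α_ A.X A.X A.X).hom ≫ A.X ◁ A.X ◁ A.X ◁ μ[A.X] ≫
            A.X ◁ A.X ◁ μ[A.X]) := by monoidal
        _ = _ := by rw [← h2]; monoidal

/-- `A ⊗ μ ⊗ A` as a morphism of bimodules. -/
def relMidHom (A : Mon C) : freeBimod A (A.X ⊗ A.X) ⟶ freeBimod A A.X where
  hom := relMid A
  left_act_hom := by
    change freeL A (A.X ⊗ A.X) ≫ relMid A = A.X ◁ relMid A ≫ freeL A A.X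
    have h1 := whisker_exchange (μ[A.X]) (μ[A.X] ▷ A.X)
    simp only [freeL, relMid]
    calc _ = 𝟙 _ ⊗≫ (μ[A.X] ▷ ((A.X ⊗ A.X) ⊗ A.X) ≫ A.X ◁ μ[A.X] ▷ A.X) := by monoidal
      _ = _ := by rw [← h1]; monoidal
  right_act_hom := by
    change freeR A (A.X ⊗ A.X) ≫ relMid A = relMid A ▷ A.X ≫ freeR A A.X
    have h1 := congrArg (fun k => A.X ◁ k) (whisker_exchange (μ[A.X]) (μ[A.X]))
    simp only [whiskerLeft_comp] at h1
    simp only [freeR, relMid]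
    calc _ = 𝟙 _ ⊗≫ (A.X ◁ (A.X ⊗ A.X) ◁ μ[A.X] ≫ A.X ◁ μ[A.X] ▷ A.X) := by monoidal
      _ = _ := by rw [h1]; monoidal

/-- The endomorphism `a ⊗ b ⊗ c ↦ 1 ⊗ ab ⊗ c - 1 ⊗ a ⊗ bc` of `A⊗³`; it is right `A`-linear. -/
def relSplit (A : Mon C) : A.X ⊗ (A.X ⊗ A.X) ⟶ A.X ⊗ (A.X ⊗ A.X) :=
  ((α_ A.X A.X A.X).inv ≫ μ[A.X] ▷ A.X - A.X ◁ μ[A.X]) ≫ (λ_ (A.X ⊗ A.X)).inv ≫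
    η[A.X] ▷ (A.X ⊗ A.X)

theorem rel_comp_relSplit (A : Mon C) : relSum A ≫ relSplit A = relMid A ≫ relSplit A := by
  have h2 := congrArg (fun k => k ▷ A.X) (mul_assoc A.X)
  have h3 := congrArg (fun k => A.X ◁ k) (mul_assoc A.X)
  have h1 := whisker_exchange (μ[A.X]) (μ[A.X])
  simp only [comp_whiskerRight] at h2
  simp only [whiskerLeft_comp] at h3
  have e1 : A.X ◁ (α_ A.X A.X A.X).hom ≫ (α_ A.X A.X (A.X ⊗ A.X)).inv ≫ μ[A.X] ▷ (A.X ⊗ A.X) ≫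
      (α_ A.X A.X A.X).inv ≫ μ[A.X] ▷ A.X =
      A.X ◁ μ[A.X] ▷ A.X ≫ (α_ A.X A.X A.X).inv ≫ μ[A.X] ▷ A.X := by
    calc _ = 𝟙 _ ⊗≫ (μ[A.X] ▷ A.X ▷ A.X ≫ μ[A.X] ▷ A.X) := by monoidal
      _ = _ := by rw [h2]; monoidal
  have e2 : A.X ◁ (α_ A.X A.X A.X).hom ≫ A.X ◁ A.X ◁ μ[A.X] ≫ A.X ◁ μ[A.X] =
      A.X ◁ μ[A.X] ▷ A.X ≫ A.X ◁ μ[A.X] := h3.symm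
  have e3 : A.X ◁ (α_ A.X A.X A.X).hom ≫ (α_ A.X A.X (A.X ⊗ A.X)).inv ≫ μ[A.X] ▷ (A.X ⊗ A.X) ≫
      A.X ◁ μ[A.X] = A.X ◁ (α_ A.X A.X A.X).hom ≫ A.X ◁ A.X ◁ μ[A.X] ≫ (α_ A.X A.X A.X).inv ≫
        μ[A.X] ▷ A.X := by
    rw [← h1]; monoidal
  have key : relSum A ≫ ((α_ A.X A.X A.X).inv ≫ μ[A.X] ▷ A.X - A.X ◁ μ[A.X]) =
      relMid A ≫ ((α_ A.X A.X A.X).inv ≫ μ[A.X] ▷ A.X - A.X ◁ μ[A.X]) := by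
    simp only [relSum, relMid, Preadditive.comp_sub, Preadditive.add_comp, Category.assoc, e1, e2,
      e3]
    abel
  simp only [relSplit, ← Category.assoc, key]

/-- The morphism `a ⊗ b ⊗ c ↦ 1 ⊗ a ⊗ b ⊗ c`. -/
def relHomotopy (A : Mon C) : A.X ⊗ (A.X ⊗ A.X) ⟶ A.X ⊗ ((A.X ⊗ A.X) ⊗ A.X) :=
  (λ_ _).inv ≫ η[A.X] ▷ _ ≫ A.X ◁ (α_ A.X A.X A.X).inv

theorem relSplit_eq (A : Mon C) :
    relSplit A = 𝟙 _ - relHomotopy A ≫ (relSum A - relMid A) := by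
  have h0 := congrArg (fun k => k ▷ (A.X ⊗ A.X)) (one_mul A.X)
  simp only [comp_whiskerRight] at h0
  have e1 : (λ_ _).inv ≫ η[A.X] ▷ _ ≫ (α_ A.X A.X (A.X ⊗ A.X)).inv ≫ μ[A.X] ▷ (A.X ⊗ A.X) =
      𝟙 (A.X ⊗ A.X ⊗ A.X) := by
    calc _ = 𝟙 _ ⊗≫ (η[A.X] ▷ A.X ▷ (A.X ⊗ A.X) ≫ μ[A.X] ▷ (A.X ⊗ A.X)) := by monoidal
      _ = _ := by rw [h0]; monoidal
  have e2 : (λ_ _).inv ≫ η[A.X] ▷ _ ≫ A.X ◁ A.X ◁ μ[A.X] =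
      A.X ◁ μ[A.X] ≫ (λ_ _).inv ≫ η[A.X] ▷ _ := by
    rw [← whisker_exchange]; simp only [leftUnitor_inv_naturality_assoc]
  have e3 : (λ_ _).inv ≫ η[A.X] ▷ _ ≫ A.X ◁ (α_ A.X A.X A.X).inv ≫ A.X ◁ μ[A.X] ▷ A.X =
      (α_ A.X A.X A.X).inv ≫ μ[A.X] ▷ A.X ≫ (λ_ _).inv ≫ η[A.X] ▷ _ := by
    rw [← whisker_exchange_assoc, ← whisker_exchange]
    simp only [leftUnitor_inv_naturality_assoc]
  have e4 : A.X ◁ (α_ A.X A.X A.X).inv ≫ A.X ◁ (α_ A.X A.X A.X).hom = 𝟙 _ := by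
    rw [← whiskerLeft_comp, Iso.inv_hom_id, whiskerLeft_id]
  simp only [relSplit, relHomotopy, relSum, relMid, Preadditive.comp_add, Preadditive.sub_comp,
    Preadditive.comp_sub, Category.assoc, reassoc_of% e4, e1, e2, e3]
  abel

theorem relSplit_comp (A : Mon C) {Z : C} (k : A.X ⊗ (A.X ⊗ A.X) ⟶ Z)
    (h : relSum A ≫ k = relMid A ≫ k) : relSplit A ≫ k = k := by
  rw [relSplit_eq, Preadditive.sub_comp, Preadditive.comp_sub, Preadditive.sub_comp,
    Category.assoc, Category.assoc, h, sub_self, sub_zero, Category.id_comp]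

variable [HasCoequalizers C]

/-- The underlying object of the bimodule of noncommutative one-forms. -/
def omegaX (A : Mon C) : C := coequalizer (relSum A) (relMid A)

/-- The projection `A⊗³ ⟶ Ω_A`. -/
def omegaπ (A : Mon C) : A.X ⊗ (A.X ⊗ A.X) ⟶ omegaX A := coequalizer.π (relSum A) (relMid A)

theorem rel_comp_omegaπ (A : Mon C) : relSum A ≫ omegaπ A = relMid A ≫ omegaπ A :=
  coequalizer.condition _ _

/-- The section of the projection `A⊗³ ⟶ Ω_A` induced by `relSplit`. -/
def omegaσ (A : Mon C) : omegaX A ⟶ A.X ⊗ (A.X ⊗ A.X) :=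
  coequalizer.desc (relSplit A) (rel_comp_relSplit A)

theorem omegaπ_σ (A : Mon C) : omegaπ A ≫ omegaσ A = relSplit A := coequalizer.π_desc _ _

theorem omegaσ_π (A : Mon C) : omegaσ A ≫ omegaπ A = 𝟙 _ := by
  have : Epi (omegaπ A) := inferInstanceAs (Epi (coequalizer.π (relSum A) (relMid A)))
  rw [← cancel_epi (omegaπ A), ← Category.assoc, omegaπ_σ,
    relSplit_comp A _ (rel_comp_omegaπ A), Category.comp_id]

theorem relSplit_right (A : Mon C) :
    freeR A A.X ≫ relSplit A = relSplit A ▷ A.X ≫ freeR A A.X := by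
  rw [freeR]
  have h1 := whisker_exchange (μ[A.X]) (μ[A.X])
  have h2 := congrArg (fun k => A.X ◁ k) (mul_assoc A.X)
  simp only [whiskerLeft_comp] at h2
  have h3 := whisker_exchange (η[A.X]) (A.X ◁ μ[A.X])
  have e1 : ((α_ A.X (A.X ⊗ A.X) A.X).hom ≫ A.X ◁ (α_ A.X A.X A.X).hom ≫
      A.X ◁ A.X ◁ μ[A.X]) ≫ ((α_ A.X A.X A.X).inv ≫ μ[A.X] ▷ A.X - A.X ◁ μ[A.X]) =
      ((α_ A.X A.X A.X).inv ≫ μ[A.X] ▷ A.X - A.X ◁ μ[A.X]) ▷ A.X ≫ (α_ A.X A.X A.X).hom ≫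
        A.X ◁ μ[A.X] := by
    have hs : ((α_ A.X A.X A.X).inv ≫ μ[A.X] ▷ A.X - A.X ◁ μ[A.X]) ▷ A.X =
        ((α_ A.X A.X A.X).inv ≫ μ[A.X] ▷ A.X) ▷ A.X - (A.X ◁ μ[A.X]) ▷ A.X :=
      (tensorRight A.X).map_sub
    rw [hs]
    simp only [Preadditive.comp_sub, Preadditive.sub_comp]
    congr 1
    · calc _ = 𝟙 _ ⊗≫ ((A.X ⊗ A.X) ◁ μ[A.X] ≫ μ[A.X] ▷ A.X) := by monoidal
        _ = _ := by rw [h1]; monoidal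
    · calc _ = (α_ A.X (A.X ⊗ A.X) A.X).hom ≫ A.X ◁ (α_ A.X A.X A.X).hom ≫
            A.X ◁ A.X ◁ μ[A.X] ≫ A.X ◁ μ[A.X] := by monoidal
        _ = _ := by rw [← h2]; monoidal
  calc _ = (((α_ A.X (A.X ⊗ A.X) A.X).hom ≫ A.X ◁ (α_ A.X A.X A.X).hom ≫
      A.X ◁ A.X ◁ μ[A.X]) ≫ ((α_ A.X A.X A.X).inv ≫ μ[A.X] ▷ A.X - A.X ◁ μ[A.X])) ≫
        (λ_ (A.X ⊗ A.X)).inv ≫ η[A.X] ▷ (A.X ⊗ A.X) := by simp only [relSplit, Category.assoc]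
    _ = ((α_ A.X A.X A.X).inv ≫ μ[A.X] ▷ A.X - A.X ◁ μ[A.X]) ▷ A.X ⊗≫
        (𝟙_ C ◁ A.X ◁ μ[A.X] ≫ η[A.X] ▷ (A.X ⊗ A.X)) := by rw [e1]; monoidal
    _ = _ := by rw [h3, relSplit]; monoidal

theorem omegaπ_act_left (A : Mon C) :
    A.X ◁ omegaπ A ≫ A.X ◁ omegaσ A ≫ freeL A A.X ≫ omegaπ A = freeL A A.X ≫ omegaπ A := by
  rw [← whiskerLeft_comp_assoc, omegaπ_σ, relSplit_eq]
  have hs : A.X ◁ (𝟙 _ - relHomotopy A ≫ (relSum A - relMid A)) = 𝟙 _ -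
      A.X ◁ relHomotopy A ≫ (A.X ◁ relSum A - A.X ◁ relMid A) := by
    have hsub : ∀ {Y Z : C} (f g : Y ⟶ Z), A.X ◁ (f - g) = A.X ◁ f - A.X ◁ g :=
      fun f g => (tensorLeft A.X).map_sub
    rw [hsub, whiskerLeft_comp, hsub, whiskerLeft_id]
  have h1 : A.X ◁ relSum A ≫ freeL A A.X = freeL A _ ≫ relSum A :=
    ((relSumHom A).left_act_hom).symm
  have h2 : A.X ◁ relMid A ≫ freeL A A.X = freeL A _ ≫ relMid A :=
    ((relMidHom A).left_act_hom).symm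
  rw [hs]
  simp only [Preadditive.sub_comp, Preadditive.comp_sub, Category.assoc, reassoc_of% h1,
    reassoc_of% h2, rel_comp_omegaπ]
  simp

theorem omegaπ_act_right (A : Mon C) :
    omegaπ A ▷ A.X ≫ omegaσ A ▷ A.X ≫ freeR A A.X ≫ omegaπ A = freeR A A.X ≫ omegaπ A := by
  rw [← comp_whiskerRight_assoc, omegaπ_σ, ← Category.assoc, ← relSplit_right, Category.assoc,
    relSplit_comp A _ (rel_comp_omegaπ A)]

/-- The `A`-bimodule `Ω_A` of noncommutative differential one-forms of a unital monoid `A`: the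
coequalizer of `μ ⊗ A ⊗ A + A ⊗ A ⊗ μ` and `A ⊗ μ ⊗ A`, with the bimodule structure for which the
projection from `A⊗³` is bilinear (see `omegaIsCoequalizer`). -/
def omega (A : Mon C) : Bimod A A :=
  bimodOfRetract (freeBimod A A.X) (Q := omegaX A) (omegaπ A) (omegaσ A) (omegaσ_π A)
    (omegaπ_act_left A) (omegaπ_act_right A)

/-- The projection `A⊗³ ⟶ Ω_A` as a morphism of bimodules. -/
def omegaπHom (A : Mon C) : freeBimod A A.X ⟶ omega A where
  hom := omegaπ A
  left_act_hom := (omegaπ_act_left A).symm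
  right_act_hom := (omegaπ_act_right A).symm

/-- Morphisms of bimodules out of `Ω_A`. -/
def omegaDesc {A : Mon C} {N : Bimod A A} (k : freeBimod A A.X ⟶ N)
    (hk : relSumHom A ≫ k = relMidHom A ≫ k) : omega A ⟶ N :=
  bimodOfRetractDesc k (((Category.assoc _ _ _).symm.trans
    (congrArg (· ≫ k.hom) (omegaπ_σ A))).trans
      (relSplit_comp A _ (congrArg Bimod.Hom.hom hk)))

theorem omegaπHom_desc {A : Mon C} {N : Bimod A A} (k : freeBimod A A.X ⟶ N)
    (hk : relSumHom A ≫ k = relMidHom A ≫ k) : omegaπHom A ≫ omegaDesc k hk = k :=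
  Bimod.hom_ext _ _ (((Category.assoc _ _ _).symm.trans
    (congrArg (· ≫ k.hom) (omegaπ_σ A))).trans
      (relSplit_comp A _ (congrArg Bimod.Hom.hom hk)))

instance (A : Mon C) : Epi (omegaπ A) :=
  inferInstanceAs (Epi (coequalizer.π (relSum A) (relMid A)))

/-- `Ω_A` is the coequalizer of its defining relation in the category of `A`-bimodules. -/
def omegaIsCoequalizer (A : Mon C) :
    IsColimit (Cofork.ofπ (f := relSumHom A) (g := relMidHom A) (omegaπHom A)
      (Bimod.hom_ext _ _ (rel_comp_omegaπ A))) :=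
  Cofork.IsColimit.mk _ (fun s => omegaDesc s.π s.condition)
    (fun s => omegaπHom_desc s.π s.condition)
    (fun s m hm => by
      have h : omegaπHom A ≫ m = omegaπHom A ≫ omegaDesc s.π s.condition :=
        hm.trans (omegaπHom_desc s.π s.condition).symm
      exact Bimod.hom_ext _ _ ((cancel_epi (omegaπ A)).1 (congrArg Bimod.Hom.hom h)))

/-- The universal derivation `d : A ⟶ Ω_A`, `a ↦ [1 ⊗ a ⊗ 1]`. -/
def univD (A : Mon C) : A.X ⟶ (omega A).X :=
  (ρ_ A.X).inv ≫ A.X ◁ η[A.X] ≫ (λ_ (A.X ⊗ A.X)).inv ≫ η[A.X] ▷ (A.X ⊗ A.X) ≫ omegaπ A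

end OneForms

section FreeAlgebra

variable {C : Type u} [Category.{v} C] [MonoidalCategory C]

/-- A left module over a monoid `A`. -/
structure LeftMod (A : Mon C) where
  /-- The underlying object. -/
  X : C
  /-- The action. -/
  act : A.X ⊗ X ⟶ X
  one_act : η[A.X] ▷ X ≫ act = (λ_ X).hom
  mul_act : μ[A.X] ▷ X ≫ act = (α_ A.X A.X X).hom ≫ A.X ◁ act ≫ act

/-- `A` as a left module over itself. -/
@[simps]
def LeftMod.regular (A : Mon C) : LeftMod A where
  X := A.X
  act := μ[A.X]
  one_act := one_mul A.X
  mul_act := mul_assoc A.X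

variable {A : Mon C}

/-- The morphism `M ⊗ A ⊗ N ⟶ M ⊗ N` given by the action on `N`. -/
def actOnRight (M : Bimod A A) (N : LeftMod A) : (M.X ⊗ A.X) ⊗ N.X ⟶ M.X ⊗ N.X :=
  (α_ M.X A.X N.X).hom ≫ M.X ◁ N.act

/-- The morphism `M ⊗ A ⊗ N ⟶ M ⊗ N` given by the action on `M`. -/
def actOnLeft (M : Bimod A A) (N : LeftMod A) : (M.X ⊗ A.X) ⊗ N.X ⟶ M.X ⊗ N.X :=
  M.actRight ▷ N.X

/-- The bimodule `M` is *tensorable* if the monoidal product of `C` preserves the coequalizers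
`M ⊗_A N` for all left modules `N`, as is implicit in the formation of the iterated tensor powers
of `M` over `A`. -/
class IsTensorable (M : Bimod A A) : Prop where
  preserves (N : LeftMod A) (X : C) :
    PreservesColimit (parallelPair (actOnRight M N) (actOnLeft M N)) (tensorLeft X)

instance (priority := 100) isTensorable_of_preserves
    [∀ X : C, PreservesColimitsOfShape WalkingParallelPair (tensorLeft X)] (M : Bimod A A) :
    IsTensorable M where
  preserves _ _ := inferInstance

attribute [instance] IsTensorable.preserves

variable [HasCoequalizers C]

/-- The underlying object of `M ⊗_A N`. -/
def relTensorX (M : Bimod A A) (N : LeftMod A) : C :=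
  coequalizer (actOnRight M N) (actOnLeft M N)

/-- The projection `M ⊗ N ⟶ M ⊗_A N`. -/
def relTensorπ (M : Bimod A A) (N : LeftMod A) : M.X ⊗ N.X ⟶ relTensorX M N :=
  coequalizer.π (actOnRight M N) (actOnLeft M N)

theorem relTensor_condition (M : Bimod A A) (N : LeftMod A) :
    actOnRight M N ≫ relTensorπ M N = actOnLeft M N ≫ relTensorπ M N :=
  coequalizer.condition _ _

instance (M : Bimod A A) (N : LeftMod A) : Epi (relTensorπ M N) :=
  inferInstanceAs (Epi (coequalizer.π (actOnRight M N) (actOnLeft M N)))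

/-- A bimodule is tensorable if, as a right module, it is a retract of some `X ⊗ A`: the
coequalizers `M ⊗_A N` are then split. -/
theorem isTensorable_of_retract (M : Bimod A A) (X : C) (s : M.X ⟶ X ⊗ A.X) (r : X ⊗ A.X ⟶ M.X)
    (h : s ≫ r = 𝟙 M.X)
    (hs : M.actRight ≫ s = s ▷ A.X ≫ (α_ X A.X A.X).hom ≫ X ◁ μ[A.X])
    (hr : r ▷ A.X ≫ M.actRight = (α_ X A.X A.X).hom ≫ X ◁ μ[A.X] ≫ r) : IsTensorable M where
  preserves N Y := by
    let j : X ⟶ M.X := (ρ_ X).inv ≫ X ◁ η[A.X] ≫ r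
    let t : M.X ⊗ N.X ⟶ (M.X ⊗ A.X) ⊗ N.X :=
      s ▷ N.X ≫ (α_ X A.X N.X).hom ≫ j ▷ (A.X ⊗ N.X) ≫ (α_ M.X A.X N.X).inv
    have hj : j ▷ A.X ≫ M.actRight = r := by
      have h1 := congrArg (fun k => X ◁ k) (one_mul A.X)
      simp only [whiskerLeft_comp] at h1
      simp only [j, comp_whiskerRight, Category.assoc, hr]
      calc _ = 𝟙 _ ⊗≫ (X ◁ η[A.X] ▷ A.X ≫ X ◁ μ[A.X]) ⊗≫ r := by monoidal
        _ = _ := by rw [h1]; monoidal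
    have t1 : t ≫ actOnLeft M N = 𝟙 _ := by
      calc _ = s ▷ N.X ≫ (j ▷ A.X ≫ M.actRight) ▷ N.X := by
            simp only [t, actOnLeft]; monoidal
        _ = (s ≫ r) ▷ N.X := by rw [hj, comp_whiskerRight]
        _ = _ := by rw [h, id_whiskerRight]
    have t2 : t ≫ actOnRight M N = s ▷ N.X ≫ (α_ X A.X N.X).hom ≫ X ◁ N.act ≫ j ▷ N.X := by
      have h1 := whisker_exchange j N.act
      rw [h1]; simp only [t, actOnRight]; monoidal
    have t3 : actOnRight M N ≫ t ≫ actOnRight M N = actOnLeft M N ≫ t ≫ actOnRight M N := by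
      have h1 := whisker_exchange s N.act
      have h2 := congrArg (fun k => X ◁ k) N.mul_act
      simp only [whiskerLeft_comp] at h2
      have h3 := congrArg (fun k => k ▷ N.X) hs
      simp only [comp_whiskerRight] at h3
      rw [t2]
      calc _ = (α_ M.X A.X N.X).hom ≫ (M.X ◁ N.act ≫ s ▷ N.X) ≫ (α_ X A.X N.X).hom ≫
              X ◁ N.act ≫ j ▷ N.X := by simp only [actOnRight]; monoidal
        _ = s ▷ A.X ▷ N.X ⊗≫ (X ◁ (α_ A.X A.X N.X).hom ≫ X ◁ A.X ◁ N.act ≫ X ◁ N.act) ≫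
              j ▷ N.X := by rw [h1]; monoidal
        _ = (s ▷ A.X ▷ N.X ≫ (α_ X A.X A.X).hom ▷ N.X ≫ (X ◁ μ[A.X]) ▷ N.X) ≫
              (α_ X A.X N.X).hom ≫ X ◁ N.act ≫ j ▷ N.X := by rw [← h2]; monoidal
        _ = _ := by rw [← h3]; simp only [actOnLeft]; monoidal
    have : HasSplitCoequalizer (actOnRight M N) (actOnLeft M N) :=
      ⟨⟨_, relTensorπ M N,
        ⟨{ rightSection := coequalizer.desc (t ≫ actOnRight M N) t3
           leftSection := t
           condition := relTensor_condition M N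
           rightSection_π := by
             rw [← cancel_epi (relTensorπ M N)]
             have := coequalizer.π_desc (t ≫ actOnRight M N) t3
             change coequalizer.π _ _ ≫ coequalizer.desc _ _ ≫ relTensorπ M N = _
             rw [reassoc_of% this, relTensor_condition, reassoc_of% t1, Category.comp_id]
           leftSection_bottom := t1
           leftSection_top := (coequalizer.π_desc (t ≫ actOnRight M N) t3).symm }⟩⟩⟩
    exact inferInstance

instance [Preadditive C] [MonoidalPreadditive C] (A : Mon C) : IsTensorable (omega A) :=
  isTensorable_of_retract (omega A) (A.X ⊗ A.X) (omegaσ A ≫ (α_ _ _ _).inv)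
    ((α_ _ _ _).hom ≫ omegaπ A)
    (((Category.assoc _ _ _).trans (congrArg (omegaσ A ≫ ·) (Iso.inv_hom_id_assoc _ _))).trans
      (omegaσ_π A))
    (by
      change (omegaσ A ▷ A.X ≫ freeR A A.X ≫ omegaπ A) ≫ omegaσ A ≫ (α_ _ _ _).inv =
        (omegaσ A ≫ (α_ A.X A.X A.X).inv) ▷ A.X ≫ (α_ (A.X ⊗ A.X) A.X A.X).hom ≫
          (A.X ⊗ A.X) ◁ μ[A.X]
      simp only [Category.assoc]
      have h : omegaσ A ▷ A.X ≫ freeR A A.X ≫ relSplit A = omegaσ A ▷ A.X ≫ freeR A A.X := by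
        rw [relSplit_right, ← comp_whiskerRight_assoc]
        congr 2
        have : Epi (omegaπ A) := inferInstance
        rw [← cancel_epi (omegaπ A), ← Category.assoc, omegaπ_σ]
        exact relSplit_comp A _ (rel_comp_relSplit A)
      have h2 := congrArg (fun k => k ≫ (α_ A.X A.X A.X).inv) h
      simp only [Category.assoc] at h2
      rw [← Category.assoc (omegaπ A), omegaπ_σ, h2, freeR]
      monoidal)
    (by
      change ((α_ _ _ _).hom ≫ omegaπ A) ▷ A.X ≫ omegaσ A ▷ A.X ≫ freeR A A.X ≫ omegaπ A =
        (α_ (A.X ⊗ A.X) A.X A.X).hom ≫ (A.X ⊗ A.X) ◁ μ[A.X] ≫ (α_ _ _ _).hom ≫ omegaπ A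
      have h := omegaπ_act_right A
      rw [comp_whiskerRight, Category.assoc, h, freeR]
      calc _ = 𝟙 _ ⊗≫ A.X ◁ A.X ◁ μ[A.X] ≫ omegaπ A := by monoidal
        _ = _ := by monoidal)


section

variable (M : Bimod A A) (N : LeftMod A) [IsTensorable M] (Y : C)

/-- `Y ⊗ (M ⊗_A N)` is again a coequalizer. -/
def relTensorIsColimitLeft := isColimitOfHasCoequalizerOfPreservesColimit (tensorLeft Y)
  (actOnRight M N) (actOnLeft M N)

instance : Epi (Y ◁ relTensorπ M N) := epi_of_isColimit_cofork (relTensorIsColimitLeft M N Y)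

variable {M N Y} in
/-- Morphisms out of `Y ⊗ (M ⊗_A N)`. -/
def relTensorDescLeft {Z : C} (k : Y ⊗ (M.X ⊗ N.X) ⟶ Z)
    (hk : Y ◁ actOnRight M N ≫ k = Y ◁ actOnLeft M N ≫ k) : Y ⊗ relTensorX M N ⟶ Z :=
  (Cofork.IsColimit.desc' (relTensorIsColimitLeft M N Y) k hk).1

variable {M N Y} in
theorem relTensorDescLeft_fac {Z : C} (k : Y ⊗ (M.X ⊗ N.X) ⟶ Z)
    (hk : Y ◁ actOnRight M N ≫ k = Y ◁ actOnLeft M N ≫ k) :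
    Y ◁ relTensorπ M N ≫ relTensorDescLeft k hk = k :=
  (Cofork.IsColimit.desc' (relTensorIsColimitLeft M N Y) k hk).2

variable [BraidedCategory C]

/-- `(M ⊗_A N) ⊗ Y` is again a coequalizer. -/
def relTensorIsColimitRight := isColimitOfHasCoequalizerOfPreservesColimit (tensorRight Y)
  (actOnRight M N) (actOnLeft M N)

instance : Epi (relTensorπ M N ▷ Y) := epi_of_isColimit_cofork (relTensorIsColimitRight M N Y)

variable {M N Y} in
/-- Morphisms out of `(M ⊗_A N) ⊗ Y`. -/
def relTensorDescRight {Z : C} (k : (M.X ⊗ N.X) ⊗ Y ⟶ Z)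
    (hk : actOnRight M N ▷ Y ≫ k = actOnLeft M N ▷ Y ≫ k) : relTensorX M N ⊗ Y ⟶ Z :=
  (Cofork.IsColimit.desc' (relTensorIsColimitRight M N Y) k hk).1

variable {M N Y} in
theorem relTensorDescRight_fac {Z : C} (k : (M.X ⊗ N.X) ⊗ Y ⟶ Z)
    (hk : actOnRight M N ▷ Y ≫ k = actOnLeft M N ▷ Y ≫ k) :
    relTensorπ M N ▷ Y ≫ relTensorDescRight k hk = k :=
  (Cofork.IsColimit.desc' (relTensorIsColimitRight M N Y) k hk).2

end

/-- The left action of `A` on `M ⊗_A N`. -/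
def relTensorAct (M : Bimod A A) (N : LeftMod A) [IsTensorable M] :
    A.X ⊗ relTensorX M N ⟶ relTensorX M N :=
  relTensorDescLeft ((α_ A.X M.X N.X).inv ≫ M.actLeft ▷ N.X ≫ relTensorπ M N) (by
    have h := relTensor_condition M N
    have h1 := congrArg (fun k => k ▷ N.X) M.middle_assoc
    simp only [comp_whiskerRight] at h1
    have h2 := whisker_exchange M.actLeft N.act
    calc _ = (α_ A.X (M.X ⊗ A.X) N.X).inv ≫ (α_ A.X M.X A.X).inv ▷ N.X ≫
            (α_ (A.X ⊗ M.X) A.X N.X).hom ≫ ((A.X ⊗ M.X) ◁ N.act ≫ M.actLeft ▷ N.X) ≫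
            relTensorπ M N := by simp only [actOnRight]; monoidal
      _ = (α_ A.X (M.X ⊗ A.X) N.X).inv ≫ (α_ A.X M.X A.X).inv ▷ N.X ≫
            M.actLeft ▷ A.X ▷ N.X ≫ actOnRight M N ≫ relTensorπ M N := by
          rw [h2]; simp only [actOnRight]; monoidal
      _ = (α_ A.X (M.X ⊗ A.X) N.X).inv ≫ (α_ A.X M.X A.X).inv ▷ N.X ≫
            (M.actLeft ▷ A.X ▷ N.X ≫ M.actRight ▷ N.X) ≫ relTensorπ M N := by
          rw [h, actOnLeft]; simp only [Category.assoc]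
      _ = _ := by rw [h1, actOnLeft]; monoidal)

theorem whiskerLeft_relTensorπ_act (M : Bimod A A) (N : LeftMod A) [IsTensorable M] :
    A.X ◁ relTensorπ M N ≫ relTensorAct M N =
      (α_ A.X M.X N.X).inv ≫ M.actLeft ▷ N.X ≫ relTensorπ M N :=
  relTensorDescLeft_fac _ _

/-- The left module `M ⊗_A N`. -/
def relTensor (M : Bimod A A) (N : LeftMod A) [IsTensorable M] : LeftMod A where
  X := relTensorX M N
  act := relTensorAct M N
  one_act := by
    rw [← cancel_epi (𝟙_ C ◁ relTensorπ M N), whisker_exchange_assoc, whiskerLeft_relTensorπ_act,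
      associator_inv_naturality_left_assoc, ← comp_whiskerRight_assoc, M.one_actLeft,
      leftUnitor_naturality]
    monoidal
  mul_act := by
    have h1 := congrArg (fun k => k ▷ N.X) M.left_assoc
    simp only [comp_whiskerRight] at h1
    rw [← cancel_epi ((A.X ⊗ A.X) ◁ relTensorπ M N), whisker_exchange_assoc,
      whiskerLeft_relTensorπ_act, associator_inv_naturality_left_assoc, reassoc_of% h1,
      associator_naturality_right_assoc, ← whiskerLeft_comp_assoc, whiskerLeft_relTensorπ_act]
    simp only [whiskerLeft_comp, Category.assoc, whiskerLeft_relTensorπ_act]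
    monoidal

/-- The tensor power `M ⊗_A (M ⊗_A (⋯ ⊗_A A))` with `n` factors `M`, as a left module; it is `A`
for `n = 0`. -/
def tensorPow (M : Bimod A A) [IsTensorable M] : ℕ → LeftMod A
  | 0 => LeftMod.regular A
  | n + 1 => relTensor M (tensorPow M n)

/-- The projection `M ⊗ M^{⊗_A n} ⟶ M^{⊗_A (n+1)}`. -/
def tensorPowπ (M : Bimod A A) [IsTensorable M] (n : ℕ) :
    M.X ⊗ (tensorPow M n).X ⟶ (tensorPow M (n + 1)).X :=
  relTensorπ M (tensorPow M n)


variable [HasCoproductsOfShape ℕ C] (M : Bimod A A) [IsTensorable M]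

/-- The underlying object `⨁ₙ M^{⊗_A n}` of the free `A`-algebra on `M`. -/
def freeAlgX : C := ∐ fun n => (tensorPow M n).X

/-- The inclusion of `M^{⊗_A n}`. -/
def freeAlgι (n : ℕ) : (tensorPow M n).X ⟶ freeAlgX M := Sigma.ι (fun n => (tensorPow M n).X) n

variable [∀ X : C, PreservesColimitsOfShape (Discrete ℕ) (tensorLeft X)]

/-- `Y ⊗ ⨁ₙ M^{⊗_A n}` is again a coproduct. -/
def freeAlgIsColimitLeft (Y : C) :=
  isColimitOfHasCoproductOfPreservesColimit (tensorLeft Y) (fun n => (tensorPow M n).X)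

variable {M} in
/-- Morphisms out of `Y ⊗ ⨁ₙ M^{⊗_A n}`. -/
def freeAlgDescLeft {Y Z : C} (k : ∀ n, Y ⊗ (tensorPow M n).X ⟶ Z) : Y ⊗ freeAlgX M ⟶ Z :=
  Cofan.IsColimit.desc (freeAlgIsColimitLeft M Y) k

variable {M} in
theorem freeAlgDescLeft_fac {Y Z : C} (k : ∀ n, Y ⊗ (tensorPow M n).X ⟶ Z) (n : ℕ) :
    Y ◁ freeAlgι M n ≫ freeAlgDescLeft k = k n :=
  Cofan.IsColimit.fac (freeAlgIsColimitLeft M Y) k n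

variable {M} in
theorem freeAlg_hom_ext_left {Y Z : C} {f g : Y ⊗ freeAlgX M ⟶ Z}
    (h : ∀ n, Y ◁ freeAlgι M n ≫ f = Y ◁ freeAlgι M n ≫ g) : f = g :=
  Cofan.IsColimit.hom_ext (freeAlgIsColimitLeft M Y) _ _ h

section

variable [BraidedCategory C]

/-- `(⨁ₙ M^{⊗_A n}) ⊗ Y` is again a coproduct. -/
def freeAlgIsColimitRight (Y : C) :=
  isColimitOfHasCoproductOfPreservesColimit (tensorRight Y) (fun n => (tensorPow M n).X)

variable {M} in
/-- Morphisms out of `(⨁ₙ M^{⊗_A n}) ⊗ Y`. -/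
def freeAlgDescRight {Y Z : C} (k : ∀ n, (tensorPow M n).X ⊗ Y ⟶ Z) : freeAlgX M ⊗ Y ⟶ Z :=
  Cofan.IsColimit.desc (freeAlgIsColimitRight M Y) k

variable {M} in
theorem freeAlgDescRight_fac {Y Z : C} (k : ∀ n, (tensorPow M n).X ⊗ Y ⟶ Z) (n : ℕ) :
    freeAlgι M n ▷ Y ≫ freeAlgDescRight k = k n :=
  Cofan.IsColimit.fac (freeAlgIsColimitRight M Y) k n

variable {M} in
theorem freeAlg_hom_ext_right {Y Z : C} {f g : freeAlgX M ⊗ Y ⟶ Z}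
    (h : ∀ n, freeAlgι M n ▷ Y ≫ f = freeAlgι M n ▷ Y ≫ g) : f = g :=
  Cofan.IsColimit.hom_ext (freeAlgIsColimitRight M Y) _ _ h

end

/-- The left action of `A` on `⨁ₙ M^{⊗_A n}`. -/
def freeAlgAct : A.X ⊗ freeAlgX M ⟶ freeAlgX M :=
  freeAlgDescLeft fun n => (tensorPow M n).act ≫ freeAlgι M n

/-- The product `M ⊗ ⨁ₙ M^{⊗_A n} ⟶ ⨁ₙ M^{⊗_A n}` by an element of `M` on the left. -/
def freeAlgShift : M.X ⊗ freeAlgX M ⟶ freeAlgX M :=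
  freeAlgDescLeft fun n => tensorPowπ M n ≫ freeAlgι M (n + 1)

theorem freeAlgι_act (n : ℕ) :
    A.X ◁ freeAlgι M n ≫ freeAlgAct M = (tensorPow M n).act ≫ freeAlgι M n :=
  freeAlgDescLeft_fac _ n

theorem freeAlgι_shift (n : ℕ) :
    M.X ◁ freeAlgι M n ≫ freeAlgShift M = tensorPowπ M n ≫ freeAlgι M (n + 1) :=
  freeAlgDescLeft_fac _ n

/-- `⨁ₙ M^{⊗_A n}` as a left module. -/
@[simps]
def freeAlgLeftMod : LeftMod A where
  X := freeAlgX M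
  act := freeAlgAct M
  one_act := freeAlg_hom_ext_left fun n => by
    rw [whisker_exchange_assoc, freeAlgι_act, reassoc_of% (tensorPow M n).one_act,
      leftUnitor_naturality]
  mul_act := freeAlg_hom_ext_left fun n => by
    rw [whisker_exchange_assoc, freeAlgι_act, reassoc_of% (tensorPow M n).mul_act,
      associator_naturality_right_assoc, ← whiskerLeft_comp_assoc, freeAlgι_act,
      whiskerLeft_comp_assoc, freeAlgι_act]

theorem whiskerLeft_tensorPowπ_act (n : ℕ) :
    A.X ◁ tensorPowπ M n ≫ (tensorPow M (n + 1)).act =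
      (α_ A.X M.X _).inv ≫ M.actLeft ▷ _ ≫ tensorPowπ M n :=
  whiskerLeft_relTensorπ_act M (tensorPow M n)

theorem tensorPow_condition (n : ℕ) :
    (α_ M.X A.X _).hom ≫ M.X ◁ (tensorPow M n).act ≫ tensorPowπ M n =
      M.actRight ▷ _ ≫ tensorPowπ M n :=
  ((Category.assoc _ _ _).symm.trans (relTensor_condition M (tensorPow M n)) :)

theorem freeAlgShift_act :
    A.X ◁ freeAlgShift M ≫ freeAlgAct M =
      (α_ A.X M.X _).inv ≫ M.actLeft ▷ _ ≫ freeAlgShift M := by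
  rw [← cancel_epi (α_ A.X M.X _).hom]
  refine freeAlg_hom_ext_left fun n => ?_
  rw [associator_naturality_right_assoc, ← whiskerLeft_comp_assoc, freeAlgι_shift,
    whiskerLeft_comp_assoc, freeAlgι_act, reassoc_of% (whiskerLeft_tensorPowπ_act M n),
    Iso.hom_inv_id_assoc, Iso.hom_inv_id_assoc, whisker_exchange_assoc, freeAlgι_shift]

theorem freeAlgShift_balanced :
    (α_ M.X A.X _).hom ≫ M.X ◁ freeAlgAct M ≫ freeAlgShift M =
      M.actRight ▷ _ ≫ freeAlgShift M := by
  refine freeAlg_hom_ext_left fun n => ?_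
  rw [associator_naturality_right_assoc, ← whiskerLeft_comp_assoc, freeAlgι_act,
    whiskerLeft_comp_assoc, freeAlgι_shift, reassoc_of% (tensorPow_condition M n), whisker_exchange_assoc,
    freeAlgι_shift]

variable [BraidedCategory C]

theorem epi_whisker_both {P Q : C} (f : P ⟶ Q) (h : ∀ Y : C, Epi (Y ◁ f)) (Y Z : C) :
    Epi ((Y ◁ f) ▷ Z) := by
  have h1 : f ▷ Z = (β_ P Z).hom ≫ Z ◁ f ≫ (β_ Q Z).inv := by
    rw [← BraidedCategory.braiding_naturality_left_assoc, Iso.hom_inv_id, Category.comp_id]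
  have h2 : (Y ◁ f) ▷ Z = (α_ Y P Z).hom ≫ Y ◁ (β_ P Z).hom ≫ (α_ Y Z P).inv ≫
      (Y ⊗ Z) ◁ f ≫ (α_ Y Z Q).hom ≫ Y ◁ (β_ Q Z).inv ≫ (α_ Y Q Z).inv := by
    rw [whisker_assoc, h1]
    simp only [whiskerLeft_comp, Category.assoc]
    monoidal
  have := h (Y ⊗ Z)
  rw [h2]
  infer_instance

variable {M} in
theorem freeAlg_hom_ext_mid {Y Z W : C} {f g : (Y ⊗ freeAlgX M) ⊗ Z ⟶ W}
    (h : ∀ n, (Y ◁ freeAlgι M n) ▷ Z ≫ f = (Y ◁ freeAlgι M n) ▷ Z ≫ g) : f = g := by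
  rw [← cancel_epi (Y ◁ (β_ (freeAlgX M) Z).inv ≫ (α_ Y (freeAlgX M) Z).inv),
    ← cancel_epi (α_ Y Z (freeAlgX M)).hom]
  refine freeAlg_hom_ext_left fun n => ?_
  have h1 : (Y ⊗ Z) ◁ freeAlgι M n ≫ (α_ Y Z (freeAlgX M)).hom ≫
      Y ◁ (β_ (freeAlgX M) Z).inv ≫ (α_ Y (freeAlgX M) Z).inv =
      (α_ Y Z _).hom ≫ Y ◁ (β_ _ Z).inv ≫ (α_ Y _ Z).inv ≫ (Y ◁ freeAlgι M n) ▷ Z := by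
    rw [associator_naturality_right_assoc, ← whiskerLeft_comp_assoc,
      BraidedCategory.braiding_inv_naturality_right, whiskerLeft_comp_assoc,
      associator_inv_naturality_middle]
  have := congrArg (fun k => ((α_ Y Z _).hom ≫ Y ◁ (β_ _ Z).inv ≫ (α_ Y _ Z).inv) ≫ k) (h n)
  simp only [Category.assoc] at this h1 ⊢
  rw [reassoc_of% h1, reassoc_of% h1, this]

instance (n : ℕ) (Y : C) : Epi (tensorPowπ M n ▷ Y) :=
  inferInstanceAs (Epi (relTensorπ M (tensorPow M n) ▷ Y))

instance (n : ℕ) (Y : C) : Epi (Y ◁ tensorPowπ M n) :=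
  inferInstanceAs (Epi (Y ◁ relTensorπ M (tensorPow M n)))

/-- The product `M^{⊗_A (n+1)} ⊗ ⨁ₙ M^{⊗_A n} ⟶ ⨁ₙ M^{⊗_A n}`, from the one on `M^{⊗_A n}`. -/
def freeAlgMulStep (n : ℕ) (a : (tensorPow M n).X ⊗ freeAlgX M ⟶ freeAlgX M)
    (h : (tensorPow M n).act ▷ _ ≫ a = (α_ A.X _ _).hom ≫ A.X ◁ a ≫ freeAlgAct M) :
    (tensorPow M (n + 1)).X ⊗ freeAlgX M ⟶ freeAlgX M :=
  relTensorDescRight ((α_ M.X _ _).hom ≫ M.X ◁ a ≫ freeAlgShift M) (by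
    have h1 := congrArg (fun k => M.X ◁ k) h
    simp only [whiskerLeft_comp] at h1
    have h2 := freeAlgShift_balanced M
    have h3 := whisker_exchange M.actRight a
    calc _ = 𝟙 _ ⊗≫ (M.X ◁ (tensorPow M n).act ▷ _ ≫ M.X ◁ a) ≫ freeAlgShift M := by
          simp only [actOnRight]; monoidal
      _ = ((α_ _ _ _).hom ≫ (M.X ⊗ A.X) ◁ a) ≫
          ((α_ M.X A.X _).hom ≫ M.X ◁ freeAlgAct M ≫ freeAlgShift M) := by
          rw [h1]; monoidal
      _ = (α_ _ _ _).hom ≫ ((M.X ⊗ A.X) ◁ a ≫ M.actRight ▷ _) ≫ freeAlgShift M := by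
          rw [h2]; simp only [Category.assoc]
      _ = _ := by rw [h3]; simp only [actOnLeft]; monoidal)

theorem tensorPowπ_mulStep (n : ℕ) (a : (tensorPow M n).X ⊗ freeAlgX M ⟶ freeAlgX M)
    (h : (tensorPow M n).act ▷ _ ≫ a = (α_ A.X _ _).hom ≫ A.X ◁ a ≫ freeAlgAct M) :
    tensorPowπ M n ▷ _ ≫ freeAlgMulStep M n a h =
      (α_ M.X _ _).hom ≫ M.X ◁ a ≫ freeAlgShift M :=
  relTensorDescRight_fac (M := M) (N := tensorPow M n) _ _

theorem freeAlgMulStep_act (n : ℕ) (a : (tensorPow M n).X ⊗ freeAlgX M ⟶ freeAlgX M)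
    (h : (tensorPow M n).act ▷ _ ≫ a = (α_ A.X _ _).hom ≫ A.X ◁ a ≫ freeAlgAct M) :
    (tensorPow M (n + 1)).act ▷ _ ≫ freeAlgMulStep M n a h =
      (α_ A.X _ _).hom ≫ A.X ◁ freeAlgMulStep M n a h ≫ freeAlgAct M := by
  have : Epi ((A.X ◁ tensorPowπ M n) ▷ freeAlgX M) :=
    epi_whisker_both _ (fun Y => inferInstance) _ _
  rw [← cancel_epi ((A.X ◁ tensorPowπ M n) ▷ freeAlgX M), ← comp_whiskerRight_assoc,
    whiskerLeft_tensorPowπ_act]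
  have h1 := whisker_exchange M.actLeft a
  have h2 := freeAlgShift_act M
  have h3 := tensorPowπ_mulStep M n a h
  have h4 := congrArg (fun k => A.X ◁ k) h3
  simp only [whiskerLeft_comp] at h4
  calc _ = (α_ A.X M.X _).inv ▷ _ ≫ M.actLeft ▷ _ ▷ _ ≫
        (tensorPowπ M n ▷ _ ≫ freeAlgMulStep M n a h) := by
        simp only [comp_whiskerRight, Category.assoc]
    _ = (α_ A.X M.X _).inv ▷ _ ≫ (α_ (A.X ⊗ M.X) _ _).hom ≫
        (M.actLeft ▷ _ ≫ M.X ◁ a) ≫ freeAlgShift M := by rw [h3]; monoidal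
    _ = (α_ A.X (M.X ⊗ (tensorPow M n).X) (freeAlgX M)).hom ≫ A.X ◁ (α_ M.X _ _).hom ≫
        A.X ◁ M.X ◁ a ≫ (α_ A.X M.X _).inv ≫ M.actLeft ▷ _ ≫ freeAlgShift M := by
        rw [← h1]; monoidal
    _ = (α_ A.X (M.X ⊗ (tensorPow M n).X) (freeAlgX M)).hom ≫ (A.X ◁ (α_ M.X _ _).hom ≫
        A.X ◁ M.X ◁ a ≫ A.X ◁ freeAlgShift M) ≫ freeAlgAct M := by
        rw [← h2]; simp only [Category.assoc]
    _ = _ := by rw [← h4]; monoidal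

/-- The product `M^{⊗_A n} ⊗ ⨁ₙ M^{⊗_A n} ⟶ ⨁ₙ M^{⊗_A n}`, a morphism of left modules. -/
def freeAlgMulAux : ∀ n : ℕ, { a : (tensorPow M n).X ⊗ freeAlgX M ⟶ freeAlgX M //
    (tensorPow M n).act ▷ _ ≫ a = (α_ A.X _ _).hom ≫ A.X ◁ a ≫ freeAlgAct M }
  | 0 => ⟨freeAlgAct M, (freeAlgLeftMod M).mul_act⟩
  | n + 1 => ⟨freeAlgMulStep M n (freeAlgMulAux n).1 (freeAlgMulAux n).2,
      freeAlgMulStep_act M n (freeAlgMulAux n).1 (freeAlgMulAux n).2⟩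

/-- The product of the free algebra. -/
def freeAlgMul : freeAlgX M ⊗ freeAlgX M ⟶ freeAlgX M :=
  freeAlgDescRight fun n => (freeAlgMulAux M n).1

/-- The inclusion of `A` into the free algebra. -/
def freeAlgInl : A.X ⟶ freeAlgX M := freeAlgι M 0

theorem freeAlgInl_act : A.X ◁ freeAlgInl M ≫ freeAlgAct M = μ[A.X] ≫ freeAlgInl M :=
  freeAlgDescLeft_fac _ 0

theorem freeAlgInl_mul : freeAlgInl M ▷ _ ≫ freeAlgMul M = freeAlgAct M :=
  freeAlgDescRight_fac _ 0

theorem freeAlgι_mul (n : ℕ) : freeAlgι M n ▷ _ ≫ freeAlgMul M = (freeAlgMulAux M n).1 :=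
  freeAlgDescRight_fac _ n

theorem tensorPowπ_mulAux (n : ℕ) : tensorPowπ M n ▷ _ ≫ (freeAlgMulAux M (n + 1)).1 =
    (α_ M.X _ _).hom ≫ M.X ◁ (freeAlgMulAux M n).1 ≫ freeAlgShift M :=
  tensorPowπ_mulStep M n (freeAlgMulAux M n).1 (freeAlgMulAux M n).2

theorem freeAlgAct_mul :
    freeAlgAct M ▷ _ ≫ freeAlgMul M =
      (α_ A.X _ _).hom ≫ A.X ◁ freeAlgMul M ≫ freeAlgAct M := by
  refine freeAlg_hom_ext_mid fun n => ?_
  have h1 : (A.X ◁ freeAlgι M n) ▷ freeAlgX M ≫ freeAlgAct M ▷ freeAlgX M =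
      (tensorPow M n).act ▷ _ ≫ freeAlgι M n ▷ _ := by
    rw [← comp_whiskerRight, freeAlgι_act, comp_whiskerRight]
  have h2 : A.X ◁ freeAlgι M n ▷ freeAlgX M ≫ A.X ◁ freeAlgMul M =
      A.X ◁ (freeAlgMulAux M n).1 := by
    rw [← whiskerLeft_comp, freeAlgι_mul]
  rw [reassoc_of% h1, freeAlgι_mul, (freeAlgMulAux M n).2, associator_naturality_middle_assoc,
    reassoc_of% h2]

theorem freeAlgShift_mul :
    freeAlgShift M ▷ _ ≫ freeAlgMul M =
      (α_ M.X _ _).hom ≫ M.X ◁ freeAlgMul M ≫ freeAlgShift M := by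
  refine freeAlg_hom_ext_mid fun n => ?_
  have h1 : (M.X ◁ freeAlgι M n) ▷ freeAlgX M ≫ freeAlgShift M ▷ freeAlgX M =
      tensorPowπ M n ▷ _ ≫ freeAlgι M (n + 1) ▷ _ := by
    rw [← comp_whiskerRight, freeAlgι_shift, comp_whiskerRight]
  have h2 : M.X ◁ freeAlgι M n ▷ freeAlgX M ≫ M.X ◁ freeAlgMul M =
      M.X ◁ (freeAlgMulAux M n).1 := by
    rw [← whiskerLeft_comp, freeAlgι_mul]
  rw [reassoc_of% h1, freeAlgι_mul, tensorPowπ_mulAux, associator_naturality_middle_assoc,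
    reassoc_of% h2]

theorem freeAlgMulAux_one (n : ℕ) :
    (tensorPow M n).X ◁ (η[A.X] ≫ freeAlgInl M) ≫ (freeAlgMulAux M n).1 =
      (ρ_ _).hom ≫ freeAlgι M n := by
  induction n with
  | zero =>
    change A.X ◁ (η[A.X] ≫ freeAlgInl M) ≫ freeAlgAct M = (ρ_ _).hom ≫ freeAlgInl M
    rw [whiskerLeft_comp, Category.assoc, freeAlgInl_act, mul_one_assoc]
  | succ n ih =>
    rw [← cancel_epi (tensorPowπ M n ▷ 𝟙_ C), ← whisker_exchange_assoc, tensorPowπ_mulAux,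
      associator_naturality_right_assoc, ← whiskerLeft_comp_assoc, ih, whiskerLeft_comp_assoc,
      freeAlgι_shift, rightUnitor_naturality_assoc]
    monoidal

theorem freeAlgMulAux_assoc (n : ℕ) :
    (freeAlgMulAux M n).1 ▷ _ ≫ freeAlgMul M =
      (α_ _ _ _).hom ≫ (tensorPow M n).X ◁ freeAlgMul M ≫ (freeAlgMulAux M n).1 := by
  induction n with
  | zero => exact freeAlgAct_mul M
  | succ n ih =>
    have : Epi (tensorPowπ M n ▷ freeAlgX M ▷ freeAlgX M) := by
      have h0 : tensorPowπ M n ▷ freeAlgX M ▷ freeAlgX M =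
          (α_ _ _ _).hom ≫ tensorPowπ M n ▷ (freeAlgX M ⊗ freeAlgX M) ≫ (α_ _ _ _).inv := by
        monoidal
      rw [h0]
      infer_instance
    rw [← cancel_epi (tensorPowπ M n ▷ freeAlgX M ▷ freeAlgX M), ← comp_whiskerRight_assoc,
      tensorPowπ_mulAux]
    have h1 := congrArg (fun k => M.X ◁ k) ih
    simp only [whiskerLeft_comp] at h1
    have h2 := freeAlgShift_mul M
    calc _ = (α_ M.X _ _).hom ▷ _ ≫ (M.X ◁ (freeAlgMulAux M n).1) ▷ _ ≫
          (freeAlgShift M ▷ _ ≫ freeAlgMul M) := by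
          simp only [comp_whiskerRight, Category.assoc]
      _ = (α_ M.X _ _).hom ▷ _ ≫ (α_ M.X _ _).hom ≫
          (M.X ◁ (freeAlgMulAux M n).1 ▷ _ ≫ M.X ◁ freeAlgMul M) ≫ freeAlgShift M := by
          rw [h2]; monoidal
      _ = (α_ _ _ _).hom ≫ (M.X ⊗ (tensorPow M n).X) ◁ freeAlgMul M ≫
          ((α_ M.X _ _).hom ≫ M.X ◁ (freeAlgMulAux M n).1 ≫ freeAlgShift M) := by
          rw [h1]; monoidal
      _ = _ := by
          rw [← tensorPowπ_mulAux, whisker_exchange_assoc]; monoidal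

/-- The free `A`-algebra `T_A(M) = ⨁ₙ M^{⊗_A n}` on a bimodule `M`. -/
def freeAlg : Mon C where
  X := freeAlgX M
  mon :=
    { one := η[A.X] ≫ freeAlgInl M
      mul := freeAlgMul M
      one_mul := by
        rw [comp_whiskerRight, Category.assoc, freeAlgInl_mul]
        exact (freeAlgLeftMod M).one_act
      mul_one := by
        refine freeAlg_hom_ext_right fun n => ?_
        rw [← whisker_exchange_assoc, freeAlgι_mul, rightUnitor_naturality, freeAlgMulAux_one]
      mul_assoc := by
        have h : ∀ n, freeAlgι M n ▷ freeAlgX M ▷ freeAlgX M ≫ freeAlgMul M ▷ _ ≫ freeAlgMul M =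
            freeAlgι M n ▷ freeAlgX M ▷ freeAlgX M ≫ (α_ _ _ _).hom ≫ _ ◁ freeAlgMul M ≫
              freeAlgMul M := fun n => by
          rw [← comp_whiskerRight_assoc, freeAlgι_mul, freeAlgMulAux_assoc,
            associator_naturality_left_assoc, ← whisker_exchange_assoc, freeAlgι_mul]
        rw [← cancel_epi (α_ (freeAlgX M) (freeAlgX M) (freeAlgX M)).inv]
        refine freeAlg_hom_ext_right fun n => ?_
        rw [associator_inv_naturality_left_assoc, h, associator_inv_naturality_left_assoc] }

/-- The inclusion `M ⟶ T_A(M)`. -/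
def freeAlgInr : M.X ⟶ (freeAlg M).X :=
  (ρ_ M.X).inv ≫ M.X ◁ η[A.X] ≫ tensorPowπ M 0 ≫ freeAlgι M 1

end FreeAlgebra

section DoubleBrackets

variable {C : Type u} [Category.{v} C] [MonoidalCategory C] [SymmetricCategory C]

/-- `Σ τ_{X,Y} : ΣX ⊗ Y ⟶ ΣY ⊗ X`. -/
def sigmaTau (S X Y : C) : (S ⊗ X) ⊗ Y ⟶ (S ⊗ Y) ⊗ X :=
  (α_ S X Y).hom ≫ S ◁ (β_ X Y).hom ≫ (α_ S Y X).inv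

/-- `Σ τ_{X ⊗ Y, Z} : ΣX ⊗ Y ⊗ Z ⟶ ΣZ ⊗ X ⊗ Y`. -/
def sigmaRotR (S X Y Z : C) : ((S ⊗ X) ⊗ Y) ⊗ Z ⟶ ((S ⊗ Z) ⊗ X) ⊗ Y :=
  𝟙 _ ⊗≫ S ◁ (β_ (X ⊗ Y) Z).hom ⊗≫ 𝟙 _

/-- `Σ τ_{X, Y ⊗ Z} : ΣX ⊗ Y ⊗ Z ⟶ ΣY ⊗ Z ⊗ X`. -/
def sigmaRotL (S X Y Z : C) : ((S ⊗ X) ⊗ Y) ⊗ Z ⟶ ((S ⊗ Y) ⊗ Z) ⊗ X :=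
  𝟙 _ ⊗≫ S ◁ (β_ X (Y ⊗ Z)).hom ⊗≫ 𝟙 _

/-- `τ_{X ⊗ Y, Z} : X ⊗ Y ⊗ Z ⟶ Z ⊗ X ⊗ Y`. -/
def cycR (X Y Z : C) : X ⊗ (Y ⊗ Z) ⟶ Z ⊗ (X ⊗ Y) :=
  (α_ X Y Z).inv ≫ (β_ (X ⊗ Y) Z).hom

/-- `τ_{X, Y ⊗ Z} : X ⊗ Y ⊗ Z ⟶ Y ⊗ Z ⊗ X`. -/
def cycL (X Y Z : C) : X ⊗ (Y ⊗ Z) ⟶ Y ⊗ (Z ⊗ X) :=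
  (β_ X (Y ⊗ Z)).hom ≫ (α_ Y Z X).hom

/-- The composite `(g ⊗ W) ∘ (X ⊗ h) : X ⊗ Y ⊗ Z ⟶ P ⊗ W`, of the form
`x ⊗ y ⊗ z ↦ g (x ⊗ h(y, z)') ⊗ h(y, z)''`. -/
def nest {X Y Z U W P : C} (g : X ⊗ U ⟶ P) (h : Y ⊗ Z ⟶ U ⊗ W) : X ⊗ (Y ⊗ Z) ⟶ P ⊗ W :=
  X ◁ h ≫ (α_ X U W).inv ≫ g ▷ W

/-- The left action `R ⊗ ΣP ⟶ ΣP'` induced by a morphism `R ⊗ P ⟶ P'`. -/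
def suspLeft (S : C) {R P P' : C} (l : R ⊗ P ⟶ P') : R ⊗ (S ⊗ P) ⟶ S ⊗ P' :=
  (α_ R S P).inv ≫ (β_ R S).hom ▷ P ≫ (α_ S R P).hom ≫ S ◁ l

/-- The right action `ΣP ⊗ R ⟶ ΣP'` induced by a morphism `P ⊗ R ⟶ P'`. -/
def suspRight (S : C) {R P P' : C} (r : P ⊗ R ⟶ P') : (S ⊗ P) ⊗ R ⟶ S ⊗ P' :=
  (α_ S P R).hom ≫ S ◁ r

/-- The external left action `R ⊗ (ΣP ⊗ Q) ⟶ ΣP' ⊗ Q`, by an action `R ⊗ P ⟶ P'`. -/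
def extLeft (S : C) {R P P' : C} (l : R ⊗ P ⟶ P') (Q : C) : R ⊗ ((S ⊗ P) ⊗ Q) ⟶ (S ⊗ P') ⊗ Q :=
  (α_ R (S ⊗ P) Q).inv ≫ suspLeft S l ▷ Q

/-- The external right action `(ΣP ⊗ Q) ⊗ R ⟶ ΣP ⊗ Q'`, by an action `Q ⊗ R ⟶ Q'`. -/
def extRight (S P : C) {R Q Q' : C} (r : Q ⊗ R ⟶ Q') : ((S ⊗ P) ⊗ Q) ⊗ R ⟶ (S ⊗ P) ⊗ Q' :=
  (α_ (S ⊗ P) Q R).hom ≫ (S ⊗ P) ◁ r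

/-- The internal left action on `ΣP ⊗ Q`, by a left action on `Q`. -/
def intLeft (S P : C) {R Q : C} (l : R ⊗ Q ⟶ Q) : R ⊗ ((S ⊗ P) ⊗ Q) ⟶ (S ⊗ P) ⊗ Q :=
  (α_ R (S ⊗ P) Q).inv ≫ (β_ R (S ⊗ P)).hom ▷ Q ≫ (α_ (S ⊗ P) R Q).hom ≫ (S ⊗ P) ◁ l

/-- The internal right action on `ΣP ⊗ Q`, by a right action on `P`. -/
def intRight (S : C) {R P : C} (r : P ⊗ R ⟶ P) (Q : C) : ((S ⊗ P) ⊗ Q) ⊗ R ⟶ (S ⊗ P) ⊗ Q :=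
  (α_ (S ⊗ P) Q R).hom ≫ (S ⊗ P) ◁ (β_ Q R).hom ≫ (α_ (S ⊗ P) R Q).inv ≫ suspRight S r ▷ Q

/-- `Σ(R ⊗ P) ⊗ Y ⟶ R ⊗ (ΣP ⊗ Y)`, moving `R` to the front. -/
def pullLeft₁ (S R P Y : C) : (S ⊗ (R ⊗ P)) ⊗ Y ⟶ R ⊗ ((S ⊗ P) ⊗ Y) :=
  𝟙 _ ⊗≫ (β_ S R).hom ▷ (P ⊗ Y) ⊗≫ 𝟙 _

/-- `Σ(P ⊗ R) ⊗ Y ⟶ (ΣP ⊗ Y) ⊗ R`, moving `R` to the end. -/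
def pullRight₁ (S P R Y : C) : (S ⊗ (P ⊗ R)) ⊗ Y ⟶ ((S ⊗ P) ⊗ Y) ⊗ R :=
  𝟙 _ ⊗≫ (S ⊗ P) ◁ (β_ R Y).hom ⊗≫ 𝟙 _

/-- `X ⊗ Σ(R ⊗ P) ⟶ R ⊗ (X ⊗ ΣP)`, moving `R` to the front. -/
def pullLeft₂ (X S R P : C) : X ⊗ (S ⊗ (R ⊗ P)) ⟶ R ⊗ (X ⊗ (S ⊗ P)) :=
  𝟙 _ ⊗≫ (β_ (X ⊗ S) R).hom ▷ P ⊗≫ 𝟙 _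

/-- The associator `X ⊗ Σ(P ⊗ R) ⟶ (X ⊗ ΣP) ⊗ R`. -/
def pullRight₂ (X S P R : C) : X ⊗ (S ⊗ (P ⊗ R)) ⟶ (X ⊗ (S ⊗ P)) ⊗ R :=
  X ◁ (α_ S P R).inv ≫ (α_ X (S ⊗ P) R).inv

variable [Preadditive C]

/-- `f : ΣA ⊗ ΣA ⟶ ΣA ⊗ A` is a `Σ`-double Poisson bracket on the monoid `A`. -/
structure IsDoublePoisson (S : C) (A : Mon C)
    (f : (S ⊗ A.X) ⊗ (S ⊗ A.X) ⟶ (S ⊗ A.X) ⊗ A.X) : Prop where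
  antisymm : f = -((β_ (S ⊗ A.X) (S ⊗ A.X)).hom ≫ f ≫ sigmaTau S A.X A.X)
  /-- `f` is a derivation in the first variable, for the internal bimodule structure. -/
  left_derivation : (S ◁ μ[A.X]) ▷ (S ⊗ A.X) ≫ f =
    pullLeft₁ S A.X A.X (S ⊗ A.X) ≫ A.X ◁ f ≫ intLeft S A.X μ[A.X] +
      pullRight₁ S A.X A.X (S ⊗ A.X) ≫ f ▷ A.X ≫ intRight S μ[A.X] A.X
  jacobi : nest f f +
      cycR (S ⊗ A.X) (S ⊗ A.X) (S ⊗ A.X) ≫ nest f f ≫ sigmaRotL S A.X A.X A.X +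
      cycL (S ⊗ A.X) (S ⊗ A.X) (S ⊗ A.X) ≫ nest f f ≫ sigmaRotR S A.X A.X A.X = 0

section LieRinehart

variable {A : Mon C} {M : Bimod A A}

/-- `ρ : ΣM ⊗ ΣA ⟶ ΣA ⊗ A` is a morphism of `A`-bimodules, for the structure induced by the one of
`M` on the source and the internal one on the target. -/
structure IsAnchorLinear (S : C) (ρ : (S ⊗ M.X) ⊗ (S ⊗ A.X) ⟶ (S ⊗ A.X) ⊗ A.X) : Prop where
  left : extLeft S M.actLeft (S ⊗ A.X) ≫ ρ = A.X ◁ ρ ≫ intLeft S A.X μ[A.X]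
  right : intRight S M.actRight (S ⊗ A.X) ≫ ρ = ρ ▷ A.X ≫ intRight S μ[A.X] A.X

/-- `ρ : ΣM ⊗ ΣA ⟶ ΣA ⊗ A` is an anchor: a morphism of bimodules, and a derivation in the second
variable for the external bimodule structure. -/
structure IsAnchor (S : C) (ρ : (S ⊗ M.X) ⊗ (S ⊗ A.X) ⟶ (S ⊗ A.X) ⊗ A.X) : Prop where
  linear : IsAnchorLinear S ρ
  derivation : (S ⊗ M.X) ◁ S ◁ μ[A.X] ≫ ρ =
    pullLeft₂ (S ⊗ M.X) S A.X A.X ≫ A.X ◁ ρ ≫ extLeft S μ[A.X] A.X +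
      pullRight₂ (S ⊗ M.X) S A.X A.X ≫ ρ ▷ A.X ≫ extRight S A.X μ[A.X]

/-- `ρ_τ = - Στ ∘ ρ ∘ τ : ΣA ⊗ ΣM ⟶ ΣA ⊗ A`. -/
def anchorTau (S : C) (ρ : (S ⊗ M.X) ⊗ (S ⊗ A.X) ⟶ (S ⊗ A.X) ⊗ A.X) :
    (S ⊗ A.X) ⊗ (S ⊗ M.X) ⟶ (S ⊗ A.X) ⊗ A.X :=
  -((β_ (S ⊗ A.X) (S ⊗ M.X)).hom ≫ ρ ≫ sigmaTau S A.X A.X)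

variable [HasBinaryBiproducts C]

/-- The component in `ΣM ⊗ A` of a morphism to `Σ(M ⊗ A ⊕ A ⊗ M)`. -/
def compL {S X : C} (B : X ⟶ S ⊗ ((M.X ⊗ A.X) ⊞ (A.X ⊗ M.X))) : X ⟶ (S ⊗ M.X) ⊗ A.X :=
  B ≫ S ◁ biprod.fst ≫ (α_ S M.X A.X).inv

/-- The component in `ΣA ⊗ M` of a morphism to `Σ(M ⊗ A ⊕ A ⊗ M)`. -/
def compR {S X : C} (B : X ⟶ S ⊗ ((M.X ⊗ A.X) ⊞ (A.X ⊗ M.X))) : X ⟶ (S ⊗ A.X) ⊗ M.X :=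
  B ≫ S ◁ biprod.snd ≫ (α_ S A.X M.X).inv

/-- Antisymmetry of a bracket `ΣM ⊗ ΣM ⟶ Σ(M ⊗ A ⊕ A ⊗ M)`. -/
def IsAntisymm (S : C) (B : (S ⊗ M.X) ⊗ (S ⊗ M.X) ⟶ S ⊗ ((M.X ⊗ A.X) ⊞ (A.X ⊗ M.X))) : Prop :=
  (β_ (S ⊗ M.X) (S ⊗ M.X)).hom ≫ B =
    -(B ≫ S ◁ biprod.lift (biprod.snd ≫ (β_ A.X M.X).hom) (biprod.fst ≫ (β_ M.X A.X).hom))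

/-- The derivation property of `B : ΣM ⊗ ΣM ⟶ Σ(M ⊗ A ⊕ A ⊗ M)` in the second variable with respect
to the anchor `ρ`, written in components. In terms of elements it says
`B(m, a m') = a B(m, m') + ρ(m, a) m'` and `B(m, m' a) = B(m, m') a + m' ρ(m, a)`. -/
structure IsAnchorDerivation (S : C) (ρ : (S ⊗ M.X) ⊗ (S ⊗ A.X) ⟶ (S ⊗ A.X) ⊗ A.X)
    (B : (S ⊗ M.X) ⊗ (S ⊗ M.X) ⟶ S ⊗ ((M.X ⊗ A.X) ⊞ (A.X ⊗ M.X))) : Prop where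
  left_compL : (S ⊗ M.X) ◁ S ◁ M.actLeft ≫ compL B =
    pullLeft₂ (S ⊗ M.X) S A.X M.X ≫ A.X ◁ compL B ≫ extLeft S M.actLeft A.X
  left_compR : (S ⊗ M.X) ◁ S ◁ M.actLeft ≫ compR B =
    pullRight₂ (S ⊗ M.X) S A.X M.X ≫ ρ ▷ M.X ≫ extRight S A.X M.actLeft +
      pullLeft₂ (S ⊗ M.X) S A.X M.X ≫ A.X ◁ compR B ≫ extLeft S μ[A.X] M.X
  right_compL : (S ⊗ M.X) ◁ S ◁ M.actRight ≫ compL B =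
    pullRight₂ (S ⊗ M.X) S M.X A.X ≫ compL B ▷ A.X ≫ extRight S M.X μ[A.X] +
      pullLeft₂ (S ⊗ M.X) S M.X A.X ≫ M.X ◁ ρ ≫ extLeft S M.actRight A.X
  right_compR : (S ⊗ M.X) ◁ S ◁ M.actRight ≫ compR B =
    pullRight₂ (S ⊗ M.X) S M.X A.X ≫ compR B ▷ A.X ≫ extRight S A.X M.actRight

/-- `M` is a `Σ`-double Lie-Rinehart algebra over `A` for the anchor `ρ : ΣM ⊗ ΣA ⟶ ΣA ⊗ A` and the
bracket `B : ΣM ⊗ ΣM ⟶ Σ(M ⊗ A ⊕ A ⊗ M)`. -/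
structure IsDoubleLieRinehart (S : C) (ρ : (S ⊗ M.X) ⊗ (S ⊗ A.X) ⟶ (S ⊗ A.X) ⊗ A.X)
    (B : (S ⊗ M.X) ⊗ (S ⊗ M.X) ⟶ S ⊗ ((M.X ⊗ A.X) ⊞ (A.X ⊗ M.X))) : Prop where
  anchor : IsAnchor S ρ
  antisymm : IsAntisymm S B
  derivation : IsAnchorDerivation S ρ B
  /-- The second compatibility with the anchor, on `ΣA ⊗ ΣM ⊗ ΣM`. -/
  compat : nest (anchorTau S ρ) (compL B) +
      cycL (S ⊗ A.X) (S ⊗ M.X) (S ⊗ M.X) ≫ nest ρ ρ ≫ sigmaRotR S A.X A.X A.X +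
      cycR (S ⊗ A.X) (S ⊗ M.X) (S ⊗ M.X) ≫ nest ρ (anchorTau S ρ) ≫ sigmaRotL S A.X A.X A.X = 0
  /-- The double Jacobi identity, from `ΣM ⊗ ΣM ⊗ ΣM` to `ΣM ⊗ A ⊗ A`. -/
  jacobi : nest (compL B) (compL B) +
      cycR (S ⊗ M.X) (S ⊗ M.X) (S ⊗ M.X) ≫ nest (compR B) (compL B) ≫ sigmaRotL S A.X M.X A.X +
      cycL (S ⊗ M.X) (S ⊗ M.X) (S ⊗ M.X) ≫ nest ρ (compR B) ≫ sigmaRotR S A.X A.X M.X = 0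

end LieRinehart

section Linear

variable {A : Mon C} (M : Bimod A A) [HasCoequalizers C] [HasCoproductsOfShape ℕ C]
  [∀ X : C, PreservesColimitsOfShape (Discrete ℕ) (tensorLeft X)] [IsTensorable M]

/-- The inclusion `A ⟶ T_A(M)`. -/
def freeAlgBase : A.X ⟶ (freeAlg M).X := freeAlgInl M

variable {M} [HasBinaryBiproducts C]

/-- The restriction to `ΣM ⊗ ΣA` of the morphism `F : ΣT ⊗ ΣT ⟶ ΣT ⊗ T`, `T = T_A(M)`, is induced by
`ρ : ΣM ⊗ ΣA ⟶ ΣA ⊗ A`. -/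
def RestrictsToAnchor (S : C)
    (F : (S ⊗ (freeAlg M).X) ⊗ (S ⊗ (freeAlg M).X) ⟶ (S ⊗ (freeAlg M).X) ⊗ (freeAlg M).X)
    (ρ : (S ⊗ M.X) ⊗ (S ⊗ A.X) ⟶ (S ⊗ A.X) ⊗ A.X) : Prop :=
  (S ◁ freeAlgInr M ⊗ₘ S ◁ freeAlgBase M) ≫ F = ρ ≫ (S ◁ freeAlgBase M ⊗ₘ freeAlgBase M)

/-- The restriction to `ΣM ⊗ ΣM` of the morphism `F : ΣT ⊗ ΣT ⟶ ΣT ⊗ T`, `T = T_A(M)`, is induced by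
`B : ΣM ⊗ ΣM ⟶ Σ(M ⊗ A ⊕ A ⊗ M)`. -/
def RestrictsToBracket (S : C)
    (F : (S ⊗ (freeAlg M).X) ⊗ (S ⊗ (freeAlg M).X) ⟶ (S ⊗ (freeAlg M).X) ⊗ (freeAlg M).X)
    (B : (S ⊗ M.X) ⊗ (S ⊗ M.X) ⟶ S ⊗ ((M.X ⊗ A.X) ⊞ (A.X ⊗ M.X))) : Prop :=
  (S ◁ freeAlgInr M ⊗ₘ S ◁ freeAlgInr M) ≫ F =
    compL B ≫ (S ◁ freeAlgInr M ⊗ₘ freeAlgBase M) + compR B ≫ (S ◁ freeAlgBase M ⊗ₘ freeAlgInr M)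

/-- A morphism `ΣT ⊗ ΣT ⟶ ΣT ⊗ T`, `T = T_A(M)`, is linear if it vanishes on `ΣA ⊗ ΣA` and maps
`ΣM ⊗ ΣA` to `ΣA ⊗ A` and `ΣM ⊗ ΣM` to `Σ(M ⊗ A ⊕ A ⊗ M)`. -/
structure IsLinear (S : C)
    (F : (S ⊗ (freeAlg M).X) ⊗ (S ⊗ (freeAlg M).X) ⟶ (S ⊗ (freeAlg M).X) ⊗ (freeAlg M).X) :
    Prop where
  restrict_base : (S ◁ freeAlgBase M ⊗ₘ S ◁ freeAlgBase M) ≫ F = 0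
  restrict_mixed : ∃ ρ : (S ⊗ M.X) ⊗ (S ⊗ A.X) ⟶ (S ⊗ A.X) ⊗ A.X, RestrictsToAnchor S F ρ
  restrict_gen : ∃ B : (S ⊗ M.X) ⊗ (S ⊗ M.X) ⟶ S ⊗ ((M.X ⊗ A.X) ⊞ (A.X ⊗ M.X)),
    RestrictsToBracket S F B

end Linear

section Koszul

variable [MonoidalPreadditive C] [HasCoequalizers C] {S : C} {A : Mon C}

/-- `ρ : ΣΩ ⊗ ΣA ⟶ ΣA ⊗ A` is the anchor induced by `f : ΣA ⊗ ΣA ⟶ ΣA ⊗ A`: the extension of `f` along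
`Σd ⊗ ΣA` to a morphism of `A`-bimodules. -/
structure IsInducedAnchor (f : (S ⊗ A.X) ⊗ (S ⊗ A.X) ⟶ (S ⊗ A.X) ⊗ A.X)
    (ρ : (S ⊗ (omega A).X) ⊗ (S ⊗ A.X) ⟶ (S ⊗ A.X) ⊗ A.X) : Prop where
  linear : IsAnchorLinear S ρ
  univD_comp : (S ◁ univD A) ▷ (S ⊗ A.X) ≫ ρ = f

/-- `B : ΣΩ ⊗ ΣΩ ⟶ Σ(Ω ⊗ A ⊕ A ⊗ Ω)` is the Koszul double bracket of `f : ΣA ⊗ ΣA ⟶ ΣA ⊗ A` with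
induced anchor `ρ`: it satisfies `B ∘ (Σd ⊗ Σd) = Σ(d ⊗ A + A ⊗ d) ∘ f`, and it is the extension of
its values on `Σd ⊗ Σd` by antisymmetry and the derivation property. -/
structure IsKoszulBracket [HasBinaryBiproducts C] (f : (S ⊗ A.X) ⊗ (S ⊗ A.X) ⟶ (S ⊗ A.X) ⊗ A.X)
    (ρ : (S ⊗ (omega A).X) ⊗ (S ⊗ A.X) ⟶ (S ⊗ A.X) ⊗ A.X)
    (B : (S ⊗ (omega A).X) ⊗ (S ⊗ (omega A).X) ⟶
      S ⊗ (((omega A).X ⊗ A.X) ⊞ (A.X ⊗ (omega A).X))) : Prop where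
  univD_comp : (S ◁ univD A ⊗ₘ S ◁ univD A) ≫ B =
    f ≫ (α_ S A.X A.X).hom ≫ S ◁ biprod.lift (univD A ▷ A.X) (A.X ◁ univD A)
  antisymm : IsAntisymm S B
  derivation : IsAnchorDerivation S ρ B

end Koszul

end DoubleBrackets

end

end DoubleAlgebra

open DoubleAlgebra

/-!
The proof is a computation with generalized elements. For morphisms `x : W ⟶ X`, `y : W ⟶ Y` out of
a commutative comonoid `W`, the comultiplication of `W` defines `x ⊠ y : W ⟶ X ⊗ Y`, and structural
morphisms act on such pure tensors by permuting the entries. In an additive symmetric monoidal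
category every object `X` is a split quotient of the commutative comonoid `𝟙 ⊞ X`, so morphisms out
of an iterated tensor product are equal as soon as they agree on pure tensors (`pure_ext`). Hence
identities between multilinear operations may be verified as if objects had elements.

Exact forms generate `Ω` as a right `A`-module, and `c ⊗ e ↦ dc · e` is a split epimorphism from
`A ⊗ A` onto `Ω`, with section `b dc e ↦ bc ⊗ e - b ⊗ ce` (`omegaSec_gen`). This gives uniqueness of
the anchor and of the Koszul bracket, and, since a derivation kills the unit, it turns the formulas
`ρ(dc e, y) = {c, y} * e` and `B(dy e', dc e) = (d{y, c} e + dc {y, e}) * e'` for the component in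
`ΣΩ ⊗ A` into definitions; here `*` is the internal action. The other component is imposed by
antisymmetry.

The data `ρ` and `B` amount to a bracket `sqzBracket` on `A ⊞ M` which vanishes on `A`, and the
remaining axioms of a double Lie-Rinehart algebra are components of its Jacobi identity
(`isDoubleLieRinehart_of_jacobiator`). As `Σ` is invertible, the Jacobiator of an antisymmetric
bracket is the suspension of an expression (`jacDer`) which is a derivation in the third variable
when the bracket is one in the second (`jacobiator_eq_jacDer`, `jacDer_mul`). Since the Jacobiator
is moreover invariant under cyclic permutations, it vanishes if it does so on generators. For
`M = Ω` generators are `A` and `dA`, on which the bracket is `0`, `{-, -}` or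
`(d ⊗ A + A ⊗ d){-, -}`, and there the identity follows from that of `A` (`jacobiOn_generators`).

On the free algebra `T_A(M)` a derivation exists and is unique for given compatible values on `A` and
`M` (`isDer_derExt`, `IsDer.hom_ext`). The bracket on `A ⊞ M` is extended to `T_A(M)` in its second
variable, and then, by antisymmetry, in the first one. The external structure of the target commutes
with the internal one, so that a derivation rule in the first variable may be checked on generators
of the second (`first_variable_rule`); antisymmetry and the Jacobi identity reduce to generators in
the same way (`IsGenBracket.bracket_antisymm`, `jacobiOn_free`).
-/


/-! ### Generalized elements -/

namespace DoubleAlgebra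

section Pairing

open ComonObj

variable {C : Type u} [Category.{v} C] [MonoidalCategory C] [SymmetricCategory C]

/-- The pairing `x ⊗ y` of two generalized elements `x : W ⟶ X` and `y : W ⟶ Y` at a commutative
comonoid `W`. -/
def pair {W : CommComon C} {X Y : C} (x : W.X ⟶ X) (y : W.X ⟶ Y) : W.X ⟶ X ⊗ Y :=
  Δ[W.X] ≫ (x ⊗ₘ y)

infixr:70 " ⊠ " => pair

variable {W : CommComon C} {X Y Z X' Y' : C}

@[simp]
theorem pair_tensorHom (x : W.X ⟶ X) (y : W.X ⟶ Y) (g : X ⟶ X') (h : Y ⟶ Y') :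
    (x ⊠ y) ≫ (g ⊗ₘ h) = (x ≫ g) ⊠ (y ≫ h) := by
  simp [pair]

@[simp]
theorem pair_whiskerLeft (x : W.X ⟶ X) (y : W.X ⟶ Y) (h : Y ⟶ Y') :
    (x ⊠ y) ≫ X ◁ h = x ⊠ (y ≫ h) := by
  rw [← id_tensorHom, pair_tensorHom, Category.comp_id]

@[simp]
theorem pair_whiskerRight (x : W.X ⟶ X) (y : W.X ⟶ Y) (g : X ⟶ X') :
    (x ⊠ y) ≫ g ▷ Y = (x ≫ g) ⊠ y := by
  rw [← tensorHom_id, pair_tensorHom, Category.comp_id]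

@[simp]
theorem pair_associator_hom (x : W.X ⟶ X) (y : W.X ⟶ Y) (z : W.X ⟶ Z) :
    ((x ⊠ y) ⊠ z) ≫ (α_ X Y Z).hom = x ⊠ y ⊠ z := by
  have h := ComonObj.comul_assoc W.X
  simp only [pair, MonoidalCategory.tensorHom_def, comp_whiskerRight, whiskerLeft_comp,
    Category.assoc]
  calc _ = (Δ[W.X] ≫ Δ[W.X] ▷ W.X ≫ (α_ _ _ _).hom) ≫ x ▷ _ ≫ X ◁ y ▷ _ ≫ X ◁ Y ◁ z := by
        monoidal
    _ = Δ[W.X] ≫ (W.X ◁ Δ[W.X] ≫ x ▷ _) ≫ X ◁ y ▷ _ ≫ X ◁ Y ◁ z := by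
        rw [← h]; simp only [Category.assoc]
    _ = _ := by rw [whisker_exchange]; simp only [Category.assoc]

@[simp]
theorem pair_associator_inv (x : W.X ⟶ X) (y : W.X ⟶ Y) (z : W.X ⟶ Z) :
    (x ⊠ y ⊠ z) ≫ (α_ X Y Z).inv = (x ⊠ y) ⊠ z := by
  rw [← pair_associator_hom, Category.assoc, Iso.hom_inv_id, Category.comp_id]

@[simp]
theorem pair_braiding_hom (x : W.X ⟶ X) (y : W.X ⟶ Y) :
    (x ⊠ y) ≫ (β_ X Y).hom = y ⊠ x := by
  rw [pair, Category.assoc, BraidedCategory.braiding_naturality, IsCommComonObj.comul_comm_assoc,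
    pair]

@[simp]
theorem comp_leftUnitor_inv (x : W.X ⟶ X) : x ≫ (λ_ X).inv = ε[W.X] ⊠ x := by
  rw [pair, ComonObj.counit_comul_hom]

@[simp]
theorem comp_rightUnitor_inv (x : W.X ⟶ X) : x ≫ (ρ_ X).inv = x ⊠ ε[W.X] := by
  rw [pair, ComonObj.comul_counit_hom]

@[simp]
theorem counit_pair_leftUnitor (x : W.X ⟶ X) : (ε[W.X] ⊠ x) ≫ (λ_ X).hom = x := by
  rw [← comp_leftUnitor_inv, Category.assoc, Iso.inv_hom_id, Category.comp_id]

@[simp]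
theorem pair_counit_rightUnitor (x : W.X ⟶ X) : (x ⊠ ε[W.X]) ≫ (ρ_ X).hom = x := by
  rw [← comp_rightUnitor_inv, Category.assoc, Iso.inv_hom_id, Category.comp_id]

section Additive

variable [Preadditive C] [MonoidalPreadditive C]

@[simp]
theorem pair_add (x : W.X ⟶ X) (y z : W.X ⟶ Y) : x ⊠ (y + z) = x ⊠ y + x ⊠ z := by
  simp [pair, MonoidalPreadditive.tensor_add]

@[simp]
theorem add_pair (x y : W.X ⟶ X) (z : W.X ⟶ Y) : (x + y) ⊠ z = x ⊠ z + y ⊠ z := by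
  simp [pair, MonoidalPreadditive.add_tensor]

@[simp]
theorem pair_zero (x : W.X ⟶ X) : x ⊠ (0 : W.X ⟶ Y) = 0 := by
  simp [pair]

@[simp]
theorem zero_pair (z : W.X ⟶ Y) : (0 : W.X ⟶ X) ⊠ z = 0 := by
  simp [pair]

@[simp]
theorem pair_neg (x : W.X ⟶ X) (y : W.X ⟶ Y) : x ⊠ (-y) = -(x ⊠ y) := by
  rw [eq_neg_iff_add_eq_zero, ← pair_add, neg_add_cancel, pair_zero]

@[simp]
theorem neg_pair (x : W.X ⟶ X) (z : W.X ⟶ Y) : (-x) ⊠ z = -(x ⊠ z) := by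
  rw [eq_neg_iff_add_eq_zero, ← add_pair, neg_add_cancel, zero_pair]

@[simp]
theorem pair_sub (x : W.X ⟶ X) (y z : W.X ⟶ Y) : x ⊠ (y - z) = x ⊠ y - x ⊠ z := by
  rw [sub_eq_add_neg, pair_add, pair_neg, sub_eq_add_neg]

@[simp]
theorem sub_pair (x y : W.X ⟶ X) (z : W.X ⟶ Y) : (x - y) ⊠ z = x ⊠ z - y ⊠ z := by
  rw [sub_eq_add_neg, add_pair, neg_pair, sub_eq_add_neg]

end Additive

end Pairing

section Detection

open ComonObj

variable {C : Type u} [Category.{v} C] [MonoidalCategory C] [SymmetricCategory C]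

/-- A presentation of an object as an iterated tensor product. -/
inductive Shape : C → Type (max u v)
  | atom (X : C) : Shape X
  | tensor {X Y : C} (s : Shape X) (t : Shape Y) : Shape (X ⊗ Y)

/-- `s.All W Q` says that `Q` holds for all generalized elements at `W` which are pure tensors of
the shape `s`. -/
def Shape.All (W : CommComon C) : ∀ {X : C}, Shape X → ((W.X ⟶ X) → Prop) → Prop
  | _, .atom _, Q => ∀ x, Q x
  | _, .tensor s t, Q => s.All W fun x => t.All W fun y => Q (x ⊠ y)

variable [Preadditive C] [MonoidalPreadditive C] [HasBinaryBiproducts C]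

/-- The comultiplication of the trivial coalgebra `𝟙 ⊕ X`. -/
noncomputable def primitiveComul (X : C) : 𝟙_ C ⊞ X ⟶ (𝟙_ C ⊞ X) ⊗ (𝟙_ C ⊞ X) :=
  biprod.desc ((λ_ (𝟙_ C)).inv ≫ (biprod.inl ⊗ₘ biprod.inl))
    ((λ_ X).inv ≫ (biprod.inl ⊗ₘ biprod.inr) + (ρ_ X).inv ≫ (biprod.inr ⊗ₘ biprod.inl))

theorem inl_primitiveComul (X : C) : biprod.inl ≫ primitiveComul X =
    (λ_ (𝟙_ C)).inv ≫ (biprod.inl ⊗ₘ biprod.inl) := by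
  simp [primitiveComul]

theorem inr_primitiveComul (X : C) : biprod.inr ≫ primitiveComul X =
    (λ_ X).inv ≫ (biprod.inl ⊗ₘ biprod.inr) + (ρ_ X).inv ≫ (biprod.inr ⊗ₘ biprod.inl) := by
  simp [primitiveComul]

/-- The trivial commutative coalgebra `𝟙 ⊕ X`, in which `X` is primitive. It carries a split
epimorphism to `X`, so that generalized elements at commutative comonoids detect morphisms. -/
@[reducible]
noncomputable def primitiveComon (X : C) : ComonObj (𝟙_ C ⊞ X) where
  counit := biprod.fst
  comul := primitiveComul X
  counit_comul := by
    apply biprod.hom_ext'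
    · rw [reassoc_of% inl_primitiveComul X, ← tensorHom_id, tensorHom_comp_tensorHom]
      simp [MonoidalCategory.tensorHom_def]
    · rw [reassoc_of% inr_primitiveComul X, ← tensorHom_id, Preadditive.add_comp, Category.assoc,
        Category.assoc, tensorHom_comp_tensorHom, tensorHom_comp_tensorHom]
      simp
  comul_counit := by
    apply biprod.hom_ext'
    · rw [reassoc_of% inl_primitiveComul X, ← id_tensorHom, tensorHom_comp_tensorHom]
      simp [MonoidalCategory.tensorHom_def', unitors_inv_equal]
    · rw [reassoc_of% inr_primitiveComul X, ← id_tensorHom, Preadditive.add_comp, Category.assoc,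
        Category.assoc, tensorHom_comp_tensorHom, tensorHom_comp_tensorHom]
      simp
  comul_assoc := by
    apply biprod.hom_ext'
    · rw [reassoc_of% inl_primitiveComul X, reassoc_of% inl_primitiveComul X, ← tensorHom_id,
        ← id_tensorHom, tensorHom_comp_tensorHom, tensorHom_comp_tensorHom_assoc,
        inl_primitiveComul]
      simp only [Category.comp_id, MonoidalCategory.tensorHom_def]
      monoidal
    · rw [reassoc_of% inr_primitiveComul X, reassoc_of% inr_primitiveComul X, ← tensorHom_id,
        ← id_tensorHom]
      simp only [Preadditive.add_comp, Category.assoc, tensorHom_comp_tensorHom,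
        tensorHom_comp_tensorHom_assoc, inl_primitiveComul, inr_primitiveComul, Category.comp_id,
        MonoidalPreadditive.tensor_add, MonoidalPreadditive.add_tensor, Preadditive.comp_add]
      rw [← add_assoc]
      simp only [MonoidalCategory.tensorHom_def]
      congr 1
      · congr 1 <;> monoidal
      · monoidal

/-- The commutative comonoid `𝟙 ⊕ X`. -/
noncomputable def primitive (X : C) : CommComon C :=
  letI := primitiveComon X
  { X := 𝟙_ C ⊞ X
    comm :=
      { comul_comm := by
          change primitiveComul X ≫ _ = primitiveComul X
          apply biprod.hom_ext'
          · rw [reassoc_of% inl_primitiveComul X, inl_primitiveComul,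
              BraidedCategory.braiding_naturality]
            simp [unitors_inv_equal]
          · rw [reassoc_of% inr_primitiveComul X, inr_primitiveComul, Preadditive.add_comp,
              Category.assoc, Category.assoc, BraidedCategory.braiding_naturality,
              BraidedCategory.braiding_naturality, add_comm]
            simp } }

section Projections

variable (W₁ W₂ : CommComon C)

/-- The projection of a tensor product of commutative comonoids to the first factor. -/
noncomputable def projFst : W₁.X ⊗ W₂.X ⟶ W₁.X := W₁.X ◁ ε[W₂.X] ≫ (ρ_ _).hom

/-- The projection of a tensor product of commutative comonoids to the second factor. -/
noncomputable def projSnd : W₁.X ⊗ W₂.X ⟶ W₂.X := ε[W₁.X] ▷ W₂.X ≫ (λ_ _).hom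

instance : IsComonHom (projFst W₁ W₂) where
  hom_counit := by
    simp [projFst, Comon.tensorObj_counit, MonoidalCategory.tensorHom_def', unitors_equal]
  hom_comul := by
    rw [Comon.tensorObj_comul, projFst, ← id_tensorHom, ← tensorHom_comp_tensorHom]
    have := tensorμ_natural (𝟙 W₁.X) (𝟙 W₁.X) ε[W₂.X] ε[W₂.X]
    simp only [Category.assoc]
    rw [← reassoc_of% this, tensorHom_comp_tensorHom_assoc, ComonObj.counit_comul_hom]
    simp only [tensorμ, MonoidalCategory.tensorHom_def, braiding_tensorUnit_right,
      id_whiskerRight, whiskerLeft_id, Category.comp_id, Category.id_comp, Category.assoc]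
    rw [← whisker_exchange_assoc]
    monoidal

instance : IsComonHom (projSnd W₁ W₂) where
  hom_counit := by
    simp [projSnd, Comon.tensorObj_counit, MonoidalCategory.tensorHom_def]
  hom_comul := by
    rw [Comon.tensorObj_comul, projSnd, ← tensorHom_id, ← tensorHom_comp_tensorHom]
    have := tensorμ_natural ε[W₁.X] ε[W₁.X] (𝟙 W₂.X) (𝟙 W₂.X)
    simp only [Category.assoc]
    rw [← reassoc_of% this, tensorHom_comp_tensorHom_assoc, ComonObj.counit_comul_hom]
    simp only [tensorμ, MonoidalCategory.tensorHom_def, braiding_tensorUnit_left,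
      comp_whiskerRight, id_whiskerRight, whiskerLeft_id, Category.comp_id]
    monoidal

/-- The tensor product of two morphisms is a pairing of generalized elements at the tensor product
of the comonoids. -/
theorem proj_pair_proj {X Y : C} (x : W₁.X ⟶ X) (y : W₂.X ⟶ Y) :
    pair (W := ⟨W₁.X ⊗ W₂.X⟩) (projFst W₁ W₂ ≫ x) (projSnd W₁ W₂ ≫ y) = x ⊗ₘ y := by
  have h : Δ[W₁.X ⊗ W₂.X] ≫ (projFst W₁ W₂ ⊗ₘ projSnd W₁ W₂) = 𝟙 _ := by
    rw [Comon.tensorObj_comul, projFst, projSnd, ← tensorHom_comp_tensorHom, ← id_tensorHom,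
      ← tensorHom_id, Category.assoc]
    have := tensorμ_natural (𝟙 W₁.X) ε[W₁.X] ε[W₂.X] (𝟙 W₂.X)
    rw [← reassoc_of% this, tensorHom_comp_tensorHom_assoc, ComonObj.comul_counit_hom,
      ComonObj.counit_comul_hom]
    simp only [tensorμ, MonoidalCategory.tensorHom_def, braiding_tensorUnit_left]
    monoidal
  rw [pair, ← tensorHom_comp_tensorHom, reassoc_of% h]

end Projections

theorem comonHom_comp_pair {V W : CommComon C} (p : V.X ⟶ W.X) [IsComonHom p] {X Y : C}
    (x : W.X ⟶ X) (y : W.X ⟶ Y) : p ≫ (x ⊠ y) = (p ≫ x) ⊠ (p ≫ y) := by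
  rw [pair, pair, IsComonHom.hom_comul_assoc, tensorHom_comp_tensorHom]

/-- Every shape has a generic pure tensor: one which is a split epimorphism, and whose pullbacks
along morphisms of comonoids satisfy every property which holds for all pure tensors. -/
theorem Shape.exists_splitEpi {X : C} (s : Shape X) :
    ∃ (W : CommComon C) (x : W.X ⟶ X), IsSplitEpi x ∧ ∀ (V : CommComon C) (p : V.X ⟶ W.X)
      [IsComonHom p] (Q : (V.X ⟶ X) → Prop), s.All V Q → Q (p ≫ x) := by
  induction s with
  | atom X =>
    exact ⟨primitive X, (biprod.snd : 𝟙_ C ⊞ X ⟶ X),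
      IsSplitEpi.mk' ⟨biprod.inr, biprod.inr_snd⟩, fun V p _ Q h => h _⟩
  | tensor s t hs ht =>
    obtain ⟨W₁, x, hx, hs⟩ := hs
    obtain ⟨W₂, y, hy, ht⟩ := ht
    refine ⟨⟨W₁.X ⊗ W₂.X⟩, x ⊗ₘ y, ?_, fun V p _ Q h => ?_⟩
    · exact IsSplitEpi.mk' ⟨section_ x ⊗ₘ section_ y, by simp⟩
    · have h1 := hs V (p ≫ projFst W₁ W₂) _ h
      have h2 := ht V (p ≫ projSnd W₁ W₂) _ h1
      rw [Category.assoc, Category.assoc] at h2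
      rwa [← proj_pair_proj, comonHom_comp_pair (W := ⟨W₁.X ⊗ W₂.X⟩) p]

/-- Morphisms which agree on all pure tensors of generalized elements are equal. -/
theorem Shape.hom_ext {X Z : C} (s : Shape X) {g h : X ⟶ Z}
    (H : ∀ W : CommComon C, s.All W fun x => x ≫ g = x ≫ h) : g = h := by
  obtain ⟨W, x, hx, hs⟩ := s.exists_splitEpi
  rw [← cancel_epi x]
  simpa using hs W (𝟙 _) _ (H W)

/-- The canonical shape of an object, found by instance search. -/
class HasShape (X : C) where
  /-- The shape. -/
  shape : Shape X

instance (priority := low) (X : C) : HasShape X := ⟨.atom X⟩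

instance (priority := high) (X Y : C) [HasShape X] [HasShape Y] : HasShape (X ⊗ Y) :=
  ⟨.tensor HasShape.shape HasShape.shape⟩

/-- Morphisms which agree on all pure tensors, of the shape found by instance search, are equal.
Since every generalized element of `X` may be composed with the resulting equality, an identity
checked on pure tensors holds for all elements; proofs of the latter state the equality of
morphisms first, as `key`. -/
theorem pure_ext {X Z : C} [HasShape X] {g h : X ⟶ Z}
    (H : ∀ W : CommComon C, (HasShape.shape : Shape X).All W fun x => x ≫ g = x ≫ h) : g = h :=
  Shape.hom_ext _ H

end Detection

end DoubleAlgebra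

/-! ### The structural morphisms on pure tensors -/

namespace DoubleAlgebra

section PureFormulas

variable {C : Type u} [Category.{v} C] [MonoidalCategory C] [SymmetricCategory C]
variable {W : CommComon C} {S R P P' Q Q' X Y Z U V : C}

@[simp]
theorem pair_sigmaTau (s : W.X ⟶ S) (x : W.X ⟶ X) (y : W.X ⟶ Y) :
    ((s ⊠ x) ⊠ y) ≫ sigmaTau S X Y = (s ⊠ y) ⊠ x := by
  simp [sigmaTau, ← Category.assoc]

@[simp]
theorem pair_sigmaRotR (s : W.X ⟶ S) (x : W.X ⟶ X) (y : W.X ⟶ Y) (z : W.X ⟶ Z) :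
    (((s ⊠ x) ⊠ y) ⊠ z) ≫ sigmaRotR S X Y Z = ((s ⊠ z) ⊠ x) ⊠ y := by
  simp [sigmaRotR, monoidalComp, MonoidalCoherence.iso, ← Category.assoc]

@[simp]
theorem pair_sigmaRotL (s : W.X ⟶ S) (x : W.X ⟶ X) (y : W.X ⟶ Y) (z : W.X ⟶ Z) :
    (((s ⊠ x) ⊠ y) ⊠ z) ≫ sigmaRotL S X Y Z = ((s ⊠ y) ⊠ z) ⊠ x := by
  simp [sigmaRotL, monoidalComp, MonoidalCoherence.iso, ← Category.assoc]

@[simp]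
theorem pair_cycR (x : W.X ⟶ X) (y : W.X ⟶ Y) (z : W.X ⟶ Z) :
    (x ⊠ y ⊠ z) ≫ cycR X Y Z = z ⊠ x ⊠ y := by
  simp [cycR, ← Category.assoc]

@[simp]
theorem pair_cycL (x : W.X ⟶ X) (y : W.X ⟶ Y) (z : W.X ⟶ Z) :
    (x ⊠ y ⊠ z) ≫ cycL X Y Z = y ⊠ z ⊠ x := by
  simp [cycL, ← Category.assoc]

@[simp]
theorem pair_nest (g : X ⊗ U ⟶ P) (h : Y ⊗ Z ⟶ U ⊗ V) (x : W.X ⟶ X) (y : W.X ⟶ Y ⊗ Z) :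
    (x ⊠ y) ≫ nest g h = ((x ⊠ (y ≫ h)) ≫ (α_ X U V).inv) ≫ g ▷ V := by
  simp only [nest, ← Category.assoc, pair_whiskerLeft]

@[simp]
theorem pair_suspLeft (l : R ⊗ P ⟶ P') (r : W.X ⟶ R) (s : W.X ⟶ S) (p : W.X ⟶ P) :
    (r ⊠ s ⊠ p) ≫ suspLeft S l = s ⊠ ((r ⊠ p) ≫ l) := by
  simp [suspLeft, ← Category.assoc]

@[simp]
theorem pair_suspRight (l : P ⊗ R ⟶ P') (s : W.X ⟶ S) (p : W.X ⟶ P) (r : W.X ⟶ R) :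
    ((s ⊠ p) ⊠ r) ≫ suspRight S l = s ⊠ ((p ⊠ r) ≫ l) := by
  simp [suspRight, ← Category.assoc]

@[simp]
theorem pair_extLeft (l : R ⊗ P ⟶ P') (r : W.X ⟶ R) (s : W.X ⟶ S) (p : W.X ⟶ P) (q : W.X ⟶ Q) :
    (r ⊠ (s ⊠ p) ⊠ q) ≫ extLeft S l Q = (s ⊠ ((r ⊠ p) ≫ l)) ⊠ q := by
  simp [extLeft, ← Category.assoc]

@[simp]
theorem pair_extRight (l : Q ⊗ R ⟶ Q') (x : W.X ⟶ S ⊗ P) (q : W.X ⟶ Q) (r : W.X ⟶ R) :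
    ((x ⊠ q) ⊠ r) ≫ extRight S P l = x ⊠ ((q ⊠ r) ≫ l) := by
  rw [extRight, ← Category.assoc]
  simp only [pair_associator_hom, pair_whiskerLeft]

@[simp]
theorem pair_intLeft (l : R ⊗ Q ⟶ Q) (r : W.X ⟶ R) (x : W.X ⟶ S ⊗ P) (q : W.X ⟶ Q) :
    (r ⊠ x ⊠ q) ≫ intLeft S P l = x ⊠ ((r ⊠ q) ≫ l) := by
  simp only [intLeft, ← Category.assoc, pair_associator_inv, pair_whiskerRight, pair_braiding_hom,
    pair_associator_hom, pair_whiskerLeft]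

@[simp]
theorem pair_intRight (l : P ⊗ R ⟶ P) (s : W.X ⟶ S) (p : W.X ⟶ P) (q : W.X ⟶ Q) (r : W.X ⟶ R) :
    (((s ⊠ p) ⊠ q) ⊠ r) ≫ intRight S l Q = (s ⊠ ((p ⊠ r) ≫ l)) ⊠ q := by
  simp only [intRight, ← Category.assoc, pair_associator_hom, pair_whiskerLeft, pair_braiding_hom,
    pair_associator_inv, pair_whiskerRight, pair_suspRight]

@[simp]
theorem pair_pullLeft₁ (s : W.X ⟶ S) (r : W.X ⟶ R) (p : W.X ⟶ P) (y : W.X ⟶ Y) :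
    ((s ⊠ r ⊠ p) ⊠ y) ≫ pullLeft₁ S R P Y = r ⊠ (s ⊠ p) ⊠ y := by
  simp [pullLeft₁, monoidalComp, MonoidalCoherence.iso, ← Category.assoc]

@[simp]
theorem pair_pullRight₁ (s : W.X ⟶ S) (r : W.X ⟶ R) (p : W.X ⟶ P) (y : W.X ⟶ Y) :
    ((s ⊠ p ⊠ r) ⊠ y) ≫ pullRight₁ S P R Y = ((s ⊠ p) ⊠ y) ⊠ r := by
  simp [pullRight₁, monoidalComp, MonoidalCoherence.iso, ← Category.assoc]

@[simp]
theorem pair_pullLeft₂ (x : W.X ⟶ X) (s : W.X ⟶ S) (r : W.X ⟶ R) (p : W.X ⟶ P) :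
    (x ⊠ s ⊠ r ⊠ p) ≫ pullLeft₂ X S R P = r ⊠ x ⊠ s ⊠ p := by
  simp [pullLeft₂, monoidalComp, MonoidalCoherence.iso, ← Category.assoc]

@[simp]
theorem pair_pullRight₂ (x : W.X ⟶ X) (s : W.X ⟶ S) (r : W.X ⟶ R) (p : W.X ⟶ P) :
    (x ⊠ s ⊠ p ⊠ r) ≫ pullRight₂ X S P R = (x ⊠ s ⊠ p) ⊠ r := by
  simp [pullRight₂, ← Category.assoc]

/-- The morphism `intRight` for a map `P ⊗ R ⟶ P'` instead of a right action. -/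
def intRight' (S : C) (r : P ⊗ R ⟶ P') (Q : C) : ((S ⊗ P) ⊗ Q) ⊗ R ⟶ (S ⊗ P') ⊗ Q :=
  (α_ (S ⊗ P) Q R).hom ≫ (S ⊗ P) ◁ (β_ Q R).hom ≫ (α_ (S ⊗ P) R Q).inv ≫ suspRight S r ▷ Q

@[simp]
theorem pair_intRight' (l : P ⊗ R ⟶ P') (s : W.X ⟶ S) (p : W.X ⟶ P) (q : W.X ⟶ Q)
    (r : W.X ⟶ R) :
    (((s ⊠ p) ⊠ q) ⊠ r) ≫ intRight' S l Q = (s ⊠ ((p ⊠ r) ≫ l)) ⊠ q := by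
  simp only [intRight', ← Category.assoc, pair_associator_hom, pair_whiskerLeft, pair_braiding_hom,
    pair_associator_inv, pair_whiskerRight, pair_suspRight]

/-- The exchange `X ⊗ Y ⊗ Z ⟶ Y ⊗ X ⊗ Z` of the first two factors. -/
def exch (X Y Z : C) : X ⊗ (Y ⊗ Z) ⟶ Y ⊗ (X ⊗ Z) :=
  (α_ _ _ _).inv ≫ (β_ _ _).hom ▷ _ ≫ (α_ _ _ _).hom

@[simp]
theorem pair_exch (x : W.X ⟶ X) (y : W.X ⟶ Y) (z : W.X ⟶ Z) :
    (x ⊠ y ⊠ z) ≫ exch X Y Z = y ⊠ x ⊠ z := by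
  simp only [exch, ← Category.assoc, pair_associator_inv, pair_whiskerRight, pair_braiding_hom,
    pair_associator_hom]

instance {f : X ⟶ Y} [IsSplitEpi f] : IsSplitEpi (Z ◁ f) :=
  .mk' ⟨Z ◁ section_ f, by simp [← whiskerLeft_comp]⟩

instance {f : X ⟶ Y} [IsSplitEpi f] : IsSplitEpi (f ▷ Z) :=
  .mk' ⟨section_ f ▷ Z, by simp [← comp_whiskerRight]⟩

instance {f : X ⟶ Y} {g : U ⟶ V} [IsSplitEpi f] [IsSplitEpi g] : IsSplitEpi (f ⊗ₘ g) :=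
  .mk' ⟨section_ f ⊗ₘ section_ g, by simp⟩

instance {f : X ⟶ Y} [IsSplitMono f] : IsSplitMono (Z ◁ f) :=
  .mk' ⟨Z ◁ retraction f, by simp [← whiskerLeft_comp]⟩

instance {f : X ⟶ Y} [IsSplitMono f] : IsSplitMono (f ▷ Z) :=
  .mk' ⟨retraction f ▷ Z, by simp [← comp_whiskerRight]⟩

instance {f : X ⟶ Y} {g : U ⟶ V} [IsSplitMono f] [IsSplitMono g] : IsSplitMono (f ⊗ₘ g) :=
  .mk' ⟨retraction f ⊗ₘ retraction g, by simp⟩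

end PureFormulas

end DoubleAlgebra

/-! ### Bimodules in terms of generalized elements -/

namespace DoubleAlgebra

section Biactions

open ComonObj

variable {C : Type u} [Category.{v} C] [MonoidalCategory C] [SymmetricCategory C]
variable {W : CommComon C} (A : Mon C)

/-- The unit of a monoid as a generalized element. -/
def oneEl (W : CommComon C) : W.X ⟶ A.X := ε[W.X] ≫ η[A.X]

variable {A}

@[simp]
theorem counit_comp_one : ε[W.X] ≫ η[A.X] = oneEl A W := rfl

@[simp]
theorem oneEl_mul (a : W.X ⟶ A.X) : (oneEl A W ⊠ a) ≫ μ[A.X] = a := by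
  have := congrArg ((ε[W.X] ⊠ a) ≫ ·) (MonObj.one_mul A.X)
  simpa only [← Category.assoc, pair_whiskerRight, counit_pair_leftUnitor,
    counit_comp_one] using this

@[simp]
theorem mul_oneEl (a : W.X ⟶ A.X) : (a ⊠ oneEl A W) ≫ μ[A.X] = a := by
  have := congrArg ((a ⊠ ε[W.X]) ≫ ·) (MonObj.mul_one A.X)
  simpa only [← Category.assoc, pair_whiskerLeft, pair_counit_rightUnitor,
    counit_comp_one] using this

theorem pair_mul_assoc (a b c : W.X ⟶ A.X) :
    ((a ⊠ b) ≫ μ[A.X] ⊠ c) ≫ μ[A.X] = (a ⊠ (b ⊠ c) ≫ μ[A.X]) ≫ μ[A.X] := by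
  have := congrArg (((a ⊠ b) ⊠ c) ≫ ·) (MonObj.mul_assoc A.X)
  simpa only [← Category.assoc, pair_whiskerRight, pair_whiskerLeft, pair_associator_hom]
    using this

/-- Commuting left and right actions of a monoid `A` on `Z`, with the axioms stated on generalized
elements. -/
structure IsBiaction (A : Mon C) {Z : C} (l : A.X ⊗ Z ⟶ Z) (r : Z ⊗ A.X ⟶ Z) : Prop where
  one_left : ∀ {W : CommComon C} (z : W.X ⟶ Z), (oneEl A W ⊠ z) ≫ l = z
  one_right : ∀ {W : CommComon C} (z : W.X ⟶ Z), (z ⊠ oneEl A W) ≫ r = z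
  mul_left : ∀ {W : CommComon C} (a b : W.X ⟶ A.X) (z : W.X ⟶ Z),
    ((a ⊠ b) ≫ μ[A.X] ⊠ z) ≫ l = (a ⊠ (b ⊠ z) ≫ l) ≫ l
  mul_right : ∀ {W : CommComon C} (z : W.X ⟶ Z) (a b : W.X ⟶ A.X),
    (z ⊠ (a ⊠ b) ≫ μ[A.X]) ≫ r = ((z ⊠ a) ≫ r ⊠ b) ≫ r
  left_right : ∀ {W : CommComon C} (a : W.X ⟶ A.X) (z : W.X ⟶ Z) (b : W.X ⟶ A.X),
    ((a ⊠ z) ≫ l ⊠ b) ≫ r = (a ⊠ (z ⊠ b) ≫ r) ≫ l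

/-- The axioms of a pair of actions as equations of morphisms give them on generalized elements. -/
theorem IsBiaction.of_hom {Z : C} {l : A.X ⊗ Z ⟶ Z} {r : Z ⊗ A.X ⟶ Z}
    (h₁ : (λ_ Z).inv ≫ η[A.X] ▷ Z ≫ l = 𝟙 Z) (h₂ : (ρ_ Z).inv ≫ Z ◁ η[A.X] ≫ r = 𝟙 Z)
    (h₃ : μ[A.X] ▷ Z ≫ l = (α_ _ _ _).hom ≫ A.X ◁ l ≫ l)
    (h₄ : Z ◁ μ[A.X] ≫ r = (α_ _ _ _).inv ≫ r ▷ A.X ≫ r)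
    (h₅ : l ▷ A.X ≫ r = (α_ _ _ _).hom ≫ A.X ◁ r ≫ l) : IsBiaction A l r where
  one_left {W} z := by simpa [← Category.assoc] using congrArg (z ≫ ·) h₁
  one_right {W} z := by simpa [← Category.assoc] using congrArg (z ≫ ·) h₂
  mul_left a b z := by simpa [← Category.assoc] using congrArg (((a ⊠ b) ⊠ z) ≫ ·) h₃
  mul_right z a b := by simpa [← Category.assoc] using congrArg ((z ⊠ a ⊠ b) ≫ ·) h₄
  left_right a z b := by simpa [← Category.assoc] using congrArg (((a ⊠ z) ⊠ b) ≫ ·) h₅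

theorem isBiaction_bimod (M : Bimod A A) : IsBiaction A M.actLeft M.actRight :=
  .of_hom (by rw [M.one_actLeft, Iso.inv_hom_id]) (by rw [M.actRight_one, Iso.inv_hom_id])
    M.left_assoc M.right_assoc M.middle_assoc

theorem actRight_assoc (M : Bimod A A) :
    M.actRight ▷ A.X ≫ M.actRight = (α_ _ _ _).hom ≫ M.X ◁ μ[A.X] ≫ M.actRight := by
  rw [M.right_assoc, Iso.hom_inv_id_assoc]

theorem isBiaction_mul (A : Mon C) : IsBiaction A μ[A.X] μ[A.X] :=
  .of_hom (by simp) (by simp) (MonObj.mul_assoc _) (by rw [MonObj.mul_assoc]; simp)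
    (MonObj.mul_assoc _)

variable [Preadditive C] [MonoidalPreadditive C] [HasBinaryBiproducts C]

/-- The internal bimodule structure on `ΣP ⊗ Q`. -/
theorem isBiaction_int (S : C) {P Q : C} {lP : A.X ⊗ P ⟶ P} {rP : P ⊗ A.X ⟶ P}
    {lQ : A.X ⊗ Q ⟶ Q} {rQ : Q ⊗ A.X ⟶ Q} (hP : IsBiaction A lP rP) (hQ : IsBiaction A lQ rQ) :
    IsBiaction A (intLeft S P lQ) (intRight S rP Q) := by
  refine .of_hom ?_ ?_ ?_ ?_ ?_ <;> refine pure_ext fun W => ?_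
  · intro s p q
    simp [← Category.assoc, hQ.one_left]
  · intro s p q
    simp [← Category.assoc, hP.one_right]
  · intro a b s p q
    simp [← Category.assoc, hQ.mul_left]
  · intro s p q a b
    simp [← Category.assoc, hP.mul_right]
  · intro a s p q b
    simp [← Category.assoc]


/-- The external bimodule structure on `ΣP ⊗ Q`. -/
theorem isBiaction_ext (S : C) {P Q : C} {lP : A.X ⊗ P ⟶ P} {rP : P ⊗ A.X ⟶ P}
    {lQ : A.X ⊗ Q ⟶ Q} {rQ : Q ⊗ A.X ⟶ Q} (hP : IsBiaction A lP rP) (hQ : IsBiaction A lQ rQ) :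
    IsBiaction A (extLeft S lP Q) (extRight S P rQ) := by
  refine .of_hom ?_ ?_ ?_ ?_ ?_ <;> refine pure_ext fun W => ?_
  · intro s p q
    simp [← Category.assoc, hP.one_left]
  · intro s p q
    simp [← Category.assoc, hQ.one_right]
  · intro a b s p q
    simp [← Category.assoc, hP.mul_left]
  · intro s p q a b
    simp [← Category.assoc, hQ.mul_right]
  · intro a s p q b
    simp [← Category.assoc]

section Commutation

variable {S P Q P' Q' R R' X Y : C} (t : W.X ⟶ (S ⊗ P) ⊗ Q)

theorem sigmaTau_sigmaTau : (t ≫ sigmaTau S P Q) ≫ sigmaTau S Q P = t := by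
  have key : sigmaTau S P Q ≫ sigmaTau S Q P = 𝟙 _ := by
    refine pure_ext fun W => ?_
    intro s p q
    simp [← Category.assoc]
  simpa [← Category.assoc] using congrArg (t ≫ ·) key

theorem sigmaTau_map (g : P ⟶ P') (h : Q ⟶ Q') :
    (t ≫ sigmaTau S P Q) ≫ (S ◁ h ⊗ₘ g) = (t ≫ (S ◁ g ⊗ₘ h)) ≫ sigmaTau S P' Q' := by
  have key : sigmaTau S P Q ≫ (S ◁ h ⊗ₘ g) = (S ◁ g ⊗ₘ h) ≫ sigmaTau S P' Q' := by
    refine pure_ext fun W => ?_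
    intro s p q
    simp [← Category.assoc]
  simpa [← Category.assoc] using congrArg (t ≫ ·) key

theorem extLeft_sigmaTau (l : R ⊗ P ⟶ P) (a : W.X ⟶ R) :
    ((a ⊠ t) ≫ extLeft S l Q) ≫ sigmaTau S P Q = (a ⊠ t ≫ sigmaTau S P Q) ≫ intLeft S Q l := by
  have key : extLeft S l Q ≫ sigmaTau S P Q = R ◁ sigmaTau S P Q ≫ intLeft S Q l := by
    refine pure_ext fun W => ?_
    intro a s p q
    simp [← Category.assoc]
  simpa [← Category.assoc] using congrArg ((a ⊠ t) ≫ ·) key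

theorem extRight_sigmaTau' (r : Q ⊗ R ⟶ Q') (a : W.X ⟶ R) :
    ((t ⊠ a) ≫ extRight S P r) ≫ sigmaTau S P Q' = (t ≫ sigmaTau S P Q ⊠ a) ≫ intRight' S r P := by
  have key : extRight S P r ≫ sigmaTau S P Q' = sigmaTau S P Q ▷ R ≫ intRight' S r P := by
    refine pure_ext fun W => ?_
    intro s p q a
    simp [← Category.assoc]
  simpa [← Category.assoc] using congrArg ((t ⊠ a) ≫ ·) key

theorem extRight_sigmaTau (r : Q ⊗ R ⟶ Q) (a : W.X ⟶ R) :
    ((t ⊠ a) ≫ extRight S P r) ≫ sigmaTau S P Q = (t ≫ sigmaTau S P Q ⊠ a) ≫ intRight S r P :=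
  extRight_sigmaTau' t r a

theorem intLeft_sigmaTau (l : R ⊗ Q ⟶ Q) (a : W.X ⟶ R) :
    ((a ⊠ t) ≫ intLeft S P l) ≫ sigmaTau S P Q = (a ⊠ t ≫ sigmaTau S P Q) ≫ extLeft S l P := by
  have key : intLeft S P l ≫ sigmaTau S P Q = R ◁ sigmaTau S P Q ≫ extLeft S l P := by
    refine pure_ext fun W => ?_
    intro a s p q
    simp [← Category.assoc]
  simpa [← Category.assoc] using congrArg ((a ⊠ t) ≫ ·) key

theorem intRight_sigmaTau (r : P ⊗ R ⟶ P) (a : W.X ⟶ R) :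
    ((t ⊠ a) ≫ intRight S r Q) ≫ sigmaTau S P Q = (t ≫ sigmaTau S P Q ⊠ a) ≫ extRight S Q r := by
  have key : intRight S r Q ≫ sigmaTau S P Q = sigmaTau S P Q ▷ R ≫ extRight S Q r := by
    refine pure_ext fun W => ?_
    intro s p q a
    simp [← Category.assoc]
  simpa [← Category.assoc] using congrArg ((t ⊠ a) ≫ ·) key

theorem extLeft_intLeft (l : R ⊗ P ⟶ P') (l' : R' ⊗ Q ⟶ Q) (a : W.X ⟶ R) (b : W.X ⟶ R') :
    (a ⊠ (b ⊠ t) ≫ intLeft S P l') ≫ extLeft S l Q =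
      (b ⊠ (a ⊠ t) ≫ extLeft S l Q) ≫ intLeft S P' l' := by
  have key : R ◁ intLeft S P l' ≫ extLeft S l Q =
      exch _ _ _ ≫ R' ◁ extLeft S l Q ≫ intLeft S P' l' := by
    refine pure_ext fun W => ?_
    intro a b s p q
    simp [← Category.assoc]
  simpa [← Category.assoc] using congrArg ((a ⊠ b ⊠ t) ≫ ·) key

theorem extLeft_intRight (l : R ⊗ P ⟶ P') (r : P ⊗ R' ⟶ P) (r' : P' ⊗ R' ⟶ P')
    (h : l ▷ R' ≫ r' = (α_ _ _ _).hom ≫ R ◁ r ≫ l) (a : W.X ⟶ R) (b : W.X ⟶ R') :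
    (a ⊠ (t ⊠ b) ≫ intRight S r Q) ≫ extLeft S l Q =
      ((a ⊠ t) ≫ extLeft S l Q ⊠ b) ≫ intRight S r' Q := by
  have key : R ◁ intRight S r Q ≫ extLeft S l Q =
      (α_ _ _ _).inv ≫ extLeft S l Q ▷ R' ≫ intRight S r' Q := by
    refine pure_ext fun W => ?_
    intro a s p q b
    have := congrArg (((a ⊠ p) ⊠ b) ≫ ·) h
    simp [← Category.assoc] at this
    simp [← Category.assoc, this]
  simpa [← Category.assoc] using congrArg ((a ⊠ t ⊠ b) ≫ ·) key

theorem extLeft_extRight (l : R ⊗ P ⟶ P') (r : Q ⊗ R' ⟶ Q') (a : W.X ⟶ R) (b : W.X ⟶ R') :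
    (a ⊠ (t ⊠ b) ≫ extRight S P r) ≫ extLeft S l Q' =
      ((a ⊠ t) ≫ extLeft S l Q ⊠ b) ≫ extRight S P' r := by
  have key : R ◁ extRight S P r ≫ extLeft S l Q' =
      (α_ _ _ _).inv ≫ extLeft S l Q ▷ R' ≫ extRight S P' r := by
    refine pure_ext fun W => ?_
    intro a s p q b
    simp [← Category.assoc]
  simpa [← Category.assoc] using congrArg ((a ⊠ t ⊠ b) ≫ ·) key

theorem extLeft_bimod_right (M : Bimod A A) (m : W.X ⟶ M.X) (a : W.X ⟶ A.X)
    (t : W.X ⟶ (S ⊗ A.X) ⊗ Q) :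
    (m ⊠ (a ⊠ t) ≫ extLeft S μ[A.X] Q) ≫ extLeft S M.actRight Q =
      ((m ⊠ a) ≫ M.actRight ⊠ t) ≫ extLeft S M.actRight Q := by
  have key : M.X ◁ extLeft S μ[A.X] Q ≫ extLeft S M.actRight Q =
      (α_ _ _ _).inv ≫ M.actRight ▷ _ ≫ extLeft S M.actRight Q := by
    refine pure_ext fun W => ?_
    intro m a s p q
    simp [← Category.assoc, (isBiaction_bimod M).mul_right]
  simpa only [← Category.assoc, pair_whiskerLeft, pair_associator_inv, pair_whiskerRight] using
    congrArg ((m ⊠ a ⊠ t) ≫ ·) key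

theorem extLeft_bimod_left (M : Bimod A A) (a : W.X ⟶ A.X) (m : W.X ⟶ M.X)
    (t : W.X ⟶ (S ⊗ A.X) ⊗ Q) :
    ((a ⊠ m) ≫ M.actLeft ⊠ t) ≫ extLeft S M.actRight Q =
      (a ⊠ (m ⊠ t) ≫ extLeft S M.actRight Q) ≫ extLeft S M.actLeft Q := by
  have key : M.actLeft ▷ _ ≫ extLeft S M.actRight Q =
      (α_ _ _ _).hom ≫ A.X ◁ extLeft S M.actRight Q ≫ extLeft S M.actLeft Q := by
    refine pure_ext fun W => ?_
    intro a m s p q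
    simp [← Category.assoc, (isBiaction_bimod M).left_right]
  simpa only [← Category.assoc, pair_whiskerLeft, pair_associator_hom, pair_whiskerRight] using
    congrArg (((a ⊠ m) ⊠ t) ≫ ·) key

theorem intRight'_sigmaTau (M : Bimod A A) (t : W.X ⟶ (S ⊗ A.X) ⊗ A.X) (m : W.X ⟶ M.X)
    (a b : W.X ⟶ A.X) :
    ((((t ⊠ m) ≫ intRight' S M.actLeft A.X ⊠ a) ≫ extRight S M.X μ[A.X] ⊠ b) ≫
        intRight S M.actRight A.X) ≫ sigmaTau S M.X A.X =
      ((t ≫ sigmaTau S A.X A.X ⊠ a) ≫ intRight S μ[A.X] A.X ⊠ (m ⊠ b) ≫ M.actRight) ≫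
        extRight S A.X M.actLeft := by
  have key : intRight' S M.actLeft A.X ▷ A.X ▷ A.X ≫ extRight S M.X μ[A.X] ▷ A.X ≫
        intRight S M.actRight A.X ≫ sigmaTau S M.X A.X =
      sigmaTau S A.X A.X ▷ M.X ▷ A.X ▷ A.X ≫ sigmaTau _ _ _ ▷ A.X ≫
        intRight S μ[A.X] A.X ▷ M.X ▷ A.X ≫ (α_ _ _ _).hom ≫ _ ◁ M.actRight ≫
          extRight S A.X M.actLeft := by
    refine pure_ext fun W => ?_
    intro s p q m a b
    simp only [← Category.assoc, pair_whiskerRight, pair_whiskerLeft, pair_associator_hom,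
      pair_intRight', pair_extRight, pair_intRight, pair_sigmaTau,
      (isBiaction_bimod M).left_right]
  simpa only [← Category.assoc, pair_whiskerRight, pair_whiskerLeft, pair_associator_hom,
    pair_sigmaTau] using congrArg ((((t ⊠ m) ⊠ a) ⊠ b) ≫ ·) key

theorem extRight_intLeft (r : Q ⊗ R ⟶ Q) (l : R' ⊗ Q ⟶ Q)
    (h : l ▷ R ≫ r = (α_ _ _ _).hom ≫ R' ◁ r ≫ l) (a : W.X ⟶ R) (b : W.X ⟶ R') :
    ((b ⊠ t) ≫ intLeft S P l ⊠ a) ≫ extRight S P r =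
      (b ⊠ (t ⊠ a) ≫ extRight S P r) ≫ intLeft S P l := by
  have key : intLeft S P l ▷ R ≫ extRight S P r =
      (α_ _ _ _).hom ≫ R' ◁ extRight S P r ≫ intLeft S P l := by
    refine pure_ext fun W => ?_
    intro b s p q a
    have := congrArg (((b ⊠ q) ⊠ a) ≫ ·) h
    simp [← Category.assoc] at this
    simp [← Category.assoc, this]
  simpa [← Category.assoc] using congrArg (((b ⊠ t) ⊠ a) ≫ ·) key

theorem extRight_intRight (r : Q ⊗ R ⟶ Q) (r' : P ⊗ R' ⟶ P) (a : W.X ⟶ R) (b : W.X ⟶ R') :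
    ((t ⊠ b) ≫ intRight S r' Q ⊠ a) ≫ extRight S P r =
      ((t ⊠ a) ≫ extRight S P r ⊠ b) ≫ intRight S r' Q := by
  have key : intRight S r' Q ▷ R ≫ extRight S P r =
      sigmaTau _ _ _ ≫ extRight S P r ▷ R' ≫ intRight S r' Q := by
    refine pure_ext fun W => ?_
    intro s p q b a
    simp [← Category.assoc]
  simpa [← Category.assoc] using congrArg (((t ⊠ b) ⊠ a) ≫ ·) key

end Commutation

end Biactions

end DoubleAlgebra

/-! ### Noncommutative one-forms -/

namespace DoubleAlgebra

section Forms

open ComonObj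

variable {C : Type u} [Category.{v} C] [MonoidalCategory C] [SymmetricCategory C]
  [Preadditive C] [MonoidalPreadditive C] [HasBinaryBiproducts C] [HasCoequalizers C]
variable {W : CommComon C} (A : Mon C)

/-- The epimorphism `A ⊗ A ⟶ Ω_A`, `c ⊗ e ↦ dc · e`. -/
noncomputable def omegaGen : A.X ⊗ A.X ⟶ (omega A).X := univD A ▷ A.X ≫ (omega A).actRight

/-- The section `Ω_A ⟶ A ⊗ A`, `b dc e ↦ bc ⊗ e - b ⊗ ce`, of `omegaGen`; it is right linear. -/
noncomputable def omegaSec : (omega A).X ⟶ A.X ⊗ A.X :=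
  omegaσ A ≫ ((α_ _ _ _).inv ≫ μ[A.X] ▷ A.X - A.X ◁ μ[A.X])

/-- The projection to `Ω_A`, with codomain in the form `(omega A).X`. -/
noncomputable def omegaProj : A.X ⊗ (A.X ⊗ A.X) ⟶ (omega A).X := omegaπ A

instance : Epi (omegaProj A) := inferInstanceAs (Epi (omegaπ A))

variable {A}

theorem omegaProj_actLeft (a b c e : W.X ⟶ A.X) :
    (a ⊠ (b ⊠ c ⊠ e) ≫ omegaProj A) ≫ (omega A).actLeft =
      ((a ⊠ b) ≫ μ[A.X] ⊠ c ⊠ e) ≫ omegaProj A := by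
  have h : freeL A A.X ≫ omegaProj A = A.X ◁ omegaProj A ≫ (omega A).actLeft :=
    (omegaπHom A).left_act_hom
  have := congrArg ((a ⊠ b ⊠ c ⊠ e) ≫ ·) h
  simp only [← Category.assoc, freeL, pair_associator_inv, pair_whiskerRight, pair_whiskerLeft]
    at this
  exact this.symm

theorem omegaProj_actRight (a b c e : W.X ⟶ A.X) :
    ((a ⊠ b ⊠ c) ≫ omegaProj A ⊠ e) ≫ (omega A).actRight =
      (a ⊠ b ⊠ (c ⊠ e) ≫ μ[A.X]) ≫ omegaProj A := by
  have h : freeR A A.X ≫ omegaProj A = omegaProj A ▷ A.X ≫ (omega A).actRight :=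
    (omegaπHom A).right_act_hom
  have := congrArg (((a ⊠ b ⊠ c) ⊠ e) ≫ ·) h
  simp only [← Category.assoc, freeR, pair_associator_hom, pair_whiskerRight, pair_whiskerLeft]
    at this
  exact this.symm

theorem omegaProj_rel (a b c e : W.X ⟶ A.X) :
    ((a ⊠ b) ≫ μ[A.X] ⊠ c ⊠ e) ≫ omegaProj A + (a ⊠ b ⊠ (c ⊠ e) ≫ μ[A.X]) ≫ omegaProj A =
      (a ⊠ (b ⊠ c) ≫ μ[A.X] ⊠ e) ≫ omegaProj A := by
  have h : relSum A ≫ omegaProj A = relMid A ≫ omegaProj A := rel_comp_omegaπ A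
  have := congrArg ((a ⊠ (b ⊠ c) ⊠ e) ≫ ·) h
  simpa only [← Category.assoc, relSum, relMid, Preadditive.comp_add, Preadditive.add_comp,
    pair_associator_hom, pair_associator_inv, pair_whiskerRight, pair_whiskerLeft] using this

theorem comp_univD (b : W.X ⟶ A.X) :
    b ≫ univD A = (oneEl A W ⊠ b ⊠ oneEl A W) ≫ omegaProj A := by
  have : univD A = (ρ_ A.X).inv ≫ A.X ◁ η[A.X] ≫ (λ_ (A.X ⊗ A.X)).inv ≫
    η[A.X] ▷ (A.X ⊗ A.X) ≫ omegaProj A := rfl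
  rw [this]
  simp only [← Category.assoc, comp_rightUnitor_inv, comp_leftUnitor_inv, pair_whiskerLeft,
    pair_whiskerRight, counit_comp_one]

theorem pair_omegaGen (c e : W.X ⟶ A.X) :
    (c ⊠ e) ≫ omegaGen A = (c ≫ univD A ⊠ e) ≫ (omega A).actRight := by
  simp only [omegaGen, ← Category.assoc, pair_whiskerRight]

theorem pair_omegaGen' (c e : W.X ⟶ A.X) :
    (c ⊠ e) ≫ omegaGen A = (oneEl A W ⊠ c ⊠ e) ≫ omegaProj A := by
  rw [pair_omegaGen, comp_univD, omegaProj_actRight, oneEl_mul]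

theorem pair_omegaProj (b c e : W.X ⟶ A.X) :
    (b ⊠ c ⊠ e) ≫ omegaProj A = (b ⊠ (c ⊠ e) ≫ omegaGen A) ≫ (omega A).actLeft := by
  rw [pair_omegaGen', omegaProj_actLeft, mul_oneEl]

/-- The Leibniz rule. -/
theorem mul_univD (a b : W.X ⟶ A.X) :
    ((a ⊠ b) ≫ μ[A.X]) ≫ univD A =
      (a ⊠ b ≫ univD A) ≫ (omega A).actLeft + (a ≫ univD A ⊠ b) ≫ (omega A).actRight := by
  rw [comp_univD, comp_univD, comp_univD, omegaProj_actLeft, omegaProj_actRight, ← omegaProj_rel,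
    oneEl_mul, oneEl_mul, mul_oneEl, mul_oneEl]

theorem omegaProj_sec (b c e : W.X ⟶ A.X) :
    ((b ⊠ c ⊠ e) ≫ omegaProj A) ≫ omegaSec A =
      (b ⊠ c) ≫ μ[A.X] ⊠ e - b ⊠ (c ⊠ e) ≫ μ[A.X] := by
  have h : omegaProj A ≫ omegaSec A =
      relSplit A ≫ ((α_ _ _ _).inv ≫ μ[A.X] ▷ A.X - A.X ◁ μ[A.X]) := by
    rw [← omegaπ_σ, Category.assoc]; rfl
  rw [Category.assoc, h, relSplit]
  simp only [Preadditive.comp_sub, Preadditive.sub_comp, ← Category.assoc, pair_associator_inv,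
    pair_whiskerRight, pair_whiskerLeft, comp_leftUnitor_inv, counit_comp_one, oneEl_mul,
    pair_mul_assoc]
  abel

@[simp]
theorem omegaGen_sec (c e : W.X ⟶ A.X) :
    ((c ⊠ e) ≫ omegaGen A) ≫ omegaSec A = c ⊠ e - oneEl A W ⊠ (c ⊠ e) ≫ μ[A.X] := by
  rw [pair_omegaGen', omegaProj_sec, oneEl_mul]

@[simp]
theorem actLeft_omegaGen_sec (b c e : W.X ⟶ A.X) :
    ((b ⊠ (c ⊠ e) ≫ omegaGen A) ≫ (omega A).actLeft) ≫ omegaSec A =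
      (b ⊠ c) ≫ μ[A.X] ⊠ e - b ⊠ (c ⊠ e) ≫ μ[A.X] := by
  rw [← pair_omegaProj, omegaProj_sec]

theorem actRight_omegaGen (c e e' : W.X ⟶ A.X) :
    ((c ⊠ e) ≫ omegaGen A ⊠ e') ≫ (omega A).actRight =
      (c ⊠ (e ⊠ e') ≫ μ[A.X]) ≫ omegaGen A := by
  rw [pair_omegaGen, pair_omegaGen, (isBiaction_bimod (omega A)).mul_right]

variable (A) in
/-- One-forms are a retract of `A ⊗ A`: they are generated, as a right module, by exact forms. -/
theorem omegaSec_gen : omegaSec A ≫ omegaGen A = 𝟙 _ := by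
  rw [← cancel_epi (omegaProj A)]
  refine pure_ext fun W => ?_
  intro b c e
  simp only [← Category.assoc, Category.comp_id]
  rw [omegaProj_sec, Preadditive.sub_comp, pair_omegaGen',
    pair_omegaGen', ← omegaProj_rel, oneEl_mul]
  simp

instance : IsSplitEpi (omegaGen A) := IsSplitEpi.mk' ⟨omegaSec A, omegaSec_gen A⟩

theorem oneEl_univD : oneEl A W ≫ univD A = 0 := by
  have h := mul_univD (oneEl A W) (oneEl A W)
  rw [oneEl_mul, (isBiaction_bimod (omega A)).one_left, (isBiaction_bimod (omega A)).one_right] at h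
  simpa using h

end Forms

end DoubleAlgebra

/-! ### The induced anchor -/

namespace DoubleAlgebra

section Poisson

variable {C : Type u} [Category.{v} C] [MonoidalCategory C] [SymmetricCategory C]
  [Preadditive C]
variable {W : CommComon C} {A : Mon C} {S : C} {f : (S ⊗ A.X) ⊗ (S ⊗ A.X) ⟶ (S ⊗ A.X) ⊗ A.X}

namespace IsDoublePoisson

variable (hf : IsDoublePoisson S A f)
include hf

theorem antisymm_el (x y : W.X ⟶ S ⊗ A.X) :
    (x ⊠ y) ≫ f = -(((y ⊠ x) ≫ f) ≫ sigmaTau S A.X A.X) := by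
  have := congrArg ((x ⊠ y) ≫ ·) hf.antisymm
  simpa only [Preadditive.comp_neg, ← Category.assoc, pair_braiding_hom] using this

theorem left_el (s : W.X ⟶ S) (a b : W.X ⟶ A.X) (y : W.X ⟶ S ⊗ A.X) :
    ((s ⊠ (a ⊠ b) ≫ μ[A.X]) ⊠ y) ≫ f =
      (a ⊠ ((s ⊠ b) ⊠ y) ≫ f) ≫ intLeft S A.X μ[A.X] +
        (((s ⊠ a) ⊠ y) ≫ f ⊠ b) ≫ intRight S μ[A.X] A.X := by
  have := congrArg (((s ⊠ a ⊠ b) ⊠ y) ≫ ·) hf.left_derivation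
  simpa only [Preadditive.comp_add, ← Category.assoc, pair_whiskerLeft, pair_whiskerRight,
    pair_pullLeft₁, pair_pullRight₁] using this

variable [MonoidalPreadditive C] [HasBinaryBiproducts C]

/-- By antisymmetry, the bracket is also a derivation in its second variable, for the external
structure. -/
theorem right_el (x : W.X ⟶ S ⊗ A.X) (s : W.X ⟶ S) (a b : W.X ⟶ A.X) :
    (x ⊠ s ⊠ (a ⊠ b) ≫ μ[A.X]) ≫ f =
      (a ⊠ (x ⊠ s ⊠ b) ≫ f) ≫ extLeft S μ[A.X] A.X +
        ((x ⊠ s ⊠ a) ≫ f ⊠ b) ≫ extRight S A.X μ[A.X] := by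
  rw [hf.antisymm_el, hf.left_el, Preadditive.add_comp, intLeft_sigmaTau, intRight_sigmaTau,
    hf.antisymm_el x, hf.antisymm_el x]
  simp only [pair_neg, neg_pair, Preadditive.neg_comp, neg_add]

/-- A derivation kills the unit; hence the formulas below are well defined on one-forms, whose
section `omegaSec` has values modulo elements `1 ⊗ e`. -/
theorem one_left (s : W.X ⟶ S) (y : W.X ⟶ S ⊗ A.X) : ((s ⊠ oneEl A W) ⊠ y) ≫ f = 0 := by
  have h := hf.left_el s (oneEl A W) (oneEl A W) y
  have hb := isBiaction_int S (isBiaction_mul A) (isBiaction_mul A)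
  rw [oneEl_mul, hb.one_left, hb.one_right] at h
  simpa using h

theorem one_right (x : W.X ⟶ S ⊗ A.X) (s : W.X ⟶ S) : (x ⊠ s ⊠ oneEl A W) ≫ f = 0 := by
  rw [hf.antisymm_el, hf.one_left]
  simp

end IsDoublePoisson

section Anchor

variable [MonoidalPreadditive C] [HasBinaryBiproducts C] [HasCoequalizers C]

/-- The anchor `ρ(b dc e, y) = b * {c, y} * e` on one-forms, where `*` is the internal action. -/
noncomputable def koszulAnchor (f : (S ⊗ A.X) ⊗ (S ⊗ A.X) ⟶ (S ⊗ A.X) ⊗ A.X) :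
    (S ⊗ (omega A).X) ⊗ (S ⊗ A.X) ⟶ (S ⊗ A.X) ⊗ A.X :=
  (S ◁ omegaSec A) ▷ (S ⊗ A.X) ≫ pullRight₁ S A.X A.X (S ⊗ A.X) ≫ f ▷ A.X ≫
    intRight S μ[A.X] A.X

variable (hf : IsDoublePoisson S A f)

theorem koszulAnchor_sec (s : W.X ⟶ S) (ω : W.X ⟶ (omega A).X) (y : W.X ⟶ S ⊗ A.X) :
    ((s ⊠ ω) ⊠ y) ≫ koszulAnchor f = (((((s ⊠ ω ≫ omegaSec A) ⊠ y) ≫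
      pullRight₁ S A.X A.X (S ⊗ A.X)) ≫ f ▷ A.X)) ≫ intRight S μ[A.X] A.X := by
  simp only [koszulAnchor, ← Category.assoc, pair_whiskerRight, pair_whiskerLeft]

include hf

theorem koszulAnchor_gen (s : W.X ⟶ S) (c e : W.X ⟶ A.X) (y : W.X ⟶ S ⊗ A.X) :
    ((s ⊠ (c ⊠ e) ≫ omegaGen A) ⊠ y) ≫ koszulAnchor f =
      (((s ⊠ c) ⊠ y) ≫ f ⊠ e) ≫ intRight S μ[A.X] A.X := by
  rw [koszulAnchor_sec, omegaGen_sec]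
  simp only [pair_sub, sub_pair, Preadditive.sub_comp, pair_pullRight₁, pair_whiskerRight,
    hf.one_left, zero_pair, sub_zero]

theorem koszulAnchor_univD (s : W.X ⟶ S) (c : W.X ⟶ A.X) (y : W.X ⟶ S ⊗ A.X) :
    ((s ⊠ c ≫ univD A) ⊠ y) ≫ koszulAnchor f = ((s ⊠ c) ⊠ y) ≫ f := by
  have hb := isBiaction_int S (isBiaction_mul A) (isBiaction_mul A)
  have h := koszulAnchor_gen hf s c (oneEl A W) y
  rwa [pair_omegaGen, (isBiaction_bimod _).one_right, hb.one_right] at h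

theorem isAnchorLinear_koszulAnchor : IsAnchorLinear S (koszulAnchor f) where
  left := by
    have hb := isBiaction_int S (isBiaction_mul A) (isBiaction_mul A)
    rw [← cancel_epi (A.X ◁ ((S ◁ omegaGen A) ▷ (S ⊗ A.X)))]
    refine pure_ext fun W => ?_
    intro b s c e t y
    simp only [← Category.assoc, pair_whiskerLeft, pair_whiskerRight, pair_extLeft,
      koszulAnchor_gen hf]
    rw [koszulAnchor_sec, actLeft_omegaGen_sec]
    simp only [pair_sub, sub_pair, Preadditive.sub_comp, pair_pullRight₁, pair_whiskerRight,
      hf.left_el, add_pair, Preadditive.add_comp, hb.left_right, hb.mul_right, add_sub_cancel_right]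
  right := by
    have hb := isBiaction_int S (isBiaction_mul A) (isBiaction_mul A)
    rw [← cancel_epi (((S ◁ omegaGen A) ▷ (S ⊗ A.X)) ▷ A.X)]
    refine pure_ext fun W => ?_
    intro s c e t y b
    simp only [← Category.assoc, pair_whiskerLeft, pair_whiskerRight, pair_intRight,
      koszulAnchor_gen hf, actRight_omegaGen, hb.mul_right]

theorem isAnchor_koszulAnchor : IsAnchor S (koszulAnchor f) where
  linear := isAnchorLinear_koszulAnchor hf
  derivation := by
    rw [← cancel_epi ((S ◁ omegaGen A) ▷ (S ⊗ (A.X ⊗ A.X)))]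
    refine pure_ext fun W => ?_
    intro s c e t a b
    simp only [← Category.assoc, pair_whiskerLeft, pair_whiskerRight, Preadditive.comp_add,
      koszulAnchor_gen hf, pair_pullLeft₂, pair_pullRight₂, hf.right_el, add_pair,
      Preadditive.add_comp]
    rw [extLeft_intRight _ _ _ _ (MonObj.mul_assoc _), extRight_intRight]

theorem isInducedAnchor_koszulAnchor : IsInducedAnchor f (koszulAnchor f) where
  linear := isAnchorLinear_koszulAnchor hf
  univD_comp := by
    refine pure_ext fun W => ?_
    intro s c t y
    simp only [← Category.assoc, pair_whiskerLeft, pair_whiskerRight, koszulAnchor_univD hf]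

omit hf in
/-- An anchor which is linear is determined by its values on exact forms. -/
theorem IsAnchorLinear.hom_ext {ρ ρ' : (S ⊗ (omega A).X) ⊗ (S ⊗ A.X) ⟶ (S ⊗ A.X) ⊗ A.X}
    (h : IsAnchorLinear S ρ) (h' : IsAnchorLinear S ρ')
    (hd : (S ◁ univD A) ▷ (S ⊗ A.X) ≫ ρ = (S ◁ univD A) ▷ (S ⊗ A.X) ≫ ρ') : ρ = ρ' := by
  rw [← cancel_epi ((S ◁ omegaGen A) ▷ (S ⊗ A.X))]
  refine pure_ext fun W => ?_
  intro s c e t y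
  have h1 := congrArg ((((s ⊠ c ≫ univD A) ⊠ (t ⊠ y)) ⊠ e) ≫ ·) h.right
  have h2 := congrArg ((((s ⊠ c ≫ univD A) ⊠ (t ⊠ y)) ⊠ e) ≫ ·) h'.right
  have h3 := congrArg (((s ⊠ c) ⊠ (t ⊠ y)) ≫ ·) hd
  simp only [← Category.assoc, pair_whiskerLeft, pair_whiskerRight, pair_intRight] at h1 h2 h3
  simp only [← Category.assoc, pair_whiskerLeft, pair_whiskerRight, pair_omegaGen, h1, h2, h3]

end Anchor

end Poisson

end DoubleAlgebra

/-! ### The Koszul double bracket -/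

namespace DoubleAlgebra

section Components

variable {C : Type u} [Category.{v} C] [MonoidalCategory C] [SymmetricCategory C]
  [Preadditive C] [MonoidalPreadditive C] [HasBinaryBiproducts C]
variable {A : Mon C} {M : Bimod A A} {S X Y : C}

theorem comp_compL (g : Y ⟶ X) (B : X ⟶ S ⊗ ((M.X ⊗ A.X) ⊞ (A.X ⊗ M.X))) :
    compL (g ≫ B) = g ≫ compL B := by simp [compL]

theorem comp_compR (g : Y ⟶ X) (B : X ⟶ S ⊗ ((M.X ⊗ A.X) ⊞ (A.X ⊗ M.X))) :
    compR (g ≫ B) = g ≫ compR B := by simp [compR]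

theorem eq_compL_add_compR (B : X ⟶ S ⊗ ((M.X ⊗ A.X) ⊞ (A.X ⊗ M.X))) :
    B = compL B ≫ (α_ _ _ _).hom ≫ S ◁ biprod.inl + compR B ≫ (α_ _ _ _).hom ≫ S ◁ biprod.inr := by
  simp only [compL, compR, Category.assoc, Iso.inv_hom_id_assoc, ← whiskerLeft_comp,
    ← Preadditive.comp_add, ← MonoidalPreadditive.whiskerLeft_add, biprod.total, whiskerLeft_id,
    Category.comp_id]

theorem hom_ext_components {B B' : X ⟶ S ⊗ ((M.X ⊗ A.X) ⊞ (A.X ⊗ M.X))}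
    (hL : compL B = compL B') (hR : compR B = compR B') : B = B' := by
  rw [eq_compL_add_compR B, eq_compL_add_compR B', hL, hR]

/-- Antisymmetry expresses the component in `ΣA ⊗ M` through the one in `ΣM ⊗ A`. -/
theorem isAntisymm_iff {B : (S ⊗ M.X) ⊗ (S ⊗ M.X) ⟶ S ⊗ ((M.X ⊗ A.X) ⊞ (A.X ⊗ M.X))} :
    IsAntisymm S B ↔ ∀ {W : CommComon C} (x y : W.X ⟶ S ⊗ M.X),
      (x ⊠ y) ≫ compR B = -(((y ⊠ x) ≫ compL B) ≫ sigmaTau S M.X A.X) := by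
  have hl : compL (B ≫ S ◁ biprod.lift (biprod.snd ≫ (β_ A.X M.X).hom)
      (biprod.fst ≫ (β_ M.X A.X).hom)) = compR B ≫ sigmaTau S A.X M.X := by
    simp only [compL, compR, sigmaTau, Category.assoc, ← whiskerLeft_comp_assoc, biprod.lift_fst,
      Iso.inv_hom_id_assoc]
  have hr : compR (B ≫ S ◁ biprod.lift (biprod.snd ≫ (β_ A.X M.X).hom)
      (biprod.fst ≫ (β_ M.X A.X).hom)) = compL B ≫ sigmaTau S M.X A.X := by
    simp only [compL, compR, sigmaTau, Category.assoc, ← whiskerLeft_comp_assoc, biprod.lift_snd,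
      Iso.inv_hom_id_assoc]
  have hnl : ∀ B : (S ⊗ M.X) ⊗ (S ⊗ M.X) ⟶ S ⊗ ((M.X ⊗ A.X) ⊞ (A.X ⊗ M.X)),
      compL (-B) = - compL B := fun B => by simp [compL]
  have hnr : ∀ B : (S ⊗ M.X) ⊗ (S ⊗ M.X) ⟶ S ⊗ ((M.X ⊗ A.X) ⊞ (A.X ⊗ M.X)),
      compR (-B) = - compR B := fun B => by simp [compR]
  constructor
  · intro h W x y
    have h1 := congrArg ((y ⊠ x) ≫ compR ·) h
    simpa only [comp_compR, hnr, hr, Preadditive.comp_neg, ← Category.assoc, pair_braiding_hom]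
      using h1
  · intro h
    have h1 : (β_ (S ⊗ M.X) (S ⊗ M.X)).hom ≫ compR B = -(compL B ≫ sigmaTau S M.X A.X) := by
      refine pure_ext fun W => ?_
      intro s m t n
      simp only [← Category.assoc, Preadditive.comp_neg, pair_braiding_hom, h]
    have h2 : (β_ (S ⊗ M.X) (S ⊗ M.X)).hom ≫ compL B = -(compR B ≫ sigmaTau S A.X M.X) := by
      refine pure_ext fun W => ?_
      intro s m t n
      simp only [← Category.assoc, Preadditive.comp_neg, pair_braiding_hom, h,
        Preadditive.neg_comp, sigmaTau_sigmaTau, neg_neg]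
    refine hom_ext_components ?_ ?_
    · rw [hnl, hl, comp_compL, h2]
    · rw [hnr, hr, comp_compR, h1]

theorem IsAntisymm.el {W : CommComon C}
    {B : (S ⊗ M.X) ⊗ (S ⊗ M.X) ⟶ S ⊗ ((M.X ⊗ A.X) ⊞ (A.X ⊗ M.X))}
    (h : IsAntisymm S B) (x y : W.X ⟶ S ⊗ M.X) :
    (x ⊠ y) ≫ compR B = -(((y ⊠ x) ≫ compL B) ≫ sigmaTau S M.X A.X) :=
  isAntisymm_iff.1 h x y

namespace IsAnchorDerivation

variable {W : CommComon C} {ρ : (S ⊗ M.X) ⊗ (S ⊗ A.X) ⟶ (S ⊗ A.X) ⊗ A.X}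
  {B : (S ⊗ M.X) ⊗ (S ⊗ M.X) ⟶ S ⊗ ((M.X ⊗ A.X) ⊞ (A.X ⊗ M.X))}
  (h : IsAnchorDerivation S ρ B) (x : W.X ⟶ S ⊗ M.X) (s : W.X ⟶ S) (a : W.X ⟶ A.X)
  (m : W.X ⟶ M.X)
include h

theorem left_compL_el : (x ⊠ s ⊠ (a ⊠ m) ≫ M.actLeft) ≫ compL B =
    (a ⊠ (x ⊠ s ⊠ m) ≫ compL B) ≫ extLeft S M.actLeft A.X := by
  simpa only [← Category.assoc, pair_whiskerLeft, pair_pullLeft₂] using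
    congrArg ((x ⊠ s ⊠ a ⊠ m) ≫ ·) h.left_compL

theorem left_compR_el : (x ⊠ s ⊠ (a ⊠ m) ≫ M.actLeft) ≫ compR B =
    ((x ⊠ s ⊠ a) ≫ ρ ⊠ m) ≫ extRight S A.X M.actLeft +
      (a ⊠ (x ⊠ s ⊠ m) ≫ compR B) ≫ extLeft S μ[A.X] M.X := by
  simpa only [← Category.assoc, pair_whiskerLeft, pair_whiskerRight, pair_pullLeft₂,
    pair_pullRight₂, Preadditive.comp_add] using
    congrArg ((x ⊠ s ⊠ a ⊠ m) ≫ ·) h.left_compR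

theorem right_compL_el : (x ⊠ s ⊠ (m ⊠ a) ≫ M.actRight) ≫ compL B =
    ((x ⊠ s ⊠ m) ≫ compL B ⊠ a) ≫ extRight S M.X μ[A.X] +
      (m ⊠ (x ⊠ s ⊠ a) ≫ ρ) ≫ extLeft S M.actRight A.X := by
  simpa only [← Category.assoc, pair_whiskerLeft, pair_whiskerRight, pair_pullLeft₂,
    pair_pullRight₂, Preadditive.comp_add] using
    congrArg ((x ⊠ s ⊠ m ⊠ a) ≫ ·) h.right_compL

theorem right_compR_el : (x ⊠ s ⊠ (m ⊠ a) ≫ M.actRight) ≫ compR B =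
    ((x ⊠ s ⊠ m) ≫ compR B ⊠ a) ≫ extRight S A.X M.actRight := by
  simpa only [← Category.assoc, pair_whiskerLeft, pair_whiskerRight, pair_pullRight₂] using
    congrArg ((x ⊠ s ⊠ m ⊠ a) ≫ ·) h.right_compR

end IsAnchorDerivation

end Components

section Koszul

variable {C : Type u} [Category.{v} C] [MonoidalCategory C] [SymmetricCategory C]
  [Preadditive C] [MonoidalPreadditive C] [HasBinaryBiproducts C] [HasCoequalizers C]
variable {W : CommComon C} {A : Mon C} {S : C} {f : (S ⊗ A.X) ⊗ (S ⊗ A.X) ⟶ (S ⊗ A.X) ⊗ A.X}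

section Leibniz

variable (t : W.X ⟶ (S ⊗ A.X) ⊗ A.X)

theorem extLeft_univD (a : W.X ⟶ A.X) :
    ((a ⊠ t) ≫ extLeft S μ[A.X] A.X) ≫ (S ◁ univD A) ▷ A.X =
      (a ⊠ t ≫ (S ◁ univD A) ▷ A.X) ≫ extLeft S (omega A).actLeft A.X +
        (a ≫ univD A ⊠ t) ≫ extLeft S (omega A).actRight A.X := by
  have key : extLeft S μ[A.X] A.X ≫ (S ◁ univD A) ▷ A.X =
      A.X ◁ (S ◁ univD A) ▷ A.X ≫ extLeft S (omega A).actLeft A.X +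
        univD A ▷ _ ≫ extLeft S (omega A).actRight A.X := by
    refine pure_ext fun W => ?_
    intro a s p q
    simp only [← Category.assoc, Preadditive.comp_add, pair_extLeft, pair_whiskerLeft,
      pair_whiskerRight, mul_univD, pair_add, add_pair]
  simpa only [← Category.assoc, Preadditive.comp_add, pair_whiskerLeft, pair_whiskerRight] using
    congrArg ((a ⊠ t) ≫ ·) key

theorem extRight_univD (a : W.X ⟶ A.X) :
    ((t ⊠ a) ≫ extRight S A.X μ[A.X]) ≫ (S ◁ univD A) ▷ A.X =
      (t ≫ (S ◁ univD A) ▷ A.X ⊠ a) ≫ extRight S (omega A).X μ[A.X] := by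
  have key : extRight S A.X μ[A.X] ≫ (S ◁ univD A) ▷ A.X =
      (S ◁ univD A) ▷ A.X ▷ A.X ≫ extRight S (omega A).X μ[A.X] := by
    refine pure_ext fun W => ?_
    intro s p q a
    simp only [← Category.assoc, pair_extRight, pair_whiskerLeft, pair_whiskerRight]
  simpa only [← Category.assoc, pair_whiskerLeft, pair_whiskerRight] using
    congrArg ((t ⊠ a) ≫ ·) key

theorem intLeft_univD (a : W.X ⟶ A.X) :
    ((a ⊠ t) ≫ intLeft S A.X μ[A.X]) ≫ (S ◁ univD A) ▷ A.X =
      (a ⊠ t ≫ (S ◁ univD A) ▷ A.X) ≫ intLeft S (omega A).X μ[A.X] := by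
  have key : intLeft S A.X μ[A.X] ≫ (S ◁ univD A) ▷ A.X =
      A.X ◁ (S ◁ univD A) ▷ A.X ≫ intLeft S (omega A).X μ[A.X] := by
    refine pure_ext fun W => ?_
    intro a s p q
    simp only [← Category.assoc, pair_intLeft, pair_whiskerLeft, pair_whiskerRight]
  simpa only [← Category.assoc, pair_whiskerLeft, pair_whiskerRight] using
    congrArg ((a ⊠ t) ≫ ·) key

theorem intRight_univD (a : W.X ⟶ A.X) :
    ((t ⊠ a) ≫ intRight S μ[A.X] A.X) ≫ (S ◁ univD A) ▷ A.X =
      (t ≫ (S ◁ univD A) ▷ A.X ⊠ a) ≫ intRight S (omega A).actRight A.X +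
        (t ⊠ a ≫ univD A) ≫ intRight' S (omega A).actLeft A.X := by
  have key : intRight S μ[A.X] A.X ≫ (S ◁ univD A) ▷ A.X =
      (S ◁ univD A) ▷ A.X ▷ A.X ≫ intRight S (omega A).actRight A.X +
        _ ◁ univD A ≫ intRight' S (omega A).actLeft A.X := by
    refine pure_ext fun W => ?_
    intro s p q a
    simp only [← Category.assoc, Preadditive.comp_add, pair_intRight, pair_intRight',
      pair_whiskerLeft, pair_whiskerRight, mul_univD, pair_add, add_pair, add_comm]
  simpa only [← Category.assoc, Preadditive.comp_add, pair_whiskerLeft, pair_whiskerRight] using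
    congrArg ((t ⊠ a) ≫ ·) key

end Leibniz

/-- The morphism `x ⊗ (c ⊗ e) ↦ d{x, c}' ⊗ {x, c}'' e + dc {x, e}' ⊗ {x, e}''`. -/
noncomputable def koszulAux (f : (S ⊗ A.X) ⊗ (S ⊗ A.X) ⟶ (S ⊗ A.X) ⊗ A.X) :
    (S ⊗ A.X) ⊗ (S ⊗ (A.X ⊗ A.X)) ⟶ (S ⊗ (omega A).X) ⊗ A.X :=
  pullRight₂ (S ⊗ A.X) S A.X A.X ≫ f ▷ A.X ≫ (S ◁ univD A) ▷ A.X ▷ A.X ≫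
      extRight S (omega A).X μ[A.X] +
    pullLeft₂ (S ⊗ A.X) S A.X A.X ≫ A.X ◁ f ≫ univD A ▷ _ ≫ extLeft S (omega A).actRight A.X

/-- The component in `ΣΩ ⊗ A` of the Koszul double bracket, `B(dy e', ω) = B(dy, ω) * e'`, where
`*` is the internal action and `B(dy, dc e) = d{y, c}' ⊗ {y, c}'' e + dc {y, e}' ⊗ {y, e}''`. -/
noncomputable def koszulL (f : (S ⊗ A.X) ⊗ (S ⊗ A.X) ⟶ (S ⊗ A.X) ⊗ A.X) :
    (S ⊗ (omega A).X) ⊗ (S ⊗ (omega A).X) ⟶ (S ⊗ (omega A).X) ⊗ A.X :=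
  (S ◁ omegaSec A ⊗ₘ S ◁ omegaSec A) ≫ pullRight₁ S A.X A.X _ ≫ koszulAux f ▷ A.X ≫
    intRight S (omega A).actRight A.X

variable (hf : IsDoublePoisson S A f)

theorem pair_koszulAux (x : W.X ⟶ S ⊗ A.X) (t : W.X ⟶ S) (c e : W.X ⟶ A.X) :
    (x ⊠ t ⊠ c ⊠ e) ≫ koszulAux f =
      (((x ⊠ t ⊠ c) ≫ f) ≫ (S ◁ univD A) ▷ A.X ⊠ e) ≫ extRight S (omega A).X μ[A.X] +
        (c ≫ univD A ⊠ (x ⊠ t ⊠ e) ≫ f) ≫ extLeft S (omega A).actRight A.X := by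
  simp only [koszulAux, ← Category.assoc, Preadditive.comp_add, pair_whiskerLeft,
    pair_whiskerRight, pair_pullRight₂, pair_pullLeft₂]

theorem koszulL_sec (s t : W.X ⟶ S) (ω ω' : W.X ⟶ (omega A).X) :
    ((s ⊠ ω) ⊠ (t ⊠ ω')) ≫ koszulL f =
      (((((s ⊠ ω ≫ omegaSec A) ⊠ (t ⊠ ω' ≫ omegaSec A)) ≫ pullRight₁ S A.X A.X _) ≫
        koszulAux f ▷ A.X)) ≫ intRight S (omega A).actRight A.X := by
  simp only [koszulL, ← Category.assoc, pair_tensorHom, pair_whiskerLeft]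

include hf

theorem koszulAux_one_left (s t : W.X ⟶ S) (c e : W.X ⟶ A.X) :
    ((s ⊠ oneEl A W) ⊠ t ⊠ c ⊠ e) ≫ koszulAux f = 0 := by
  rw [pair_koszulAux, hf.one_left, hf.one_left]
  simp

theorem koszulAux_one_right (x : W.X ⟶ S ⊗ A.X) (t : W.X ⟶ S) (e : W.X ⟶ A.X) :
    (x ⊠ t ⊠ oneEl A W ⊠ e) ≫ koszulAux f = 0 := by
  rw [pair_koszulAux, hf.one_right, oneEl_univD]
  simp

theorem koszulL_gen (s t : W.X ⟶ S) (y e' c e : W.X ⟶ A.X) :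
    ((s ⊠ (y ⊠ e') ≫ omegaGen A) ⊠ (t ⊠ (c ⊠ e) ≫ omegaGen A)) ≫ koszulL f =
      (((s ⊠ y) ⊠ t ⊠ c ⊠ e) ≫ koszulAux f ⊠ e') ≫ intRight S (omega A).actRight A.X := by
  rw [koszulL_sec, omegaGen_sec, omegaGen_sec]
  simp only [pair_sub, sub_pair, Preadditive.sub_comp, pair_pullRight₁, pair_whiskerRight,
    koszulAux_one_left hf, koszulAux_one_right hf, zero_pair, sub_zero]

theorem koszulAux_mul_right (x : W.X ⟶ S ⊗ A.X) (t : W.X ⟶ S) (c e b : W.X ⟶ A.X) :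
    (x ⊠ t ⊠ c ⊠ (e ⊠ b) ≫ μ[A.X]) ≫ koszulAux f =
      ((x ⊠ t ⊠ c ⊠ e) ≫ koszulAux f ⊠ b) ≫ extRight S (omega A).X μ[A.X] +
        ((c ⊠ e) ≫ omegaGen A ⊠ (x ⊠ t ⊠ b) ≫ f) ≫ extLeft S (omega A).actRight A.X := by
  have hb := isBiaction_ext S (isBiaction_bimod (omega A)) (isBiaction_mul A)
  simp only [pair_koszulAux, hb.mul_right, hf.right_el, pair_add, add_pair, Preadditive.add_comp,
    extLeft_bimod_right, extLeft_extRight, pair_omegaGen]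
  abel

/-- Compatibility with the left action of `b` on `dc e`; note that `omegaSec` sends `b dc e` to
`bc ⊗ e - b ⊗ ce`. -/
theorem koszulAux_mul_left (x : W.X ⟶ S ⊗ A.X) (t : W.X ⟶ S) (b c e : W.X ⟶ A.X) :
    (x ⊠ t ⊠ (b ⊠ c) ≫ μ[A.X] ⊠ e) ≫ koszulAux f - (x ⊠ t ⊠ b ⊠ (c ⊠ e) ≫ μ[A.X]) ≫ koszulAux f =
      (b ⊠ (x ⊠ t ⊠ c ⊠ e) ≫ koszulAux f) ≫ extLeft S (omega A).actLeft A.X := by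
  have hb := isBiaction_ext S (isBiaction_bimod (omega A)) (isBiaction_mul A)
  simp only [pair_koszulAux, hb.mul_right, hf.right_el, pair_add, add_pair, Preadditive.add_comp,
    extLeft_bimod_right, extLeft_extRight, extLeft_univD, extRight_univD, mul_univD,
    extLeft_bimod_left, ← hb.left_right]
  abel

/-- The first variable is a derivation for the internal structure, up to a term with
`{b, -}' · dy`. -/
theorem koszulAux_first_mul (s t : W.X ⟶ S) (b y c e : W.X ⟶ A.X) :
    ((s ⊠ (b ⊠ y) ≫ μ[A.X]) ⊠ t ⊠ c ⊠ e) ≫ koszulAux f =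
      (b ⊠ ((s ⊠ y) ⊠ t ⊠ c ⊠ e) ≫ koszulAux f) ≫ intLeft S (omega A).X μ[A.X] +
      (((s ⊠ b) ⊠ t ⊠ c ⊠ e) ≫ koszulAux f ⊠ y) ≫ intRight S (omega A).actRight A.X +
      ((((s ⊠ b) ⊠ t ⊠ c) ≫ f ⊠ y ≫ univD A) ≫ intRight' S (omega A).actLeft A.X ⊠ e) ≫
        extRight S (omega A).X μ[A.X] := by
  simp only [pair_koszulAux, hf.left_el, pair_add, add_pair, Preadditive.add_comp,
    intLeft_univD, intRight_univD, extRight_intRight, extLeft_intLeft,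
    extRight_intLeft _ _ _ (MonObj.mul_assoc A.X),
    extLeft_intRight _ _ _ _ (actRight_assoc (omega A))]
  abel

omit hf in
/-- The component in `ΣA ⊗ Ω` of the Koszul double bracket. -/
noncomputable def koszulR (f : (S ⊗ A.X) ⊗ (S ⊗ A.X) ⟶ (S ⊗ A.X) ⊗ A.X) :
    (S ⊗ (omega A).X) ⊗ (S ⊗ (omega A).X) ⟶ (S ⊗ A.X) ⊗ (omega A).X :=
  -((β_ _ _).hom ≫ koszulL f ≫ sigmaTau S (omega A).X A.X)

omit hf in
/-- The Koszul double bracket. -/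
noncomputable def koszulBracket (f : (S ⊗ A.X) ⊗ (S ⊗ A.X) ⟶ (S ⊗ A.X) ⊗ A.X) :
    (S ⊗ (omega A).X) ⊗ (S ⊗ (omega A).X) ⟶
      S ⊗ (((omega A).X ⊗ A.X) ⊞ (A.X ⊗ (omega A).X)) :=
  koszulL f ≫ (α_ _ _ _).hom ≫ S ◁ biprod.inl + koszulR f ≫ (α_ _ _ _).hom ≫ S ◁ biprod.inr

omit hf in
theorem pair_koszulR (x y : W.X ⟶ S ⊗ (omega A).X) :
    (x ⊠ y) ≫ koszulR f = -(((y ⊠ x) ≫ koszulL f) ≫ sigmaTau S (omega A).X A.X) := by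
  simp only [koszulR, Preadditive.comp_neg, ← Category.assoc, pair_braiding_hom]

omit hf in
@[simp]
theorem compL_koszulBracket : compL (koszulBracket f) = koszulL f := by
  simp [compL, koszulBracket, Preadditive.add_comp, ← whiskerLeft_comp_assoc]

omit hf in
@[simp]
theorem compR_koszulBracket : compR (koszulBracket f) = koszulR f := by
  simp [compR, koszulBracket, Preadditive.add_comp, ← whiskerLeft_comp_assoc]

theorem isAnchorDerivation_koszul :
    IsAnchorDerivation S (koszulAnchor f) (koszulBracket f) where
  left_compL := by
    rw [compL_koszulBracket, ← cancel_epi (S ◁ omegaGen A ⊗ₘ S ◁ A.X ◁ omegaGen A)]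
    refine pure_ext fun W => ?_
    intro s y e' t b c e
    simp only [← Category.assoc, pair_tensorHom, pair_whiskerLeft, pair_pullLeft₂, koszulL_gen hf]
    rw [koszulL_sec, actLeft_omegaGen_sec, omegaGen_sec]
    simp only [pair_sub, sub_pair, Preadditive.sub_comp, pair_pullRight₁, pair_whiskerRight,
      koszulAux_one_left hf, zero_pair, sub_zero]
    rw [extLeft_intRight _ _ _ _ (omega A).middle_assoc, ← koszulAux_mul_left hf, sub_pair,
      Preadditive.sub_comp]
  left_compR := by
    have hb := isBiaction_int S (isBiaction_bimod (omega A)) (isBiaction_mul A)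
    rw [compR_koszulBracket, ← cancel_epi (S ◁ omegaGen A ⊗ₘ S ◁ A.X ◁ omegaGen A)]
    refine pure_ext fun W => ?_
    intro s y e' t b c e
    simp only [← Category.assoc, pair_tensorHom, pair_whiskerLeft, pair_whiskerRight,
      Preadditive.comp_add, pair_pullLeft₂, pair_pullRight₂, pair_koszulR, koszulL_gen hf,
      koszulAnchor_gen hf]
    rw [koszulL_sec, actLeft_omegaGen_sec, omegaGen_sec]
    simp only [pair_sub, sub_pair, Preadditive.sub_comp, pair_pullRight₁, pair_whiskerRight,
      koszulAux_one_right hf, zero_pair, sub_zero, koszulAux_first_mul hf, add_pair,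
      Preadditive.add_comp, hb.mul_right, hb.left_right]
    rw [intRight'_sigmaTau, intLeft_sigmaTau, hf.antisymm_el (s ⊠ y), ← pair_omegaGen]
    simp only [neg_pair, pair_neg, Preadditive.neg_comp]
    abel
  right_compL := by
    rw [compL_koszulBracket, ← cancel_epi (S ◁ omegaGen A ⊗ₘ S ◁ omegaGen A ▷ A.X)]
    refine pure_ext fun W => ?_
    intro s y e' t c e b
    simp only [← Category.assoc, pair_tensorHom, pair_whiskerLeft, pair_whiskerRight,
      Preadditive.comp_add, pair_pullLeft₂, pair_pullRight₂, koszulL_gen hf, actRight_omegaGen,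
      koszulAux_mul_right hf, add_pair, Preadditive.add_comp, koszulAnchor_gen hf]
    rw [extRight_intRight, extLeft_intRight _ _ _ _ (actRight_assoc (omega A))]
  right_compR := by
    rw [compR_koszulBracket, ← cancel_epi (S ◁ omegaGen A ⊗ₘ S ◁ omegaGen A ▷ A.X)]
    refine pure_ext fun W => ?_
    intro s y e' t c e b
    simp only [← Category.assoc, pair_tensorHom, pair_whiskerLeft, pair_whiskerRight,
      pair_pullRight₂, pair_koszulR, koszulL_gen hf, actRight_omegaGen,
      (isBiaction_int S (isBiaction_bimod (omega A)) (isBiaction_mul A)).mul_right,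
      intRight_sigmaTau, neg_pair, Preadditive.neg_comp]

omit hf in
theorem isAntisymm_koszulBracket : IsAntisymm S (koszulBracket f) := by
  rw [isAntisymm_iff]
  intro W x y
  rw [compL_koszulBracket, compR_koszulBracket, pair_koszulR]

theorem isKoszulBracket_koszulBracket :
    IsKoszulBracket f (koszulAnchor f) (koszulBracket f) where
  univD_comp := by
    have hb := isBiaction_int S (isBiaction_bimod (omega A)) (isBiaction_mul A)
    have h : ∀ {W : CommComon C} (s t : W.X ⟶ S) (y c : W.X ⟶ A.X),
        ((s ⊠ y ≫ univD A) ⊠ (t ⊠ c ≫ univD A)) ≫ koszulL f =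
          ((s ⊠ y) ⊠ (t ⊠ c)) ≫ f ≫ (S ◁ univD A) ▷ A.X := by
      intro W s t y c
      have h1 := koszulL_gen hf s t y (oneEl A W) c (oneEl A W)
      rw [pair_omegaGen, pair_omegaGen, (isBiaction_bimod _).one_right,
        (isBiaction_bimod _).one_right, hb.one_right, pair_koszulAux, hf.one_right,
        (isBiaction_ext S (isBiaction_bimod (omega A)) (isBiaction_mul A)).one_right] at h1
      simpa only [pair_zero, Limits.zero_comp, add_zero, Category.assoc] using h1
    refine hom_ext_components ?_ ?_
    · refine pure_ext fun W => ?_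
      intro s y t c
      rw [comp_compL, compL_koszulBracket]
      simp only [← Category.assoc, pair_tensorHom, pair_whiskerLeft, h]
      simp [compL, ← whiskerLeft_comp_assoc]
    · refine pure_ext fun W => ?_
      intro s y t c
      have h3 : compR (f ≫ (α_ S A.X A.X).hom ≫ S ◁ biprod.lift (univD A ▷ A.X) (A.X ◁ univD A)) =
          f ≫ (S ⊗ A.X) ◁ univD A := by
        simp [compR, ← whiskerLeft_comp_assoc]
      rw [comp_compR, compR_koszulBracket, h3]
      simp only [← Category.assoc, pair_tensorHom, pair_whiskerLeft, pair_koszulR, h]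
      rw [hf.antisymm_el (s ⊠ y)]
      have h2 := sigmaTau_map (((t ⊠ c) ⊠ s ⊠ y) ≫ f) (univD A) (𝟙 A.X)
      simp only [whiskerLeft_id, tensorHom_id, id_tensorHom] at h2
      simp only [Preadditive.neg_comp, ← h2]
  antisymm := isAntisymm_koszulBracket
  derivation := isAnchorDerivation_koszul hf

omit hf in
/-- An antisymmetric derivation is determined by its values on exact forms. -/
theorem IsKoszulBracket.unique {ρ : (S ⊗ (omega A).X) ⊗ (S ⊗ A.X) ⟶ (S ⊗ A.X) ⊗ A.X}
    {B B' : (S ⊗ (omega A).X) ⊗ (S ⊗ (omega A).X) ⟶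
      S ⊗ (((omega A).X ⊗ A.X) ⊞ (A.X ⊗ (omega A).X))}
    (h : IsKoszulBracket f ρ B) (h' : IsKoszulBracket f ρ B') : B = B' := by
  have gen : ∀ {W : CommComon C} (x : W.X ⟶ S ⊗ (omega A).X) (s : W.X ⟶ S) (c e : W.X ⟶ A.X),
      (x ⊠ s ⊠ c ≫ univD A) ≫ compL B = (x ⊠ s ⊠ c ≫ univD A) ≫ compL B' →
      (x ⊠ s ⊠ c ≫ univD A) ≫ compR B = (x ⊠ s ⊠ c ≫ univD A) ≫ compR B' →
      (x ⊠ s ⊠ (c ⊠ e) ≫ omegaGen A) ≫ compL B = (x ⊠ s ⊠ (c ⊠ e) ≫ omegaGen A) ≫ compL B' ∧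
      (x ⊠ s ⊠ (c ⊠ e) ≫ omegaGen A) ≫ compR B =
        (x ⊠ s ⊠ (c ⊠ e) ≫ omegaGen A) ≫ compR B' := by
    intro W x s c e hL hR
    rw [pair_omegaGen, h.derivation.right_compL_el, h'.derivation.right_compL_el,
      h.derivation.right_compR_el, h'.derivation.right_compR_el, hL, hR]
    exact ⟨rfl, rfl⟩
  have hd := h.univD_comp.trans h'.univD_comp.symm
  have hswap : ∀ {W : CommComon C} (x y : W.X ⟶ S ⊗ (omega A).X),
      (x ⊠ y) ≫ compL B = (x ⊠ y) ≫ compL B' → (x ⊠ y) ≫ compR B = (x ⊠ y) ≫ compR B' →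
      (y ⊠ x) ≫ compL B = (y ⊠ x) ≫ compL B' ∧ (y ⊠ x) ≫ compR B = (y ⊠ x) ≫ compR B' := by
    intro W x y h1 h2
    refine ⟨?_, by rw [h.antisymm.el, h'.antisymm.el, h1]⟩
    have h3 := h.antisymm.el x y
    have h4 := h'.antisymm.el x y
    rw [h2, h4, neg_inj] at h3
    have := congrArg (· ≫ sigmaTau S A.X (omega A).X) h3
    simpa only [sigmaTau_sigmaTau] using this.symm
  have key : ∀ {W : CommComon C} (s t : W.X ⟶ S) (y e' c e : W.X ⟶ A.X),
      ((s ⊠ (y ⊠ e') ≫ omegaGen A) ⊠ t ⊠ (c ⊠ e) ≫ omegaGen A) ≫ compL B =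
        ((s ⊠ (y ⊠ e') ≫ omegaGen A) ⊠ t ⊠ (c ⊠ e) ≫ omegaGen A) ≫ compL B' ∧
      ((s ⊠ (y ⊠ e') ≫ omegaGen A) ⊠ t ⊠ (c ⊠ e) ≫ omegaGen A) ≫ compR B =
        ((s ⊠ (y ⊠ e') ≫ omegaGen A) ⊠ t ⊠ (c ⊠ e) ≫ omegaGen A) ≫ compR B' := by
    intro W s t y e' c e
    have h1 := congrArg (((t ⊠ c) ⊠ s ⊠ y) ≫ compL ·) hd
    have h2 := congrArg (((t ⊠ c) ⊠ s ⊠ y) ≫ compR ·) hd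
    simp only [comp_compL, comp_compR, ← Category.assoc, pair_tensorHom, pair_whiskerLeft]
      at h1 h2
    -- extend the equality to all forms in one variable, exchange the variables, and repeat
    obtain ⟨h3, h4⟩ := gen _ _ _ e' h1 h2
    obtain ⟨h5, h6⟩ := hswap _ _ h3 h4
    exact gen _ _ _ _ h5 h6
  refine hom_ext_components ?_ ?_ <;>
    rw [← cancel_epi (S ◁ omegaGen A ⊗ₘ S ◁ omegaGen A)] <;> refine pure_ext fun W => ?_ <;>
    intro s y e' t c e <;>
    simp only [← Category.assoc, pair_tensorHom, pair_whiskerLeft, key]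

end Koszul

end DoubleAlgebra

/-! ### The bracket on `A ⊞ M` -/

namespace DoubleAlgebra

section SquareZero

variable {C : Type u} [Category.{v} C] [MonoidalCategory C] [SymmetricCategory C]
  [Preadditive C] [MonoidalPreadditive C] [HasBinaryBiproducts C]
variable {W : CommComon C} {A : Mon C} {M : Bimod A A} {S : C}

section Naturality

variable {P Q P' Q' R R' X X' : C} (t : W.X ⟶ (S ⊗ P) ⊗ Q)

theorem extLeft_tensorHom {l : R ⊗ P ⟶ X} {l' : R' ⊗ P' ⟶ X'} {j : R ⟶ R'} {g : P ⟶ P'}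
    {g' : X ⟶ X'} (h : Q ⟶ Q') (hl : (j ⊗ₘ g) ≫ l' = l ≫ g') (a : W.X ⟶ R) :
    (a ≫ j ⊠ t ≫ (S ◁ g ⊗ₘ h)) ≫ extLeft S l' Q' = ((a ⊠ t) ≫ extLeft S l Q) ≫ (S ◁ g' ⊗ₘ h) := by
  have key : (j ⊗ₘ (S ◁ g ⊗ₘ h)) ≫ extLeft S l' Q' = extLeft S l Q ≫ (S ◁ g' ⊗ₘ h) := by
    refine pure_ext fun W => ?_
    intro a s p q
    have := congrArg ((a ⊠ p) ≫ ·) hl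
    simp only [← Category.assoc, pair_tensorHom] at this
    simp only [← Category.assoc, pair_whiskerLeft, pair_tensorHom, pair_extLeft, this]
  simpa only [← Category.assoc, pair_tensorHom] using congrArg ((a ⊠ t) ≫ ·) key

theorem extRight_tensorHom {r : Q ⊗ R ⟶ X} {r' : Q' ⊗ R' ⟶ X'} {j : R ⟶ R'} {h : Q ⟶ Q'}
    {h' : X ⟶ X'} (g : P ⟶ P') (hr : (h ⊗ₘ j) ≫ r' = r ≫ h') (a : W.X ⟶ R) :
    (t ≫ (S ◁ g ⊗ₘ h) ⊠ a ≫ j) ≫ extRight S P' r' =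
      ((t ⊠ a) ≫ extRight S P r) ≫ (S ◁ g ⊗ₘ h') := by
  have key : ((S ◁ g ⊗ₘ h) ⊗ₘ j) ≫ extRight S P' r' = extRight S P r ≫ (S ◁ g ⊗ₘ h') := by
    refine pure_ext fun W => ?_
    intro s p q a
    have := congrArg ((q ⊠ a) ≫ ·) hr
    simp only [← Category.assoc, pair_tensorHom] at this
    simp only [← Category.assoc, pair_whiskerLeft, pair_tensorHom, pair_extRight, this]
  simpa only [← Category.assoc, pair_tensorHom] using congrArg ((t ⊠ a) ≫ ·) key

theorem extLeft_map {l : R ⊗ P ⟶ X} {l' : R ⊗ P' ⟶ X'} {g : P ⟶ P'} {g' : X ⟶ X'} (h : Q ⟶ Q')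
    (hl : R ◁ g ≫ l' = l ≫ g') (a : W.X ⟶ R) :
    (a ⊠ t ≫ (S ◁ g ⊗ₘ h)) ≫ extLeft S l' Q' = ((a ⊠ t) ≫ extLeft S l Q) ≫ (S ◁ g' ⊗ₘ h) := by
  have hj : (𝟙 R ⊗ₘ g) ≫ l' = l ≫ g' := by rw [id_tensorHom, hl]
  simpa only [Category.comp_id] using extLeft_tensorHom t h hj a

theorem extRight_map {r : Q ⊗ R ⟶ X} {r' : Q' ⊗ R ⟶ X'} {h : Q ⟶ Q'} {h' : X ⟶ X'} (g : P ⟶ P')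
    (hr : h ▷ R ≫ r' = r ≫ h') (a : W.X ⟶ R) :
    (t ≫ (S ◁ g ⊗ₘ h) ⊠ a) ≫ extRight S P' r' =
      ((t ⊠ a) ≫ extRight S P r) ≫ (S ◁ g ⊗ₘ h') := by
  have hj : (h ⊗ₘ 𝟙 R) ≫ r' = r ≫ h' := by rw [tensorHom_id, hr]
  simpa only [Category.comp_id] using extRight_tensorHom t g hj a

end Naturality

/-- The left action of `A` on `A ⊞ M`. -/
noncomputable def sqzLeft (M : Bimod A A) : A.X ⊗ (A.X ⊞ M.X) ⟶ A.X ⊞ M.X :=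
  A.X ◁ biprod.fst ≫ μ[A.X] ≫ biprod.inl + A.X ◁ biprod.snd ≫ M.actLeft ≫ biprod.inr

/-- The right action of `A` on `A ⊞ M`. -/
noncomputable def sqzRight (M : Bimod A A) : (A.X ⊞ M.X) ⊗ A.X ⟶ A.X ⊞ M.X :=
  biprod.fst ▷ A.X ≫ μ[A.X] ≫ biprod.inl + biprod.snd ▷ A.X ≫ M.actRight ≫ biprod.inr

theorem pair_sqzLeft (a : W.X ⟶ A.X) (e : W.X ⟶ A.X ⊞ M.X) :
    (a ⊠ e) ≫ sqzLeft M = ((a ⊠ e ≫ biprod.fst) ≫ μ[A.X]) ≫ biprod.inl +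
      ((a ⊠ e ≫ biprod.snd) ≫ M.actLeft) ≫ biprod.inr := by
  simp only [sqzLeft, Preadditive.comp_add, ← Category.assoc, pair_whiskerLeft]

theorem pair_sqzRight (e : W.X ⟶ A.X ⊞ M.X) (a : W.X ⟶ A.X) :
    (e ⊠ a) ≫ sqzRight M = ((e ≫ biprod.fst ⊠ a) ≫ μ[A.X]) ≫ biprod.inl +
      ((e ≫ biprod.snd ⊠ a) ≫ M.actRight) ≫ biprod.inr := by
  simp only [sqzRight, Preadditive.comp_add, ← Category.assoc, pair_whiskerRight]

theorem inl_sqzLeft : A.X ◁ biprod.inl ≫ sqzLeft M = μ[A.X] ≫ biprod.inl := by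
  simp [sqzLeft, Preadditive.comp_add, ← whiskerLeft_comp_assoc]

theorem inr_sqzLeft : A.X ◁ biprod.inr ≫ sqzLeft M = M.actLeft ≫ biprod.inr := by
  simp [sqzLeft, Preadditive.comp_add, ← whiskerLeft_comp_assoc]

theorem inl_sqzRight : biprod.inl ▷ A.X ≫ sqzRight M = μ[A.X] ≫ biprod.inl := by
  simp [sqzRight, Preadditive.comp_add, ← comp_whiskerRight_assoc]

theorem inr_sqzRight : biprod.inr ▷ A.X ≫ sqzRight M = M.actRight ≫ biprod.inr := by
  simp [sqzRight, Preadditive.comp_add, ← comp_whiskerRight_assoc]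

/-- The bracket on `A ⊞ M` which vanishes on `A` and is given by `ρ` and `B`. -/
noncomputable def sqzBracket (ρ : (S ⊗ M.X) ⊗ (S ⊗ A.X) ⟶ (S ⊗ A.X) ⊗ A.X)
    (B : (S ⊗ M.X) ⊗ (S ⊗ M.X) ⟶ S ⊗ ((M.X ⊗ A.X) ⊞ (A.X ⊗ M.X))) :
    (S ⊗ (A.X ⊞ M.X)) ⊗ (S ⊗ (A.X ⊞ M.X)) ⟶ (S ⊗ (A.X ⊞ M.X)) ⊗ (A.X ⊞ M.X) :=
  (S ◁ biprod.snd ⊗ₘ S ◁ biprod.snd) ≫ compL B ≫ (S ◁ biprod.inr ⊗ₘ biprod.inl) +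
    (S ◁ biprod.snd ⊗ₘ S ◁ biprod.snd) ≫ compR B ≫ (S ◁ biprod.inl ⊗ₘ biprod.inr) +
    (S ◁ biprod.snd ⊗ₘ S ◁ biprod.fst) ≫ ρ ≫ (S ◁ biprod.inl ⊗ₘ biprod.inl) +
    (S ◁ biprod.fst ⊗ₘ S ◁ biprod.snd) ≫ anchorTau S ρ ≫ (S ◁ biprod.inl ⊗ₘ biprod.inl)

/-- The restriction to `A` of the bracket on `A ⊞ M` in its second variable. -/
noncomputable def sqzBase (ρ : (S ⊗ M.X) ⊗ (S ⊗ A.X) ⟶ (S ⊗ A.X) ⊗ A.X) :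
    (S ⊗ (A.X ⊞ M.X)) ⊗ (S ⊗ A.X) ⟶ (S ⊗ A.X) ⊗ A.X := (S ◁ biprod.snd) ▷ _ ≫ ρ

variable {ρ : (S ⊗ M.X) ⊗ (S ⊗ A.X) ⟶ (S ⊗ A.X) ⊗ A.X}
  {B : (S ⊗ M.X) ⊗ (S ⊗ M.X) ⟶ S ⊗ ((M.X ⊗ A.X) ⊞ (A.X ⊗ M.X))}

theorem pair_anchorTau (x : W.X ⟶ S ⊗ A.X) (y : W.X ⟶ S ⊗ M.X) :
    (x ⊠ y) ≫ anchorTau S ρ = -(((y ⊠ x) ≫ ρ) ≫ sigmaTau S A.X A.X) := by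
  simp only [anchorTau, Preadditive.comp_neg, ← Category.assoc, pair_braiding_hom]

theorem pair_sqzBracket (x y : W.X ⟶ S ⊗ (A.X ⊞ M.X)) :
    (x ⊠ y) ≫ sqzBracket ρ B =
      ((x ≫ S ◁ biprod.snd ⊠ y ≫ S ◁ biprod.snd) ≫ compL B) ≫ (S ◁ biprod.inr ⊗ₘ biprod.inl) +
      ((x ≫ S ◁ biprod.snd ⊠ y ≫ S ◁ biprod.snd) ≫ compR B) ≫ (S ◁ biprod.inl ⊗ₘ biprod.inr) +
      ((x ≫ S ◁ biprod.snd ⊠ y ≫ S ◁ biprod.fst) ≫ ρ) ≫ (S ◁ biprod.inl ⊗ₘ biprod.inl) +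
      ((x ≫ S ◁ biprod.fst ⊠ y ≫ S ◁ biprod.snd) ≫ anchorTau S ρ) ≫
        (S ◁ biprod.inl ⊗ₘ biprod.inl) := by
  simp only [sqzBracket, Preadditive.comp_add, ← Category.assoc, pair_tensorHom]

theorem pair_sqzBase (x : W.X ⟶ S ⊗ (A.X ⊞ M.X)) (y : W.X ⟶ S ⊗ A.X) :
    (x ⊠ y) ≫ sqzBase ρ = (x ≫ S ◁ biprod.snd ⊠ y) ≫ ρ := by
  simp only [sqzBase, ← Category.assoc, pair_whiskerRight]

theorem sqzBracket_inl (x : W.X ⟶ S ⊗ (A.X ⊞ M.X)) (y : W.X ⟶ S ⊗ A.X) :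
    (x ⊠ y ≫ S ◁ biprod.inl) ≫ sqzBracket ρ B =
      ((x ⊠ y) ≫ sqzBase ρ) ≫ (S ◁ biprod.inl ⊗ₘ biprod.inl) := by
  rw [pair_sqzBracket, pair_sqzBase]
  simp only [Category.assoc, ← whiskerLeft_comp, biprod.inl_snd, biprod.inl_fst,
    MonoidalPreadditive.whiskerLeft_zero, whiskerLeft_id, Category.comp_id, comp_zero, pair_zero,
    Limits.zero_comp, zero_add, add_zero]

theorem sqzBracket_antisymm (hs : IsAntisymm S B) (x y : W.X ⟶ S ⊗ (A.X ⊞ M.X)) :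
    (x ⊠ y) ≫ sqzBracket ρ B = -(((y ⊠ x) ≫ sqzBracket ρ B) ≫ sigmaTau S _ _) := by
  simp only [pair_sqzBracket, Preadditive.add_comp, ← sigmaTau_map, hs.el, pair_anchorTau,
    Preadditive.neg_comp, sigmaTau_sigmaTau]
  abel

theorem extRight_sqzLeft (t : W.X ⟶ (S ⊗ A.X) ⊗ A.X) (e : W.X ⟶ A.X ⊞ M.X) :
    (t ≫ (S ◁ biprod.inl) ▷ _ ⊠ e) ≫ extRight S (A.X ⊞ M.X) (sqzLeft M) =
      ((t ⊠ e ≫ biprod.fst) ≫ extRight S _ μ[A.X]) ≫ (S ◁ biprod.inl ⊗ₘ biprod.inl) +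
        ((t ⊠ e ≫ biprod.snd) ≫ extRight S _ M.actLeft) ≫ (S ◁ biprod.inl ⊗ₘ biprod.inr) := by
  have key : ((S ◁ biprod.inl) ▷ A.X) ▷ (A.X ⊞ M.X) ≫ extRight S (A.X ⊞ M.X) (sqzLeft M) =
      _ ◁ biprod.fst ≫ extRight S _ μ[A.X] ≫ (S ◁ biprod.inl ⊗ₘ biprod.inl) +
        _ ◁ biprod.snd ≫ extRight S _ M.actLeft ≫ (S ◁ biprod.inl ⊗ₘ biprod.inr) := by
    refine pure_ext fun W => ?_
    intro s a b e
    simp only [← Category.assoc, Preadditive.comp_add, pair_whiskerRight, pair_whiskerLeft,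
      pair_tensorHom, pair_extRight, pair_sqzLeft, pair_add]
  simpa only [← Category.assoc, Preadditive.comp_add, pair_whiskerRight, pair_whiskerLeft] using
    congrArg ((t ⊠ e) ≫ ·) key

theorem extLeft_sqzRight (t : W.X ⟶ (S ⊗ A.X) ⊗ A.X) (e : W.X ⟶ A.X ⊞ M.X) :
    (e ⊠ t ≫ _ ◁ biprod.inl) ≫ extLeft S (sqzRight M) (A.X ⊞ M.X) =
      ((e ≫ biprod.fst ⊠ t) ≫ extLeft S μ[A.X] _) ≫ (S ◁ biprod.inl ⊗ₘ biprod.inl) +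
        ((e ≫ biprod.snd ⊠ t) ≫ extLeft S M.actRight _) ≫ (S ◁ biprod.inr ⊗ₘ biprod.inl) := by
  have key : (A.X ⊞ M.X) ◁ (S ⊗ A.X) ◁ (biprod.inl : A.X ⟶ A.X ⊞ M.X) ≫
        extLeft S (sqzRight M) _ =
      biprod.fst ▷ _ ≫ extLeft S μ[A.X] _ ≫ (S ◁ biprod.inl ⊗ₘ biprod.inl) +
        biprod.snd ▷ _ ≫ extLeft S M.actRight _ ≫ (S ◁ biprod.inr ⊗ₘ biprod.inl) := by
    refine pure_ext fun W => ?_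
    intro e s a b
    simp only [← Category.assoc, Preadditive.comp_add, pair_whiskerRight, pair_whiskerLeft,
      pair_tensorHom, pair_extLeft, pair_sqzRight, pair_add, add_pair]
  simpa only [← Category.assoc, Preadditive.comp_add, pair_whiskerRight, pair_whiskerLeft] using
    congrArg ((e ⊠ t) ≫ ·) key

section Elements

theorem IsAnchor.derivation_el (ha : IsAnchor S ρ) (x : W.X ⟶ S ⊗ M.X) (s : W.X ⟶ S)
    (a b : W.X ⟶ A.X) : (x ⊠ s ⊠ (a ⊠ b) ≫ μ[A.X]) ≫ ρ =
      (a ⊠ (x ⊠ s ⊠ b) ≫ ρ) ≫ extLeft S μ[A.X] A.X +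
        ((x ⊠ s ⊠ a) ≫ ρ ⊠ b) ≫ extRight S A.X μ[A.X] := by
  simpa only [← Category.assoc, pair_whiskerLeft, pair_whiskerRight, pair_pullLeft₂,
    pair_pullRight₂, Preadditive.comp_add] using
    congrArg ((x ⊠ s ⊠ a ⊠ b) ≫ ·) ha.derivation

theorem anchorTau_left (ha : IsAnchorLinear S ρ) (y : W.X ⟶ S ⊗ A.X) (s : W.X ⟶ S)
    (a : W.X ⟶ A.X) (m : W.X ⟶ M.X) : (y ⊠ s ⊠ (a ⊠ m) ≫ M.actLeft) ≫ anchorTau S ρ =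
      (a ⊠ (y ⊠ s ⊠ m) ≫ anchorTau S ρ) ≫ extLeft S μ[A.X] A.X := by
  have := congrArg ((a ⊠ (s ⊠ m) ⊠ y) ≫ ·) ha.left
  simp only [← Category.assoc, pair_whiskerLeft, pair_extLeft] at this
  rw [pair_anchorTau, pair_anchorTau, this, intLeft_sigmaTau, pair_neg, Preadditive.neg_comp]

theorem anchorTau_right (ha : IsAnchorLinear S ρ) (y : W.X ⟶ S ⊗ A.X) (s : W.X ⟶ S)
    (m : W.X ⟶ M.X) (a : W.X ⟶ A.X) : (y ⊠ s ⊠ (m ⊠ a) ≫ M.actRight) ≫ anchorTau S ρ =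
      ((y ⊠ s ⊠ m) ≫ anchorTau S ρ ⊠ a) ≫ extRight S A.X μ[A.X] := by
  have h2 : ((s ⊠ (m ⊠ a) ≫ M.actRight) ⊠ y) ≫ ρ =
      (((s ⊠ m) ⊠ y) ≫ ρ ⊠ a) ≫ intRight S μ[A.X] A.X := by
    have := congrArg ((((s ⊠ m) ⊠ y) ⊠ a) ≫ ·) ha.right
    simpa only [← Category.assoc, pair_whiskerRight, pair_intRight] using this
  rw [pair_anchorTau, pair_anchorTau, h2, intRight_sigmaTau, neg_pair, Preadditive.neg_comp]

end Elements

/-- In the second variable, the bracket on `A ⊞ M` is compatible with the left action of `A`. The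
term `{x, a}` lies in `ΣA ⊗ A`, which is why it is expressed by `sqzBase`. -/
theorem sqzBracket_left (ha : IsAnchor S ρ) (hd : IsAnchorDerivation S ρ B)
    (x : W.X ⟶ S ⊗ (A.X ⊞ M.X)) (s : W.X ⟶ S) (a : W.X ⟶ A.X) (e : W.X ⟶ A.X ⊞ M.X) :
    (x ⊠ s ⊠ (a ⊠ e) ≫ sqzLeft M) ≫ sqzBracket ρ B =
      (a ⊠ (x ⊠ s ⊠ e) ≫ sqzBracket ρ B) ≫ extLeft S (sqzLeft M) _ +
        (((x ⊠ s ⊠ a) ≫ sqzBase ρ) ≫ (S ◁ biprod.inl) ▷ _ ⊠ e) ≫ extRight S _ (sqzLeft M) := by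
  have h1 : ((a ⊠ e) ≫ sqzLeft M) ≫ biprod.fst = (a ⊠ e ≫ biprod.fst) ≫ μ[A.X] := by
    simp [pair_sqzLeft, Preadditive.add_comp]
  have h2 : ((a ⊠ e) ≫ sqzLeft M) ≫ biprod.snd = (a ⊠ e ≫ biprod.snd) ≫ M.actLeft := by
    simp [pair_sqzLeft, Preadditive.add_comp]
  simp only [pair_sqzBracket, pair_whiskerLeft, h1, h2, hd.left_compL_el, hd.left_compR_el,
    ha.derivation_el, anchorTau_left ha.linear, pair_add, Preadditive.add_comp, extRight_sqzLeft,
    pair_sqzBase, extLeft_map _ _ inr_sqzLeft, extLeft_map _ _ inl_sqzLeft]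
  abel

theorem sqzBracket_right (ha : IsAnchor S ρ) (hd : IsAnchorDerivation S ρ B)
    (x : W.X ⟶ S ⊗ (A.X ⊞ M.X)) (s : W.X ⟶ S) (e : W.X ⟶ A.X ⊞ M.X) (a : W.X ⟶ A.X) :
    (x ⊠ s ⊠ (e ⊠ a) ≫ sqzRight M) ≫ sqzBracket ρ B =
      (e ⊠ ((x ⊠ s ⊠ a) ≫ sqzBase ρ) ≫ _ ◁ biprod.inl) ≫ extLeft S (sqzRight M) _ +
        ((x ⊠ s ⊠ e) ≫ sqzBracket ρ B ⊠ a) ≫ extRight S _ (sqzRight M) := by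
  have h1 : ((e ⊠ a) ≫ sqzRight M) ≫ biprod.fst = (e ≫ biprod.fst ⊠ a) ≫ μ[A.X] := by
    simp [pair_sqzRight, Preadditive.add_comp]
  have h2 : ((e ⊠ a) ≫ sqzRight M) ≫ biprod.snd = (e ≫ biprod.snd ⊠ a) ≫ M.actRight := by
    simp [pair_sqzRight, Preadditive.add_comp]
  simp only [pair_sqzBracket, pair_whiskerLeft, h1, h2, hd.right_compL_el, hd.right_compR_el,
    ha.derivation_el, anchorTau_right ha.linear, add_pair, Preadditive.add_comp, extLeft_sqzRight,
    pair_sqzBase, extRight_map _ _ inr_sqzRight, extRight_map _ _ inl_sqzRight]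
  abel

end SquareZero

end DoubleAlgebra

/-! ### Desuspension and the Jacobiator -/

namespace DoubleAlgebra

section Desuspension

variable {C : Type u} [Category.{v} C] [MonoidalCategory C] [SymmetricCategory C]

/-- Tensoring with an invertible object is an equivalence. -/
theorem isEquivalence_tensorLeft {S S' : C} (e : S' ⊗ S ≅ 𝟙_ C) :
    (tensorLeft S).IsEquivalence :=
  (CategoryTheory.Equivalence.mk (tensorLeft S) (tensorLeft S')
    ((leftUnitorNatIso C).symm ≪≫ (tensoringLeft C).mapIso e.symm ≪≫ tensorLeftTensor S' S)
    ((tensorLeftTensor S S').symm ≪≫ (tensoringLeft C).mapIso ((β_ S S') ≪≫ e) ≪≫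
      leftUnitorNatIso C)).isEquivalence_functor

variable {W : CommComon C} {S X Y Z U V P Q K : C}
  [(tensorLeft S).Full] [(tensorLeft S).Faithful]

/-- The morphism `Y ⊗ P ⟶ U ⊗ V` of which `F : Y ⊗ ΣP ⟶ ΣU ⊗ V` is the suspension. -/
noncomputable def desusp (F : Y ⊗ (S ⊗ P) ⟶ (S ⊗ U) ⊗ V) : Y ⊗ P ⟶ U ⊗ V :=
  (tensorLeft S).preimage (exch S Y P ≫ F ≫ (α_ S U V).hom)

omit [(tensorLeft S).Faithful] in
theorem pair_desusp (F : Y ⊗ (S ⊗ P) ⟶ (S ⊗ U) ⊗ V) (y : W.X ⟶ Y) (s : W.X ⟶ S) (p : W.X ⟶ P) :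
    (y ⊠ s ⊠ p) ≫ F = (s ⊠ (y ⊠ p) ≫ desusp F) ≫ (α_ S U V).inv := by
  have h : S ◁ desusp F = exch S Y P ≫ F ≫ (α_ S U V).hom := (tensorLeft S).map_preimage _
  have := congrArg ((s ⊠ y ⊠ p) ≫ · ≫ (α_ S U V).inv) h
  simp only [Category.assoc, Iso.hom_inv_id, Category.comp_id] at this
  simpa only [← Category.assoc, pair_whiskerLeft, pair_exch] using this.symm

omit [(tensorLeft S).Full] in
theorem whiskerLeft_cancel {g h : X ⟶ Y} (e : S ◁ g = S ◁ h) : g = h :=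
  (tensorLeft S).map_injective e

end Desuspension

section Jacobiator

variable {C : Type u} [Category.{v} C] [MonoidalCategory C] [SymmetricCategory C]
  [Preadditive C]
variable {W : CommComon C} {S X Y Z U V P Q K : C}

/-- The double Jacobiator of `F : ΣX ⊗ ΣX ⟶ ΣX ⊗ X`. -/
noncomputable def jacobiator (F : (S ⊗ X) ⊗ (S ⊗ X) ⟶ (S ⊗ X) ⊗ X) :
    (S ⊗ X) ⊗ ((S ⊗ X) ⊗ (S ⊗ X)) ⟶ ((S ⊗ X) ⊗ X) ⊗ X :=
  nest F F + cycR (S ⊗ X) (S ⊗ X) (S ⊗ X) ≫ nest F F ≫ sigmaRotL S X X X +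
    cycL (S ⊗ X) (S ⊗ X) (S ⊗ X) ≫ nest F F ≫ sigmaRotR S X X X

/-- The morphism with value
`g₁(x, g₁(y, q)') ⊗ g₁(y, q)'' - g₁(x, q)' ⊗ g(y, g₁(x, q)'') -
g₁({x, y}', q)' ⊗ {x, y}'' ⊗ g₁({x, y}', q)''` at `x ⊗ y ⊗ q`, where `{-, -}` stands for `F`. -/
noncomputable def jacDer (F : Y ⊗ Y ⟶ Y ⊗ X) (g : Y ⊗ X ⟶ X ⊗ X) (g₁ : Y ⊗ Q ⟶ Q ⊗ X) :
    Y ⊗ (Y ⊗ Q) ⟶ Q ⊗ (X ⊗ X) :=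
  Y ◁ g₁ ≫ (α_ _ _ _).inv ≫ g₁ ▷ X ≫ (α_ _ _ _).hom -
    exch Y Y Q ≫ Y ◁ g₁ ≫ exch Y Q X ≫ Q ◁ g -
    (α_ _ _ _).inv ≫ F ▷ Q ≫ (α_ _ _ _).hom ≫ exch Y X Q ≫ X ◁ g₁ ≫ exch X Q X

variable (F : Y ⊗ Y ⟶ Y ⊗ X) (g : Y ⊗ X ⟶ X ⊗ X) (g₁ : Y ⊗ Q ⟶ Q ⊗ X)

theorem pair_jacDer (x y : W.X ⟶ Y) (q : W.X ⟶ Q) :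
    (x ⊠ y ⊠ q) ≫ jacDer F g g₁ =
      (((x ⊠ (y ⊠ q) ≫ g₁) ≫ (α_ _ _ _).inv) ≫ g₁ ▷ X) ≫ (α_ _ _ _).hom -
        ((y ⊠ (x ⊠ q) ≫ g₁) ≫ exch Y Q X) ≫ Q ◁ g -
        (((((x ⊠ y) ≫ F ⊠ q) ≫ (α_ _ _ _).hom) ≫ exch Y X Q) ≫ X ◁ g₁) ≫ exch X Q X := by
  simp only [jacDer, Preadditive.comp_sub, ← Category.assoc, pair_whiskerLeft, pair_exch,
    pair_associator_inv, pair_whiskerRight]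

variable {F g g₁} [MonoidalPreadditive C] [HasBinaryBiproducts C]

/-- The left action `P ⊗ (Q ⊗ V) ⟶ X ⊗ V` by a product `P ⊗ Q ⟶ X`. -/
def outLeft (pr : P ⊗ Q ⟶ X) (V : C) : P ⊗ (Q ⊗ V) ⟶ X ⊗ V := (α_ _ _ _).inv ≫ pr ▷ V

/-- The right action `(U ⊗ P) ⊗ Q ⟶ U ⊗ X` by a product `P ⊗ Q ⟶ X`. -/
def outRight (U : C) (pr : P ⊗ Q ⟶ X) : (U ⊗ P) ⊗ Q ⟶ U ⊗ X := (α_ _ _ _).hom ≫ U ◁ pr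

omit [Preadditive C] [MonoidalPreadditive C] [HasBinaryBiproducts C] in
@[simp]
theorem pair_outLeft (pr : P ⊗ Q ⟶ X) (p : W.X ⟶ P) (q : W.X ⟶ Q) (v : W.X ⟶ V) :
    (p ⊠ q ⊠ v) ≫ outLeft pr V = (p ⊠ q) ≫ pr ⊠ v := by
  simp only [outLeft, ← Category.assoc, pair_associator_inv, pair_whiskerRight]

omit [Preadditive C] [MonoidalPreadditive C] [HasBinaryBiproducts C] in
@[simp]
theorem pair_outRight (pr : P ⊗ Q ⟶ X) (u : W.X ⟶ U) (p : W.X ⟶ P) (q : W.X ⟶ Q) :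
    ((u ⊠ p) ⊠ q) ≫ outRight U pr = u ⊠ (p ⊠ q) ≫ pr := by
  simp only [outRight, ← Category.assoc, pair_associator_hom, pair_whiskerLeft]

section Naturality

variable {R : C} (pr : P ⊗ Q ⟶ X)

theorem outLeft_assoc (p : W.X ⟶ P) (c : W.X ⟶ Q ⊗ V) (u : W.X ⟶ U) :
    ((p ⊠ c) ≫ outLeft pr V ⊠ u) ≫ (α_ _ _ _).hom =
      (p ⊠ (c ⊠ u) ≫ (α_ _ _ _).hom) ≫ outLeft pr (V ⊗ U) := by
  have key : outLeft pr V ▷ U ≫ (α_ _ _ _).hom =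
      (α_ _ _ _).hom ≫ P ◁ (α_ _ _ _).hom ≫ outLeft pr (V ⊗ U) := by
    refine pure_ext fun W => ?_
    intro p q v u
    simp only [← Category.assoc, pair_whiskerRight, pair_whiskerLeft, pair_outLeft,
      pair_associator_hom]
  simpa only [← Category.assoc, pair_whiskerRight, pair_whiskerLeft, pair_associator_hom] using
    congrArg (((p ⊠ c) ⊠ u) ≫ ·) key

theorem outRight_assoc (d : W.X ⟶ U ⊗ P) (q : W.X ⟶ Q) (v : W.X ⟶ V) :
    ((d ⊠ q) ≫ outRight U pr ⊠ v) ≫ (α_ _ _ _).hom =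
      ((d ⊠ q ⊠ v) ≫ (α_ _ _ _).hom) ≫ U ◁ outLeft pr V := by
  have key : outRight U pr ▷ V ≫ (α_ _ _ _).hom =
      (α_ _ _ _).hom ≫ (α_ _ _ _).hom ≫ U ◁ outLeft pr V := by
    refine pure_ext fun W => ?_
    intro u p q v
    simp only [← Category.assoc, pair_whiskerRight, pair_whiskerLeft, pair_outLeft, pair_outRight,
      pair_associator_hom]
  simpa only [← Category.assoc, pair_whiskerRight, pair_whiskerLeft, pair_associator_hom] using
    congrArg (((d ⊠ q) ⊠ v) ≫ ·) key

theorem assoc_outRight (c : W.X ⟶ U ⊗ V) (p : W.X ⟶ P) (q : W.X ⟶ Q) :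
    (c ⊠ (p ⊠ q) ≫ pr) ≫ (α_ _ _ _).hom =
      (((c ⊠ p) ≫ (α_ _ _ _).hom ⊠ q) ≫ (α_ _ _ _).hom) ≫ U ◁ outRight V pr := by
  have key : (U ⊗ V) ◁ pr ≫ (α_ _ _ _).hom =
      (α_ _ _ _).inv ≫ (α_ _ _ _).hom ▷ Q ≫ (α_ _ _ _).hom ≫ U ◁ outRight V pr := by
    refine pure_ext fun W => ?_
    intro u v p q
    simp only [← Category.assoc, pair_whiskerRight, pair_whiskerLeft, pair_outRight,
      pair_associator_hom, pair_associator_inv]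
  simpa only [← Category.assoc, pair_whiskerRight, pair_whiskerLeft, pair_associator_inv] using
    congrArg ((c ⊠ p ⊠ q) ≫ ·) key

theorem outLeft_exch (v : W.X ⟶ V) (p : W.X ⟶ P) (b : W.X ⟶ Q ⊗ U) :
    (v ⊠ (p ⊠ b) ≫ outLeft pr U) ≫ exch V X U =
      (p ⊠ (v ⊠ b) ≫ exch V Q U) ≫ outLeft pr (V ⊗ U) := by
  have key : V ◁ outLeft pr U ≫ exch V X U =
      exch _ _ _ ≫ P ◁ exch V Q U ≫ outLeft pr (V ⊗ U) := by
    refine pure_ext fun W => ?_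
    intro v p q u
    simp only [← Category.assoc, pair_whiskerLeft, pair_outLeft, pair_exch]
  simpa only [← Category.assoc, pair_whiskerLeft, pair_exch] using
    congrArg ((v ⊠ p ⊠ b) ≫ ·) key

theorem outRight_exch (v : W.X ⟶ V) (a : W.X ⟶ U ⊗ P) (q : W.X ⟶ Q) :
    (v ⊠ (a ⊠ q) ≫ outRight U pr) ≫ exch V U X =
      (((v ⊠ a) ≫ exch V U P ⊠ q) ≫ (α_ _ _ _).hom) ≫ U ◁ outRight V pr := by
  have key : V ◁ outRight U pr ≫ exch V U X =
      (α_ _ _ _).inv ≫ exch V U P ▷ Q ≫ (α_ _ _ _).hom ≫ U ◁ outRight V pr := by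
    refine pure_ext fun W => ?_
    intro v u p q
    simp only [← Category.assoc, pair_whiskerLeft, pair_whiskerRight, pair_outRight, pair_exch,
      pair_associator_hom, pair_associator_inv]
  simpa only [← Category.assoc, pair_whiskerRight, pair_associator_inv, pair_whiskerLeft] using
    congrArg ((v ⊠ a ⊠ q) ≫ ·) key

end Naturality

/-- If every `g(x, -)` is a derivation, so is `jacDer`: the terms
`g(x, p)' ⊗ g(x, p)'' g₁(y, q)' ⊗ g₁(y, q)''` cancel. -/
theorem jacDer_mul (pr : X ⊗ Q ⟶ X)
    (hpr : ∀ {W : CommComon C} (x : W.X ⟶ Y) (p : W.X ⟶ X) (q : W.X ⟶ Q),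
      (x ⊠ (p ⊠ q) ≫ pr) ≫ g =
        (p ⊠ (x ⊠ q) ≫ g₁) ≫ outLeft pr X + ((x ⊠ p) ≫ g ⊠ q) ≫ outRight X pr)
    (x y : W.X ⟶ Y) (p : W.X ⟶ X) (q : W.X ⟶ Q) :
    (x ⊠ y ⊠ (p ⊠ q) ≫ pr) ≫ jacDer F g g =
      (p ⊠ (x ⊠ y ⊠ q) ≫ jacDer F g g₁) ≫ outLeft pr (X ⊗ X) +
        (((x ⊠ y ⊠ p) ≫ jacDer F g g ⊠ q) ≫ (α_ _ _ _).hom) ≫ X ◁ outRight X pr := by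
  -- `h1`-`h5` apply the derivation rule within the three summands of `jacDer`
  have h1 : ∀ b : W.X ⟶ Q ⊗ X,
      (((x ⊠ (p ⊠ b) ≫ outLeft pr X) ≫ (α_ _ _ _).inv) ≫ g ▷ X) ≫ (α_ _ _ _).hom =
      (p ⊠ (((x ⊠ b) ≫ (α_ _ _ _).inv) ≫ g₁ ▷ X) ≫ (α_ _ _ _).hom) ≫ outLeft pr (X ⊗ X) +
        (((x ⊠ p) ≫ g ⊠ b) ≫ (α_ _ _ _).hom) ≫ X ◁ outLeft pr X := by
    have key : Y ◁ outLeft pr X ≫ (α_ _ _ _).inv ≫ g ▷ X ≫ (α_ _ _ _).hom =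
        exch Y X (Q ⊗ X) ≫ X ◁ (α_ _ _ _).inv ≫ X ◁ g₁ ▷ X ≫ X ◁ (α_ _ _ _).hom ≫
          outLeft pr (X ⊗ X) + (α_ _ _ _).inv ≫ g ▷ (Q ⊗ X) ≫ (α_ _ _ _).hom ≫
            X ◁ outLeft pr X := by
      refine pure_ext fun W => ?_
      intro x p q u
      simp only [← Category.assoc, Preadditive.comp_add, pair_whiskerLeft, pair_whiskerRight,
        pair_outLeft, pair_exch, pair_associator_inv, hpr, add_pair, Preadditive.add_comp,
        outLeft_assoc, outRight_assoc]
    intro b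
    simpa only [← Category.assoc, Preadditive.comp_add, pair_whiskerLeft, pair_whiskerRight,
      pair_exch, pair_associator_inv] using congrArg ((x ⊠ p ⊠ b) ≫ ·) key
  have h2 : ∀ a : W.X ⟶ X ⊗ X,
      (((x ⊠ (a ⊠ q) ≫ outRight X pr) ≫ (α_ _ _ _).inv) ≫ g ▷ X) ≫ (α_ _ _ _).hom =
      (((((x ⊠ a) ≫ (α_ _ _ _).inv) ≫ g ▷ X) ≫ (α_ _ _ _).hom ⊠ q) ≫ (α_ _ _ _).hom) ≫
        X ◁ outRight X pr := by
    have key : Y ◁ outRight X pr ≫ (α_ _ _ _).inv ≫ g ▷ X ≫ (α_ _ _ _).hom =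
        (α_ _ _ _).inv ≫ (α_ _ _ _).inv ▷ Q ≫ g ▷ X ▷ Q ≫ (α_ _ _ _).hom ▷ Q ≫ (α_ _ _ _).hom ≫
          X ◁ outRight X pr := by
      refine pure_ext fun W => ?_
      intro x u v q
      simp only [← Category.assoc, pair_whiskerLeft, pair_whiskerRight,
        pair_outRight, pair_associator_inv, assoc_outRight]
    intro a
    simpa only [← Category.assoc, pair_whiskerLeft, pair_whiskerRight, pair_associator_inv] using
      congrArg ((x ⊠ a ⊠ q) ≫ ·) key
  have h3 : ∀ b : W.X ⟶ Q ⊗ X,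
      ((y ⊠ (p ⊠ b) ≫ outLeft pr X) ≫ exch Y X X) ≫ X ◁ g =
        (p ⊠ ((y ⊠ b) ≫ exch Y Q X) ≫ Q ◁ g) ≫ outLeft pr (X ⊗ X) := by
    have key : Y ◁ outLeft pr X ≫ exch Y X X ≫ X ◁ g =
        exch Y X (Q ⊗ X) ≫ X ◁ exch Y Q X ≫ X ◁ Q ◁ g ≫ outLeft pr (X ⊗ X) := by
      refine pure_ext fun W => ?_
      intro x p q u
      simp only [← Category.assoc, pair_whiskerLeft, pair_outLeft, pair_exch]
    intro b
    simpa only [← Category.assoc, pair_whiskerLeft, pair_exch] using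
      congrArg ((y ⊠ p ⊠ b) ≫ ·) key
  have h4 : ∀ a : W.X ⟶ X ⊗ X,
      ((y ⊠ (a ⊠ q) ≫ outRight X pr) ≫ exch Y X X) ≫ X ◁ g =
        ((a ⊠ (y ⊠ q) ≫ g₁) ≫ (α_ _ _ _).hom) ≫ X ◁ outLeft pr X +
        ((((y ⊠ a) ≫ exch Y X X) ≫ X ◁ g ⊠ q) ≫ (α_ _ _ _).hom) ≫ X ◁ outRight X pr := by
    have key : Y ◁ outRight X pr ≫ exch Y X X ≫ X ◁ g =
        exch Y (X ⊗ X) Q ≫ (X ⊗ X) ◁ g₁ ≫ (α_ _ _ _).hom ≫ X ◁ outLeft pr X +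
        (α_ _ _ _).inv ≫ exch Y X X ▷ Q ≫ (X ◁ g) ▷ Q ≫ (α_ _ _ _).hom ≫
          X ◁ outRight X pr := by
      refine pure_ext fun W => ?_
      intro x u v q
      simp only [← Category.assoc, Preadditive.comp_add, pair_whiskerLeft, pair_whiskerRight,
        pair_outRight, pair_exch, pair_associator_inv, pair_associator_hom, hpr, pair_add]
    intro a
    simpa only [← Category.assoc, Preadditive.comp_add, pair_whiskerLeft, pair_whiskerRight,
      pair_exch, pair_associator_inv] using congrArg ((y ⊠ a ⊠ q) ≫ ·) key
  have h5 : ∀ t : W.X ⟶ Y ⊗ X,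
      ((((t ⊠ (p ⊠ q) ≫ pr) ≫ (α_ _ _ _).hom) ≫ exch Y X X) ≫ X ◁ g) ≫ exch X X X =
        (p ⊠ ((((t ⊠ q) ≫ (α_ _ _ _).hom) ≫ exch Y X Q) ≫ X ◁ g₁) ≫ exch X Q X) ≫
          outLeft pr (X ⊗ X) +
        ((((((t ⊠ p) ≫ (α_ _ _ _).hom) ≫ exch Y X X) ≫ X ◁ g) ≫ exch X X X ⊠ q) ≫
          (α_ _ _ _).hom) ≫ X ◁ outRight X pr := by
    have key : (Y ⊗ X) ◁ pr ≫ (α_ _ _ _).hom ≫ exch Y X X ≫ X ◁ g ≫ exch X X X =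
        exch _ _ _ ≫ X ◁ (α_ _ _ _).hom ≫ X ◁ exch Y X Q ≫ X ◁ X ◁ g₁ ≫ X ◁ exch X Q X ≫
          outLeft pr (X ⊗ X) +
        (α_ _ _ _).inv ≫ (α_ _ _ _).hom ▷ Q ≫ exch Y X X ▷ Q ≫ (X ◁ g) ▷ Q ≫ exch X X X ▷ Q ≫
          (α_ _ _ _).hom ≫ X ◁ outRight X pr := by
      refine pure_ext fun W => ?_
      intro u v p q
      simp only [← Category.assoc, Preadditive.comp_add, pair_whiskerLeft, pair_whiskerRight,
        pair_exch, pair_associator_inv, pair_associator_hom, hpr, pair_add, Preadditive.add_comp,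
        outLeft_exch, outRight_exch]
    intro t
    simpa only [← Category.assoc, Preadditive.comp_add, pair_whiskerLeft, pair_whiskerRight,
      pair_exch, pair_associator_inv] using congrArg ((t ⊠ p ⊠ q) ≫ ·) key
  simp only [pair_jacDer, hpr, pair_add, pair_sub, sub_pair, Preadditive.add_comp,
    Preadditive.sub_comp, h1, h2, h3, h4, h5]
  abel

end Jacobiator

end DoubleAlgebra

/-! ### The Jacobi identity one variable at a time -/

namespace DoubleAlgebra

section Jacobiator

variable {C : Type u} [Category.{v} C] [MonoidalCategory C] [SymmetricCategory C]
  [Preadditive C]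
variable {W : CommComon C} {S X Y K U V : C} {F : (S ⊗ X) ⊗ (S ⊗ X) ⟶ (S ⊗ X) ⊗ X}
  {g : (S ⊗ X) ⊗ X ⟶ X ⊗ X}

theorem pair_jacobiator (x y z : W.X ⟶ S ⊗ X) :
    (x ⊠ y ⊠ z) ≫ jacobiator F = (x ⊠ y ⊠ z) ≫ nest F F +
      ((z ⊠ x ⊠ y) ≫ nest F F) ≫ sigmaRotL S X X X +
      ((y ⊠ z ⊠ x) ≫ nest F F) ≫ sigmaRotR S X X X := by
  simp only [jacobiator, Preadditive.comp_add, ← Category.assoc, pair_cycR, pair_cycL]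

variable [MonoidalPreadditive C] [HasBinaryBiproducts C]

theorem sigmaRotL_sigmaRotL (t : W.X ⟶ ((S ⊗ X) ⊗ X) ⊗ X) :
    (t ≫ sigmaRotL S X X X) ≫ sigmaRotL S X X X = t ≫ sigmaRotR S X X X := by
  have key : sigmaRotL S X X X ≫ sigmaRotL S X X X = sigmaRotR S X X X := by
    refine pure_ext fun W => ?_
    intro s a b c
    simp only [← Category.assoc, pair_sigmaRotL, pair_sigmaRotR]
  simpa only [← Category.assoc] using congrArg (t ≫ ·) key

theorem sigmaRotR_sigmaRotL (t : W.X ⟶ ((S ⊗ X) ⊗ X) ⊗ X) :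
    (t ≫ sigmaRotR S X X X) ≫ sigmaRotL S X X X = t := by
  have key : sigmaRotR S X X X ≫ sigmaRotL S X X X = 𝟙 _ := by
    refine pure_ext fun W => ?_
    intro s a b c
    simp only [← Category.assoc, pair_sigmaRotL, pair_sigmaRotR, Category.comp_id]
  simpa only [← Category.assoc, Category.comp_id] using congrArg (t ≫ ·) key

/-- The Jacobiator is invariant under cyclic permutations. -/
theorem jacobiator_rotate (x y z : W.X ⟶ S ⊗ X) :
    ((z ⊠ x ⊠ y) ≫ jacobiator F) ≫ sigmaRotL S X X X = (x ⊠ y ⊠ z) ≫ jacobiator F := by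
  simp only [pair_jacobiator, Preadditive.add_comp, sigmaRotL_sigmaRotL, sigmaRotR_sigmaRotL]
  abel

/-- The associator `Σ(X ⊗ X ⊗ X) ⟶ ΣX ⊗ X ⊗ X`. -/
def suspAssoc (S X : C) : S ⊗ (X ⊗ (X ⊗ X)) ⟶ ((S ⊗ X) ⊗ X) ⊗ X :=
  S ◁ (α_ _ _ _).inv ≫ (α_ _ _ _).inv ≫ (α_ _ _ _).inv ▷ X

omit [Preadditive C] [MonoidalPreadditive C] [HasBinaryBiproducts C] in
theorem pair_suspAssoc (s : W.X ⟶ S) (a b c : W.X ⟶ X) :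
    (s ⊠ a ⊠ b ⊠ c) ≫ suspAssoc S X = ((s ⊠ a) ⊠ b) ⊠ c := by
  simp only [suspAssoc, ← Category.assoc, pair_whiskerLeft, pair_whiskerRight, pair_associator_inv]

/-- For an antisymmetric bracket, the Jacobiator is the suspension of `jacDer`. -/
theorem jacobiator_eq_jacDer
    (hs : ∀ {W : CommComon C} (x y : W.X ⟶ S ⊗ X),
      (x ⊠ y) ≫ F = -(((y ⊠ x) ≫ F) ≫ sigmaTau S X X))
    (hg : ∀ {W : CommComon C} (y : W.X ⟶ S ⊗ X) (s : W.X ⟶ S) (p : W.X ⟶ X),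
      (y ⊠ s ⊠ p) ≫ F = (s ⊠ (y ⊠ p) ≫ g) ≫ (α_ S X X).inv)
    (x y : W.X ⟶ S ⊗ X) (s : W.X ⟶ S) (p : W.X ⟶ X) :
    (x ⊠ y ⊠ s ⊠ p) ≫ jacobiator F = (s ⊠ (x ⊠ y ⊠ p) ≫ jacDer F g g) ≫ suspAssoc S X := by
  -- `h1`-`h3` move the suspension out of the three summands of the Jacobiator
  have h1 : ∀ w : W.X ⟶ X ⊗ X,
      ((x ⊠ (s ⊠ w) ≫ (α_ S X X).inv) ≫ (α_ _ _ _).inv) ≫ F ▷ X =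
        (s ⊠ (((x ⊠ w) ≫ (α_ _ _ _).inv) ≫ g ▷ X) ≫ (α_ _ _ _).hom) ≫ suspAssoc S X := by
    have key : (S ⊗ X) ◁ (α_ S X X).inv ≫ (α_ _ _ _).inv ≫ F ▷ X =
        exch _ _ _ ≫ S ◁ (α_ _ _ _).inv ≫ S ◁ g ▷ X ≫ S ◁ (α_ _ _ _).hom ≫ suspAssoc S X := by
      refine pure_ext fun W => ?_
      intro s' x s a b
      have h : ∀ c : W.X ⟶ X ⊗ X, (s ⊠ c) ≫ (α_ S X X).inv ⊠ b =
          (s ⊠ (c ⊠ b) ≫ (α_ _ _ _).hom) ≫ suspAssoc S X := by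
        have key : (α_ S X X).inv ▷ X = (α_ _ _ _).hom ≫ S ◁ (α_ _ _ _).hom ≫ suspAssoc S X := by
          refine pure_ext fun W => ?_
          intro s a c b
          simp only [← Category.assoc, pair_whiskerLeft, pair_whiskerRight, pair_associator_inv,
            pair_associator_hom, pair_suspAssoc]
        intro c
        simpa only [← Category.assoc, pair_whiskerLeft, pair_whiskerRight, pair_associator_hom]
          using congrArg (((s ⊠ c) ⊠ b) ≫ ·) key
      simp only [← Category.assoc, pair_whiskerLeft, pair_whiskerRight, pair_exch,
        pair_associator_inv, hg, h]
    intro w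
    simpa only [← Category.assoc, pair_whiskerLeft, pair_exch] using
      congrArg ((x ⊠ s ⊠ w) ≫ ·) key
  have h2 : ∀ t : W.X ⟶ (S ⊗ X) ⊗ X,
      ((((s ⊠ p) ⊠ t) ≫ (α_ _ _ _).inv) ≫ F ▷ X) ≫ sigmaRotL S X X X =
        -((s ⊠ ((((t ⊠ p) ≫ (α_ _ _ _).hom) ≫ exch _ X X) ≫ X ◁ g) ≫ exch X X X) ≫
          suspAssoc S X) := by
    have key : (α_ (S ⊗ X) (S ⊗ X) X).inv ≫ F ▷ X ≫ sigmaRotL S X X X =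
        -((α_ _ _ _).hom ≫ S ◁ (β_ _ _).hom ≫ S ◁ (α_ _ _ _).hom ≫ S ◁ exch _ X X ≫
          S ◁ X ◁ g ≫ S ◁ exch X X X ≫ suspAssoc S X) := by
      refine pure_ext fun W => ?_
      intro s p s' a b
      have h : ∀ c : W.X ⟶ X ⊗ X,
          (((s ⊠ c) ≫ (α_ S X X).inv) ≫ sigmaTau S X X ⊠ b) ≫ sigmaRotL S X X X =
          (s ⊠ (b ⊠ c) ≫ exch X X X) ≫ suspAssoc S X := by
        have key : (α_ S X X).inv ▷ X ≫ sigmaTau S X X ▷ X ≫ sigmaRotL S X X X =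
            (α_ _ _ _).hom ≫ S ◁ (β_ _ _).hom ≫ S ◁ exch X X X ≫ suspAssoc S X := by
          refine pure_ext fun W => ?_
          intro s a c b
          simp only [← Category.assoc, pair_whiskerLeft, pair_whiskerRight, pair_associator_inv,
            pair_associator_hom, pair_suspAssoc, pair_sigmaTau, pair_sigmaRotL, pair_braiding_hom,
            pair_exch]
        intro c
        simpa only [← Category.assoc, pair_whiskerLeft, pair_whiskerRight, pair_associator_hom,
          pair_braiding_hom] using congrArg (((s ⊠ c) ⊠ b) ≫ ·) key
      simp only [← Category.assoc, Preadditive.comp_neg, pair_whiskerLeft, pair_whiskerRight,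
        pair_exch, pair_associator_inv, pair_associator_hom, pair_braiding_hom]
      rw [hs]
      simp only [hg, neg_pair, Preadditive.neg_comp, h]
    intro t
    simpa only [← Category.assoc, Preadditive.comp_neg, pair_whiskerLeft, pair_associator_hom,
      pair_braiding_hom] using congrArg (((s ⊠ p) ⊠ t) ≫ ·) key
  have h3 : ∀ w : W.X ⟶ X ⊗ X,
      (((y ⊠ ((s ⊠ w) ≫ (α_ S X X).inv) ≫ sigmaTau S X X) ≫ (α_ _ _ _).inv) ≫ F ▷ X) ≫
          sigmaRotR S X X X =
        (s ⊠ ((y ⊠ w) ≫ exch _ X X) ≫ X ◁ g) ≫ suspAssoc S X := by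
    have key : (S ⊗ X) ◁ (α_ S X X).inv ≫ (S ⊗ X) ◁ sigmaTau S X X ≫ (α_ _ _ _).inv ≫ F ▷ X ≫
          sigmaRotR S X X X =
        exch _ _ _ ≫ S ◁ exch _ X X ≫ S ◁ X ◁ g ≫ suspAssoc S X := by
      refine pure_ext fun W => ?_
      intro s' y s a b
      have h : ∀ c : W.X ⟶ X ⊗ X, ((s ⊠ c) ≫ (α_ S X X).inv ⊠ a) ≫ sigmaRotR S X X X =
          (s ⊠ a ⊠ c) ≫ suspAssoc S X := by
        have key : (α_ S X X).inv ▷ X ≫ sigmaRotR S X X X =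
            (α_ _ _ _).hom ≫ S ◁ (β_ _ _).hom ≫ suspAssoc S X := by
          refine pure_ext fun W => ?_
          intro s a c b
          simp only [← Category.assoc, pair_whiskerLeft, pair_whiskerRight, pair_associator_inv,
            pair_associator_hom, pair_suspAssoc, pair_sigmaRotR, pair_braiding_hom]
        intro c
        simpa only [← Category.assoc, pair_whiskerLeft, pair_whiskerRight, pair_associator_hom,
          pair_braiding_hom] using congrArg (((s ⊠ c) ⊠ a) ≫ ·) key
      simp only [← Category.assoc, pair_whiskerLeft, pair_whiskerRight,
        pair_exch, pair_associator_inv, pair_sigmaTau, hg, h]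
    intro w
    simpa only [← Category.assoc, pair_whiskerLeft, pair_exch] using
      congrArg ((y ⊠ s ⊠ w) ≫ ·) key
  rw [pair_jacobiator, pair_nest, pair_nest, pair_nest, hs (s ⊠ p) x, hg, hg, pair_jacDer]
  simp only [pair_neg, Preadditive.neg_comp, h1, h2, h3, pair_sub, Preadditive.sub_comp]
  abel

/-- The Jacobiator vanishes on `u ⊗ v ⊗ w`. -/
def JacobiOn (F : (S ⊗ X) ⊗ (S ⊗ X) ⟶ (S ⊗ X) ⊗ X) {U V K : C} (u : U ⟶ S ⊗ X) (v : V ⟶ S ⊗ X)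
    (w : K ⟶ S ⊗ X) : Prop := (u ⊗ₘ (v ⊗ₘ w)) ≫ jacobiator F = 0

theorem JacobiOn.el {u : U ⟶ S ⊗ X} {v : V ⟶ S ⊗ X} {w : K ⟶ S ⊗ X} (h : JacobiOn F u v w)
    (x : W.X ⟶ U) (y : W.X ⟶ V) (z : W.X ⟶ K) :
    (x ≫ u ⊠ y ≫ v ⊠ z ≫ w) ≫ jacobiator F = 0 := by
  simpa only [← Category.assoc, pair_tensorHom, comp_zero] using congrArg ((x ⊠ y ⊠ z) ≫ ·) h

theorem JacobiOn.rotate {u : U ⟶ S ⊗ X} {v : V ⟶ S ⊗ X} {w : K ⟶ S ⊗ X} (h : JacobiOn F u v w) :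
    JacobiOn F v w u := by
  refine pure_ext fun W => ?_
  intro y z x
  simp only [← Category.assoc, pair_tensorHom, comp_zero]
  rw [← jacobiator_rotate, h.el, Limits.zero_comp]

variable [(tensorLeft S).Full] [(tensorLeft S).Faithful]

omit [Preadditive C] [MonoidalPreadditive C] [HasBinaryBiproducts C] [(tensorLeft S).Full]
  [(tensorLeft S).Faithful] in
instance : IsIso (suspAssoc S X) := by unfold suspAssoc; infer_instance

theorem JacobiOn.jacDer_eq_zero
    (hs : ∀ {W : CommComon C} (x y : W.X ⟶ S ⊗ X),
      (x ⊠ y) ≫ F = -(((y ⊠ x) ≫ F) ≫ sigmaTau S X X))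
    {u : U ⟶ S ⊗ X} {v : V ⟶ S ⊗ X} {k : K ⟶ X}
    (h : JacobiOn F u v (S ◁ k)) (x : W.X ⟶ U) (y : W.X ⟶ V) (p : W.X ⟶ K) :
    (x ≫ u ⊠ y ≫ v ⊠ p ≫ k) ≫ jacDer F (desusp F) (desusp F) = 0 := by
  have key : (u ⊗ₘ (v ⊗ₘ k)) ≫ jacDer F (desusp F) (desusp F) = 0 := by
    apply whiskerLeft_cancel (S := S)
    rw [← cancel_mono (suspAssoc S X)]
    refine pure_ext fun W => ?_
    intro s x y p
    have h1 := h.el x y (s ⊠ p)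
    rw [pair_whiskerLeft, jacobiator_eq_jacDer hs (pair_desusp F)] at h1
    simpa only [← Category.assoc, pair_whiskerLeft, pair_tensorHom, comp_zero, pair_zero,
      Limits.zero_comp, MonoidalPreadditive.whiskerLeft_zero] using h1
  simpa only [← Category.assoc, pair_tensorHom, comp_zero] using congrArg ((x ⊠ y ⊠ p) ≫ ·) key

omit [(tensorLeft S).Faithful] in
theorem jacobiOn_of_jacDer
    (hs : ∀ {W : CommComon C} (x y : W.X ⟶ S ⊗ X),
      (x ⊠ y) ≫ F = -(((y ⊠ x) ≫ F) ≫ sigmaTau S X X))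
    {u : U ⟶ S ⊗ X} {v : V ⟶ S ⊗ X}
    (h : (u ⊗ₘ (v ⊗ₘ 𝟙 X)) ≫ jacDer F (desusp F) (desusp F) = 0) :
    JacobiOn F u v (𝟙 (S ⊗ X)) := by
  refine pure_ext fun W => ?_
  intro x y s p
  have h1 := congrArg ((x ⊠ y ⊠ p) ≫ ·) h
  simp only [← Category.assoc, pair_tensorHom, comp_zero, Category.comp_id] at h1 ⊢
  rw [jacobiator_eq_jacDer hs (pair_desusp F), h1, pair_zero, Limits.zero_comp]

end Jacobiator

section DesuspMul

variable {C : Type u} [Category.{v} C] [MonoidalCategory C] [SymmetricCategory C]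
  [Preadditive C] [MonoidalPreadditive C] [HasBinaryBiproducts C]
variable {W : CommComon C} {S X Y P Q U V : C}

theorem extLeft_susp (pr : P ⊗ Q ⟶ X) (p : W.X ⟶ P) (s : W.X ⟶ S) (w : W.X ⟶ Q ⊗ V) :
    (p ⊠ (s ⊠ w) ≫ (α_ _ _ _).inv) ≫ extLeft S pr V =
      (s ⊠ (p ⊠ w) ≫ outLeft pr V) ≫ (α_ _ _ _).inv := by
  have key : P ◁ (α_ S Q V).inv ≫ extLeft S pr V =
      exch _ _ _ ≫ S ◁ outLeft pr V ≫ (α_ _ _ _).inv := by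
    refine pure_ext fun W => ?_
    intro p s q v
    simp only [← Category.assoc, pair_whiskerLeft, pair_associator_inv, pair_extLeft, pair_exch,
      pair_outLeft]
  simpa only [← Category.assoc, pair_whiskerLeft, pair_exch] using
    congrArg ((p ⊠ s ⊠ w) ≫ ·) key

theorem extRight_susp (pr : P ⊗ Q ⟶ X) (s : W.X ⟶ S) (w : W.X ⟶ U ⊗ P) (q : W.X ⟶ Q) :
    ((s ⊠ w) ≫ (α_ _ _ _).inv ⊠ q) ≫ extRight S U pr =
      (s ⊠ (w ⊠ q) ≫ outRight U pr) ≫ (α_ _ _ _).inv := by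
  have key : (α_ S U P).inv ▷ Q ≫ extRight S U pr =
      (α_ _ _ _).hom ≫ S ◁ outRight U pr ≫ (α_ _ _ _).inv := by
    refine pure_ext fun W => ?_
    intro s u p q
    simp only [← Category.assoc, pair_whiskerRight, pair_associator_inv, pair_extRight,
      pair_associator_hom, pair_outRight, pair_whiskerLeft]
  simpa only [← Category.assoc, pair_whiskerLeft, pair_whiskerRight, pair_associator_hom] using
    congrArg (((s ⊠ w) ⊠ q) ≫ ·) key

variable [(tensorLeft S).Full] [(tensorLeft S).Faithful]

/-- The desuspension of a derivation in the second variable is a derivation. -/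
theorem desusp_mul {pr : P ⊗ Q ⟶ X} {F : Y ⊗ (S ⊗ X) ⟶ (S ⊗ X) ⊗ X}
    {FP : Y ⊗ (S ⊗ P) ⟶ (S ⊗ X) ⊗ P} {FQ : Y ⊗ (S ⊗ Q) ⟶ (S ⊗ Q) ⊗ X}
    (h : ∀ {W : CommComon C} (y : W.X ⟶ Y) (s : W.X ⟶ S) (p : W.X ⟶ P) (q : W.X ⟶ Q),
      (y ⊠ s ⊠ (p ⊠ q) ≫ pr) ≫ F = (p ⊠ (y ⊠ s ⊠ q) ≫ FQ) ≫ extLeft S pr X +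
        ((y ⊠ s ⊠ p) ≫ FP ⊠ q) ≫ extRight S X pr)
    (y : W.X ⟶ Y) (p : W.X ⟶ P) (q : W.X ⟶ Q) :
    (y ⊠ (p ⊠ q) ≫ pr) ≫ desusp F = (p ⊠ (y ⊠ q) ≫ desusp FQ) ≫ outLeft pr X +
        ((y ⊠ p) ≫ desusp FP ⊠ q) ≫ outRight X pr := by
  have key : Y ◁ pr ≫ desusp F = exch _ _ _ ≫ P ◁ desusp FQ ≫ outLeft pr X +
      (α_ _ _ _).inv ≫ desusp FP ▷ Q ≫ outRight X pr := by
    apply whiskerLeft_cancel (S := S)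
    rw [← cancel_mono (α_ S X X).inv]
    refine pure_ext fun W => ?_
    intro s y p q
    have h1 := h y s p q
    simp only [pair_desusp, extLeft_susp, extRight_susp] at h1
    simp only [← Category.assoc, pair_whiskerLeft, h1, MonoidalPreadditive.whiskerLeft_add,
      Preadditive.comp_add, Preadditive.add_comp, pair_exch, pair_associator_inv,
      pair_whiskerRight]
  simpa only [← Category.assoc, Preadditive.comp_add, pair_whiskerLeft, pair_exch,
    pair_associator_inv, pair_whiskerRight] using congrArg ((y ⊠ p ⊠ q) ≫ ·) key

/-- Desuspension is compatible with morphisms. -/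
theorem desusp_map {F : Y ⊗ (S ⊗ X) ⟶ (S ⊗ X) ⊗ V} {j : Q ⟶ X}
    {F₁ : Y ⊗ (S ⊗ Q) ⟶ (S ⊗ Q) ⊗ V}
    (h : ∀ {W : CommComon C} (y : W.X ⟶ Y) (s : W.X ⟶ S) (q : W.X ⟶ Q),
      (y ⊠ s ⊠ q ≫ j) ≫ F = ((y ⊠ s ⊠ q) ≫ F₁) ≫ (S ◁ j) ▷ V) :
    Y ◁ j ≫ desusp F = desusp F₁ ≫ j ▷ V := by
  apply whiskerLeft_cancel (S := S)
  rw [← cancel_mono (α_ S X V).inv]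
  refine pure_ext fun W => ?_
  intro s y q
  have h1 := h y s q
  simp only [pair_desusp, Category.assoc, ← associator_inv_naturality_middle] at h1
  simp only [← Category.assoc, pair_whiskerLeft, whiskerLeft_comp] at h1 ⊢
  exact h1

end DesuspMul

end DoubleAlgebra

/-! ### The Jacobi identity on `A ⊞ M` -/

namespace DoubleAlgebra

section Generators

variable {C : Type u} [Category.{v} C] [MonoidalCategory C] [SymmetricCategory C]
  [Preadditive C] [MonoidalPreadditive C] [HasBinaryBiproducts C]
variable {W : CommComon C} {S A X : C} {f : (S ⊗ A) ⊗ (S ⊗ A) ⟶ (S ⊗ A) ⊗ A}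
  {F : (S ⊗ X) ⊗ (S ⊗ X) ⟶ (S ⊗ X) ⊗ X} {i d : A ⟶ X}

section Maps

variable {P Q R U : C}

theorem sigmaRotL_map (a : P ⟶ X) (b : Q ⟶ X) (c : R ⟶ X) (t : W.X ⟶ ((S ⊗ P) ⊗ Q) ⊗ R) :
    (t ≫ ((S ◁ a ⊗ₘ b) ⊗ₘ c)) ≫ sigmaRotL S X X X =
      (t ≫ sigmaRotL S P Q R) ≫ ((S ◁ b ⊗ₘ c) ⊗ₘ a) := by
  have key : ((S ◁ a ⊗ₘ b) ⊗ₘ c) ≫ sigmaRotL S X X X =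
      sigmaRotL S P Q R ≫ ((S ◁ b ⊗ₘ c) ⊗ₘ a) := by
    refine pure_ext fun W => ?_
    intro s x y z
    simp only [← Category.assoc, pair_tensorHom, pair_whiskerLeft, pair_sigmaRotL]
  simpa only [← Category.assoc] using congrArg (t ≫ ·) key

theorem sigmaRotR_map (a : P ⟶ X) (b : Q ⟶ X) (c : R ⟶ X) (t : W.X ⟶ ((S ⊗ P) ⊗ Q) ⊗ R) :
    (t ≫ ((S ◁ a ⊗ₘ b) ⊗ₘ c)) ≫ sigmaRotR S X X X =
      (t ≫ sigmaRotR S P Q R) ≫ ((S ◁ c ⊗ₘ a) ⊗ₘ b) := by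
  have key : ((S ◁ a ⊗ₘ b) ⊗ₘ c) ≫ sigmaRotR S X X X =
      sigmaRotR S P Q R ≫ ((S ◁ c ⊗ₘ a) ⊗ₘ b) := by
    refine pure_ext fun W => ?_
    intro s x y z
    simp only [← Category.assoc, pair_tensorHom, pair_whiskerLeft, pair_sigmaRotR]
  simpa only [← Category.assoc] using congrArg (t ≫ ·) key

/-- The outer bracket in a nested one, evaluated along maps to `X`. -/
theorem outer_map {p : P ⟶ X} {q : Q ⟶ X} {u : U ⟶ X}
    {G : (S ⊗ U) ⊗ (S ⊗ P) ⟶ (S ⊗ X) ⊗ X}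
    (h : (S ◁ u ⊗ₘ S ◁ p) ≫ F = G) (x : W.X ⟶ S ⊗ U) (t : W.X ⟶ (S ⊗ P) ⊗ Q) :
    ((x ≫ S ◁ u ⊠ t ≫ (S ◁ p ⊗ₘ q)) ≫ (α_ _ _ _).inv) ≫ F ▷ X =
      (((x ⊠ t) ≫ (α_ _ _ _).inv) ≫ G ▷ Q) ≫ _ ◁ q := by
  have key : (S ◁ u ⊗ₘ (S ◁ p ⊗ₘ q)) ≫ (α_ _ _ _).inv ≫ F ▷ X =
      (α_ _ _ _).inv ≫ G ▷ Q ≫ _ ◁ q := by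
    refine pure_ext fun W => ?_
    intro s x s' y z
    simp only [← h, ← Category.assoc, pair_tensorHom, pair_associator_inv, pair_whiskerRight,
      pair_whiskerLeft]
  simpa only [← Category.assoc, pair_tensorHom] using congrArg ((x ⊠ t) ≫ ·) key

theorem whiskerRight_split {P' Q' R' Y Z : C} (f : Y ⟶ (S ⊗ P) ⊗ Q) (p : P ⟶ P') (q : Q ⟶ Q')
    (r : R ⟶ R') (t : Z ⟶ Y ⊗ R) :
    (t ≫ (f ≫ (S ◁ p ⊗ₘ q)) ▷ R) ≫ _ ◁ r = (t ≫ f ▷ R) ≫ ((S ◁ p ⊗ₘ q) ⊗ₘ r) := by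
  simp only [comp_whiskerRight, Category.assoc, MonoidalCategory.tensorHom_def (S ◁ p ⊗ₘ q) r]

end Maps

/-- If a bracket on `X` is given on the images of two maps `i, d : A ⟶ X` by the formulas
`{i, i} = 0`, `{i, d} = {d, i} = (i ⊗ i){-, -}` and `{d, d} = (d ⊗ i + i ⊗ d){-, -}`, for a bracket
on `A` satisfying the double Jacobi identity, then its Jacobiator vanishes on these images. -/
theorem jacobiOn_generators
    (hJ : jacobiator f = 0)
    (hii : (S ◁ i ⊗ₘ S ◁ i) ≫ F = 0)
    (hid : (S ◁ i ⊗ₘ S ◁ d) ≫ F = f ≫ (S ◁ i ⊗ₘ i))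
    (hdi : (S ◁ d ⊗ₘ S ◁ i) ≫ F = f ≫ (S ◁ i ⊗ₘ i))
    (hdd : (S ◁ d ⊗ₘ S ◁ d) ≫ F = f ≫ (S ◁ d ⊗ₘ i) + f ≫ (S ◁ i ⊗ₘ d)) :
    JacobiOn F (S ◁ i) (S ◁ i) (S ◁ i) ∧ JacobiOn F (S ◁ d) (S ◁ i) (S ◁ i) ∧
      JacobiOn F (S ◁ d) (S ◁ d) (S ◁ i) ∧ JacobiOn F (S ◁ d) (S ◁ d) (S ◁ d) := by
  have el : ∀ {u v : A ⟶ X} {G : (S ⊗ A) ⊗ (S ⊗ A) ⟶ (S ⊗ X) ⊗ X}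
      (_ : (S ◁ u ⊗ₘ S ◁ v) ≫ F = G) {W : CommComon C} (x y : W.X ⟶ S ⊗ A),
      (x ≫ S ◁ u ⊠ y ≫ S ◁ v) ≫ F = (x ⊠ y) ≫ G := by
    intro u v G h W x y
    simpa only [← Category.assoc, pair_tensorHom] using congrArg ((x ⊠ y) ≫ ·) h
  have hJ' : ∀ {W : CommComon C} (x y z : W.X ⟶ S ⊗ A), (x ⊠ y ⊠ z) ≫ nest f f +
      ((z ⊠ x ⊠ y) ≫ nest f f) ≫ sigmaRotL S A A A +
      ((y ⊠ z ⊠ x) ≫ nest f f) ≫ sigmaRotR S A A A = 0 := by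
    intro W x y z
    rw [← pair_jacobiator, hJ, comp_zero]
  have hN : ∀ {W : CommComon C} (x y z : W.X ⟶ S ⊗ A),
      (((x ⊠ (y ⊠ z) ≫ f) ≫ (α_ _ _ _).inv) ≫ f ▷ A) = (x ⊠ y ⊠ z) ≫ nest f f :=
    fun x y z => (pair_nest f f x (y ⊠ z)).symm
  -- with at most one `d`, every term contains a bracket `{i, i} = 0`; with two or three, the
  -- Jacobiator is the one of `f`, to which `i ⊗ i ⊗ i` or `d ⊗ i ⊗ i + i ⊗ d ⊗ i + i ⊗ i ⊗ d` is
  -- applied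
  refine ⟨?_, ?_, ?_, ?_⟩ <;> refine pure_ext fun W => ?_ <;> intro s a t b r c <;>
    simp only [← Category.assoc, pair_tensorHom, pair_jacobiator, pair_nest, el hii, el hid,
      el hdi, el hdd, comp_zero, pair_zero, Limits.zero_comp, Preadditive.comp_add, pair_add,
      Preadditive.add_comp, add_zero, outer_map hii, outer_map hid, outer_map hdi,
      outer_map hdd, MonoidalPreadditive.add_whiskerRight, MonoidalPreadditive.zero_whiskerRight,
      whiskerRight_split, sigmaRotL_map, sigmaRotR_map]
  · simp only [hN]
    have h := congrArg (· ≫ ((S ◁ i ⊗ₘ i) ⊗ₘ i)) (hJ' (s ⊠ a) (t ⊠ b) (r ⊠ c))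
    simp only [Preadditive.add_comp, Limits.zero_comp] at h
    rw [← h]
  · simp only [hN]
    have h := congrArg (· ≫ (((S ◁ d ⊗ₘ i) ⊗ₘ i) + ((S ◁ i ⊗ₘ d) ⊗ₘ i) + ((S ◁ i ⊗ₘ i) ⊗ₘ d)))
      (hJ' (s ⊠ a) (t ⊠ b) (r ⊠ c))
    simp only [Preadditive.add_comp, Preadditive.comp_add, Limits.zero_comp, add_zero] at h
    refine Eq.trans ?_ h
    abel

end Generators

section Sqz

variable {C : Type u} [Category.{v} C] [MonoidalCategory C] [SymmetricCategory C]
  [Preadditive C] [MonoidalPreadditive C] [HasBinaryBiproducts C]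
variable {W : CommComon C} {S : C} {A : Mon C} {M : Bimod A A} {U V : C}
  [(tensorLeft S).Full] [(tensorLeft S).Faithful]
  {ρ : (S ⊗ M.X) ⊗ (S ⊗ A.X) ⟶ (S ⊗ A.X) ⊗ A.X}
  {B : (S ⊗ M.X) ⊗ (S ⊗ M.X) ⟶ S ⊗ ((M.X ⊗ A.X) ⊞ (A.X ⊗ M.X))}

/-- `jacDer` is natural in the third variable. -/
theorem jacDer_map {Y X Q : C} (F : Y ⊗ Y ⟶ Y ⊗ X) {g : Y ⊗ X ⟶ X ⊗ X} {g₁ : Y ⊗ Q ⟶ Q ⊗ X}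
    (j : Q ⟶ X) (h : Y ◁ j ≫ g = g₁ ≫ j ▷ X) (x y : W.X ⟶ Y) (q : W.X ⟶ Q) :
    (x ⊠ y ⊠ q ≫ j) ≫ jacDer F g g = ((x ⊠ y ⊠ q) ≫ jacDer F g g₁) ≫ j ▷ (X ⊗ X) := by
  have h' : ∀ {W : CommComon C} (x : W.X ⟶ Y) (q : W.X ⟶ Q),
      (x ⊠ q ≫ j) ≫ g = ((x ⊠ q) ≫ g₁) ≫ j ▷ X := by
    intro W x q
    simpa only [← Category.assoc, pair_whiskerLeft] using congrArg ((x ⊠ q) ≫ ·) h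
  have h1 : ∀ b : W.X ⟶ Q ⊗ X,
      (((x ⊠ b ≫ j ▷ X) ≫ (α_ _ _ _).inv) ≫ g ▷ X) ≫ (α_ _ _ _).hom =
        ((((x ⊠ b) ≫ (α_ _ _ _).inv) ≫ g₁ ▷ X) ≫ (α_ _ _ _).hom) ≫ j ▷ (X ⊗ X) := by
    have key : Y ◁ j ▷ X ≫ (α_ _ _ _).inv ≫ g ▷ X ≫ (α_ _ _ _).hom =
        (α_ _ _ _).inv ≫ g₁ ▷ X ≫ (α_ _ _ _).hom ≫ j ▷ (X ⊗ X) := by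
      have := congrArg (fun k => (α_ Y Q X).inv ≫ k ▷ X ≫ (α_ _ _ _).hom) h
      simpa using this
    intro b
    simpa only [← Category.assoc, pair_whiskerLeft] using congrArg ((x ⊠ b) ≫ ·) key
  have h2 : ∀ b : W.X ⟶ Q ⊗ X,
      ((y ⊠ b ≫ j ▷ X) ≫ exch Y X X) ≫ X ◁ g =
        (((y ⊠ b) ≫ exch Y Q X) ≫ Q ◁ g) ≫ j ▷ (X ⊗ X) := by
    have key : Y ◁ j ▷ X ≫ exch Y X X ≫ X ◁ g = exch Y Q X ≫ Q ◁ g ≫ j ▷ (X ⊗ X) := by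
      refine pure_ext fun W => ?_
      intro y q x
      simp only [← Category.assoc, pair_whiskerLeft, pair_whiskerRight, pair_exch]
    intro b
    simpa only [← Category.assoc, pair_whiskerLeft] using congrArg ((y ⊠ b) ≫ ·) key
  have h3 : ∀ t : W.X ⟶ Y ⊗ X,
      ((((t ⊠ q ≫ j) ≫ (α_ _ _ _).hom) ≫ exch Y X X) ≫ X ◁ g) ≫ exch X X X =
        (((((t ⊠ q) ≫ (α_ _ _ _).hom) ≫ exch Y X Q) ≫ X ◁ g₁) ≫ exch X Q X) ≫ j ▷ (X ⊗ X) := by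
    have key : (Y ⊗ X) ◁ j ≫ (α_ _ _ _).hom ≫ exch Y X X ≫ X ◁ g ≫ exch X X X =
        (α_ _ _ _).hom ≫ exch Y X Q ≫ X ◁ g₁ ≫ exch X Q X ≫ j ▷ (X ⊗ X) := by
      have hn : X ◁ j ▷ X ≫ exch X X X = exch X Q X ≫ j ▷ (X ⊗ X) := by
        refine pure_ext fun W => ?_
        intro u q v
        simp only [← Category.assoc, pair_whiskerLeft, pair_whiskerRight, pair_exch]
      rw [← hn]
      refine pure_ext fun W => ?_
      intro u v q
      simp only [← Category.assoc, pair_whiskerLeft, pair_exch, pair_associator_hom, h']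
    intro t
    simpa only [← Category.assoc, pair_whiskerLeft] using congrArg ((t ⊠ q) ≫ ·) key
  simp only [pair_jacDer, h', h1, h2, h3, Preadditive.sub_comp]

variable (hs : IsAntisymm S B) (ha : IsAnchor S ρ) (hd : IsAnchorDerivation S ρ B)
  {u : U ⟶ S ⊗ (A.X ⊞ M.X)} {v : V ⟶ S ⊗ (A.X ⊞ M.X)}
include hs ha hd

/-- If the Jacobiator vanishes for a third variable in `A` or in the image of a map `d : A ⟶ M`
which generates `M` as a right module, then it vanishes for every value of the third variable. -/
theorem jacobiOn_sqz {d : A.X ⟶ M.X}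
    (hgen : IsSplitEpi (d ▷ A.X ≫ M.actRight))
    (hi : JacobiOn (sqzBracket ρ B) u v (S ◁ biprod.inl))
    (hd' : JacobiOn (sqzBracket ρ B) u v (S ◁ (d ≫ biprod.inr))) :
    JacobiOn (sqzBracket ρ B) u v (𝟙 _) := by
  have hs' : ∀ {W : CommComon C} (x y : W.X ⟶ S ⊗ (A.X ⊞ M.X)),
      (x ⊠ y) ≫ sqzBracket ρ B = -(((y ⊠ x) ≫ sqzBracket ρ B) ≫ sigmaTau S _ _) :=
    fun x y => sqzBracket_antisymm hs x y
  have hi0 := fun {W : CommComon C} => hi.jacDer_eq_zero (W := W) hs'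
  have hd0 := fun {W : CommComon C} => hd'.jacDer_eq_zero (W := W) hs'
  -- the bracket with an element of `A` in the second variable
  let FA : (S ⊗ (A.X ⊞ M.X)) ⊗ (S ⊗ A.X) ⟶ (S ⊗ A.X) ⊗ (A.X ⊞ M.X) := sqzBase ρ ≫ _ ◁ biprod.inl
  have hFA : (S ⊗ (A.X ⊞ M.X)) ◁ biprod.inl ≫ desusp (sqzBracket ρ B) =
      desusp FA ≫ biprod.inl ▷ _ := by
    refine desusp_map fun y s q => ?_
    rw [← pair_whiskerLeft, sqzBracket_inl, tensorHom_def']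
    simp only [FA, ← Category.assoc]
  have hmul := fun {W : CommComon C} => desusp_mul (W := W) (pr := sqzRight M) (FQ := FA)
    (FP := sqzBracket ρ B) (F := sqzBracket ρ B) (fun y s p q => by
      rw [sqzBracket_right ha hd]
      simp only [FA, ← Category.assoc])
  have hA0 : ∀ {W : CommComon C} (x : W.X ⟶ U) (y : W.X ⟶ V) (a : W.X ⟶ A.X),
      (x ≫ u ⊠ y ≫ v ⊠ a) ≫ jacDer (sqzBracket ρ B) (desusp (sqzBracket ρ B)) (desusp FA) = 0 := by
    intro W x y a
    rw [← cancel_mono ((biprod.inl : A.X ⟶ A.X ⊞ M.X) ▷ ((A.X ⊞ M.X) ⊗ (A.X ⊞ M.X))),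
      ← jacDer_map _ _ hFA, hi0, Limits.zero_comp]
  apply jacobiOn_of_jacDer hs'
  have hinl : (u ⊗ₘ (v ⊗ₘ biprod.inl)) ≫
      jacDer (sqzBracket ρ B) (desusp (sqzBracket ρ B)) (desusp (sqzBracket ρ B)) = 0 := by
    refine pure_ext fun W => ?_
    intro x y a
    simp only [← Category.assoc, pair_tensorHom, comp_zero, hi0]
  have hinr : (u ⊗ₘ (v ⊗ₘ biprod.inr)) ≫
      jacDer (sqzBracket ρ B) (desusp (sqzBracket ρ B)) (desusp (sqzBracket ρ B)) = 0 := by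
    rw [← cancel_epi (U ◁ V ◁ (d ▷ A.X ≫ M.actRight))]
    refine pure_ext fun W => ?_
    intro x y c e
    have h1 : ((c ≫ d ⊠ e) ≫ M.actRight) ≫ biprod.inr =
        ((c ≫ d) ≫ biprod.inr ⊠ e) ≫ sqzRight M := by
      have := congrArg ((c ≫ d ⊠ e) ≫ ·) (inr_sqzRight (M := M))
      simpa only [← Category.assoc, pair_whiskerRight] using this.symm
    simp only [← Category.assoc, pair_tensorHom, pair_whiskerLeft, pair_whiskerRight, comp_zero]
    rw [h1, jacDer_mul _ hmul, hA0, Category.assoc c, hd0]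
    simp only [pair_zero, zero_pair, Limits.zero_comp, add_zero]
  have htot : (u ⊗ₘ (v ⊗ₘ 𝟙 (A.X ⊞ M.X))) = U ◁ V ◁ biprod.fst ≫ (u ⊗ₘ (v ⊗ₘ biprod.inl)) +
      U ◁ V ◁ biprod.snd ≫ (u ⊗ₘ (v ⊗ₘ biprod.inr)) := by
    simp only [← id_tensorHom, tensorHom_comp_tensorHom, Category.id_comp,
      ← MonoidalPreadditive.tensor_add, biprod.total]
  rw [htot, Preadditive.add_comp, Category.assoc, Category.assoc, hinl, hinr, comp_zero, comp_zero,
    add_zero]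

end Sqz

end DoubleAlgebra

namespace DoubleAlgebra

section SqzJacobi

variable {C : Type u} [Category.{v} C] [MonoidalCategory C] [SymmetricCategory C]
  [Preadditive C] [MonoidalPreadditive C] [HasBinaryBiproducts C]
variable {W : CommComon C} {S : C} {A : Mon C} {M : Bimod A A}
  {ρ : (S ⊗ M.X) ⊗ (S ⊗ A.X) ⟶ (S ⊗ A.X) ⊗ A.X}
  {B : (S ⊗ M.X) ⊗ (S ⊗ M.X) ⟶ S ⊗ ((M.X ⊗ A.X) ⊞ (A.X ⊗ M.X))}

theorem inl_inl_sqzBracket : (S ◁ biprod.inl ⊗ₘ S ◁ biprod.inl) ≫ sqzBracket ρ B = 0 := by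
  refine pure_ext fun W => ?_
  intro s a t b
  simp only [← Category.assoc, pair_tensorHom, sqzBracket_inl, pair_sqzBase, comp_zero]
  simp only [Category.assoc, ← whiskerLeft_comp, biprod.inl_snd,
    MonoidalPreadditive.whiskerLeft_zero, comp_zero, zero_pair, Limits.zero_comp]

theorem inr_inl_sqzBracket : (S ◁ biprod.inr ⊗ₘ S ◁ biprod.inl) ≫ sqzBracket ρ B =
    ρ ≫ (S ◁ biprod.inl ⊗ₘ biprod.inl) := by
  refine pure_ext fun W => ?_
  intro s a t b
  simp only [← Category.assoc, pair_tensorHom, sqzBracket_inl, pair_sqzBase]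
  simp only [Category.assoc, ← whiskerLeft_comp, biprod.inr_snd, whiskerLeft_id, Category.comp_id]

theorem inl_inr_sqzBracket : (S ◁ biprod.inl ⊗ₘ S ◁ biprod.inr) ≫ sqzBracket ρ B =
    anchorTau S ρ ≫ (S ◁ biprod.inl ⊗ₘ biprod.inl) := by
  refine pure_ext fun W => ?_
  intro s a t b
  simp only [← Category.assoc, pair_tensorHom, pair_sqzBracket]
  simp only [Category.assoc, ← whiskerLeft_comp, biprod.inl_snd, biprod.inr_fst, biprod.inl_fst,
    biprod.inr_snd, MonoidalPreadditive.whiskerLeft_zero, comp_zero, zero_pair, pair_zero,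
    Limits.zero_comp, whiskerLeft_id, Category.comp_id, zero_add]

theorem inr_inr_sqzBracket : (S ◁ biprod.inr ⊗ₘ S ◁ biprod.inr) ≫ sqzBracket ρ B =
    compL B ≫ (S ◁ biprod.inr ⊗ₘ biprod.inl) + compR B ≫ (S ◁ biprod.inl ⊗ₘ biprod.inr) := by
  refine pure_ext fun W => ?_
  intro s a t b
  simp only [← Category.assoc, Preadditive.comp_add, pair_tensorHom, pair_sqzBracket]
  simp only [Category.assoc, ← whiskerLeft_comp, biprod.inr_fst,
    biprod.inr_snd, MonoidalPreadditive.whiskerLeft_zero, comp_zero, zero_pair, pair_zero,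
    Limits.zero_comp, whiskerLeft_id, Category.comp_id, add_zero]

section Vanishing

variable [(tensorLeft S).Full] [(tensorLeft S).Faithful]
  {f : (S ⊗ A.X) ⊗ (S ⊗ A.X) ⟶ (S ⊗ A.X) ⊗ A.X} {d : A.X ⟶ M.X}

/-- The Jacobi identity on `A ⊞ M` when `M` is generated, as a right module, by the image of a
map `d : A ⟶ M` on which `ρ` and `B` are given by a double Poisson bracket of `A`. -/
theorem jacobiator_sqzBracket (hf : IsDoublePoisson S A f)
    (hs : IsAntisymm S B) (ha : IsAnchor S ρ) (hd : IsAnchorDerivation S ρ B)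
    (hgen : IsSplitEpi (d ▷ A.X ≫ M.actRight)) (hρ : (S ◁ d) ▷ (S ⊗ A.X) ≫ ρ = f)
    (hL : (S ◁ d ⊗ₘ S ◁ d) ≫ compL B = f ≫ (S ◁ d) ▷ A.X)
    (hR : (S ◁ d ⊗ₘ S ◁ d) ≫ compR B = f ≫ (S ⊗ A.X) ◁ d) :
    jacobiator (sqzBracket ρ B) = 0 := by
  have hρ' : ∀ {W : CommComon C} (x y : W.X ⟶ S ⊗ A.X),
      (x ≫ S ◁ d ⊠ y) ≫ ρ = (x ⊠ y) ≫ f := by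
    intro W x y
    simpa only [← Category.assoc, pair_whiskerRight] using congrArg ((x ⊠ y) ≫ ·) hρ
  obtain ⟨h0, h1, h2, h3⟩ := jacobiOn_generators (F := sqzBracket ρ B) (f := f)
    (i := biprod.inl) (d := d ≫ biprod.inr) hf.jacobi inl_inl_sqzBracket
    (by
      refine pure_ext fun W => ?_
      intro s a t b
      have h := congrArg (((s ⊠ a) ⊠ ((t ⊠ b) ≫ S ◁ d)) ≫ ·) (inl_inr_sqzBracket (ρ := ρ) (B := B))
      simp only [← Category.assoc, pair_tensorHom, pair_anchorTau, hρ',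
        ← hf.antisymm_el] at h
      simpa only [← Category.assoc, pair_tensorHom, whiskerLeft_comp] using h)
    (by
      refine pure_ext fun W => ?_
      intro s a t b
      have h := congrArg ((((s ⊠ a) ≫ S ◁ d) ⊠ (t ⊠ b)) ≫ ·) (inr_inl_sqzBracket (ρ := ρ) (B := B))
      simp only [← Category.assoc, pair_tensorHom, hρ'] at h
      simpa only [← Category.assoc, pair_tensorHom, whiskerLeft_comp] using h)
    (by
      let j : M.X ⟶ A.X ⊞ M.X := biprod.inr
      have h : (S ◁ (d ≫ j) ⊗ₘ S ◁ (d ≫ j)) =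
          (S ◁ d ⊗ₘ S ◁ d) ≫ (S ◁ j ⊗ₘ S ◁ j) := by
        simp only [tensorHom_comp_tensorHom, whiskerLeft_comp]
      rw [h, Category.assoc, inr_inr_sqzBracket, Preadditive.comp_add, ← Category.assoc,
        ← Category.assoc, hL, hR, Category.assoc, Category.assoc]
      simp only [← tensorHom_id, ← id_tensorHom, tensorHom_comp_tensorHom,
        Category.id_comp])
  have cl : ∀ {U V : C} {u : U ⟶ S ⊗ (A.X ⊞ M.X)} {v : V ⟶ S ⊗ (A.X ⊞ M.X)},
      JacobiOn (sqzBracket ρ B) u v (S ◁ biprod.inl) →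
      JacobiOn (sqzBracket ρ B) u v (S ◁ (d ≫ biprod.inr)) →
      JacobiOn (sqzBracket ρ B) u v (𝟙 _) := fun h h' => jacobiOn_sqz hs ha hd hgen h h'
  -- the three variables are extended from generators to `A ⊞ M` in turn
  have hii := (cl h0 h1.rotate).rotate.rotate
  have hid := (cl h1.rotate.rotate h2.rotate.rotate).rotate.rotate
  have hdi := (cl h1 h2.rotate).rotate.rotate
  have hdd := (cl h2 h3).rotate.rotate
  have h := cl (cl hii hid).rotate.rotate (cl hdi hdd).rotate.rotate
  simpa only [JacobiOn, id_tensorHom, whiskerLeft_id, Category.id_comp] using h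

end Vanishing

end SqzJacobi

end DoubleAlgebra

/-! ### The double Lie-Rinehart structure -/

namespace DoubleAlgebra

section Extraction

variable {C : Type u} [Category.{v} C] [MonoidalCategory C] [SymmetricCategory C]
  [Preadditive C] [MonoidalPreadditive C] [HasBinaryBiproducts C]
variable {W : CommComon C} {S : C} {A : Mon C} {M : Bimod A A}
  {ρ : (S ⊗ M.X) ⊗ (S ⊗ A.X) ⟶ (S ⊗ A.X) ⊗ A.X}
  {B : (S ⊗ M.X) ⊗ (S ⊗ M.X) ⟶ S ⊗ ((M.X ⊗ A.X) ⊞ (A.X ⊗ M.X))}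

/-- The two Jacobi-type axioms of a double Lie-Rinehart algebra are components of the Jacobi
identity on `A ⊞ M`. -/
theorem isDoubleLieRinehart_of_jacobiator (ha : IsAnchor S ρ) (hs : IsAntisymm S B)
    (hd : IsAnchorDerivation S ρ B) (hJ : jacobiator (sqzBracket ρ B) = 0) :
    IsDoubleLieRinehart S ρ B := by
  have el : ∀ {P Q : C} {u : P ⟶ A.X ⊞ M.X} {v : Q ⟶ A.X ⊞ M.X}
      {G : (S ⊗ P) ⊗ (S ⊗ Q) ⟶ (S ⊗ (A.X ⊞ M.X)) ⊗ (A.X ⊞ M.X)}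
      (_ : (S ◁ u ⊗ₘ S ◁ v) ≫ sqzBracket ρ B = G) {W : CommComon C} (x : W.X ⟶ S ⊗ P)
      (y : W.X ⟶ S ⊗ Q), (x ≫ S ◁ u ⊠ y ≫ S ◁ v) ≫ sqzBracket ρ B = (x ⊠ y) ≫ G := by
    intro P Q u v G h W x y
    simpa only [← Category.assoc, pair_tensorHom] using congrArg ((x ⊠ y) ≫ ·) h
  refine ⟨ha, hs, hd, ?_, ?_⟩
  -- evaluate the Jacobi identity on `A ⊗ M ⊗ M`, where it takes values in `ΣA ⊗ A ⊗ A`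
  · rw [← cancel_mono ((S ◁ (biprod.inl : A.X ⟶ A.X ⊞ M.X) ⊗ₘ (biprod.inl : A.X ⟶ A.X ⊞ M.X)) ⊗ₘ
      (biprod.inl : A.X ⟶ A.X ⊞ M.X))]
    refine pure_ext fun W => ?_
    intro s a t m r n
    have h := congrArg (((s ⊠ a) ≫ S ◁ biprod.inl ⊠ (t ⊠ m) ≫ S ◁ biprod.inr ⊠
      (r ⊠ n) ≫ S ◁ biprod.inr) ≫ ·) hJ
    simp only [← Category.assoc, pair_jacobiator, pair_nest, el inl_inr_sqzBracket,
      el inr_inl_sqzBracket, el inr_inr_sqzBracket, comp_zero, Limits.zero_comp,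
      Preadditive.comp_add, pair_add, Preadditive.add_comp, add_zero,
      outer_map inl_inl_sqzBracket, outer_map inl_inr_sqzBracket, outer_map inr_inl_sqzBracket,
      MonoidalPreadditive.zero_whiskerRight, whiskerRight_split, sigmaRotL_map,
      sigmaRotR_map] at h
    simp only [Preadditive.comp_add, Preadditive.add_comp, ← Category.assoc, pair_cycL, pair_cycR,
      pair_nest, Limits.zero_comp, comp_zero]
    refine Eq.trans ?_ h
    abel
  -- evaluate the Jacobi identity on `M ⊗ M ⊗ M` and project to `ΣM ⊗ A ⊗ A`
  · refine pure_ext fun W => ?_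
    intro s a t m r n
    have h := congrArg (fun k => (((s ⊠ a) ≫ S ◁ biprod.inr ⊠ (t ⊠ m) ≫ S ◁ biprod.inr ⊠
      (r ⊠ n) ≫ S ◁ biprod.inr) ≫ k) ≫ ((S ◁ biprod.snd ⊗ₘ biprod.fst) ⊗ₘ biprod.fst)) hJ
    simp only [← Category.assoc, pair_jacobiator, pair_nest, el inr_inr_sqzBracket, comp_zero,
      Limits.zero_comp, Preadditive.comp_add, pair_add, Preadditive.add_comp,
      outer_map inr_inl_sqzBracket, outer_map inr_inr_sqzBracket,
      MonoidalPreadditive.add_whiskerRight, whiskerRight_split, sigmaRotL_map,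
      sigmaRotR_map] at h
    simp only [Category.assoc, tensorHom_comp_tensorHom, ← whiskerLeft_comp, biprod.inl_fst,
      biprod.inl_snd, biprod.inr_fst, biprod.inr_snd, MonoidalPreadditive.whiskerLeft_zero,
      MonoidalPreadditive.zero_tensor, MonoidalPreadditive.tensor_zero, comp_zero, add_zero,
      zero_add, whiskerLeft_id, id_tensorHom_id, Category.comp_id] at h
    simp only [← Category.assoc] at h
    simp only [Preadditive.comp_add, ← Category.assoc, pair_cycL, pair_cycR, pair_nest, comp_zero]
    refine Eq.trans ?_ h
    abel

end Extraction

section Koszul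

variable {C : Type u} [Category.{v} C] [MonoidalCategory C] [SymmetricCategory C]
  [Preadditive C] [MonoidalPreadditive C] [HasBinaryBiproducts C] [HasCoequalizers C]
variable {S : C} {A : Mon C} {f : (S ⊗ A.X) ⊗ (S ⊗ A.X) ⟶ (S ⊗ A.X) ⊗ A.X}
  [(tensorLeft S).Full] [(tensorLeft S).Faithful]

theorem jacobiator_koszul (hf : IsDoublePoisson S A f) :
    jacobiator (sqzBracket (koszulAnchor f) (koszulBracket f)) = 0 := by
  have hB := isKoszulBracket_koszulBracket hf
  have hL : (S ◁ univD A ⊗ₘ S ◁ univD A) ≫ compL (koszulBracket f) =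
      f ≫ (S ◁ univD A) ▷ A.X := by
    rw [compL, ← Category.assoc, hB.univD_comp]
    simp only [Category.assoc, ← whiskerLeft_comp_assoc, biprod.lift_fst]
    simp
  have hR : (S ◁ univD A ⊗ₘ S ◁ univD A) ≫ compR (koszulBracket f) =
      f ≫ (S ⊗ A.X) ◁ univD A := by
    rw [compR, ← Category.assoc, hB.univD_comp]
    simp only [Category.assoc, ← whiskerLeft_comp_assoc, biprod.lift_snd]
    simp
  exact jacobiator_sqzBracket hf hB.antisymm (isAnchor_koszulAnchor hf) hB.derivation
    (inferInstanceAs (IsSplitEpi (omegaGen A))) (isInducedAnchor_koszulAnchor hf).univD_comp hL hR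

theorem isDoubleLieRinehart_koszul (hf : IsDoublePoisson S A f) :
    IsDoubleLieRinehart S (koszulAnchor f) (koszulBracket f) :=
  have hB := isKoszulBracket_koszulBracket hf
  isDoubleLieRinehart_of_jacobiator (isAnchor_koszulAnchor hf) hB.antisymm hB.derivation
    (jacobiator_koszul hf)

end Koszul

end DoubleAlgebra

/-! ### Derivations of the free algebra -/

namespace DoubleAlgebra

section FreeAlgebraElements

variable {C : Type u} [Category.{v} C] [MonoidalCategory C] [SymmetricCategory C]
  [HasCoequalizers C] [HasCoproductsOfShape ℕ C]
  [∀ X : C, PreservesColimitsOfShape (Discrete ℕ) (tensorLeft X)]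
variable {W : CommComon C} {A : Mon C} {M : Bimod A A} [IsTensorable M]

variable (M) in
/-- The inclusion of `M^{⊗_A n}` into the underlying object of the monoid `T_A(M)`. -/
noncomputable def powIncl (n : ℕ) : (tensorPow M n).X ⟶ (freeAlg M).X := freeAlgι M n

variable (M) in
/-- The action of `A` on `T_A(M)`. -/
noncomputable def baseAct : A.X ⊗ (freeAlg M).X ⟶ (freeAlg M).X := freeAlgAct M

variable (M) in
/-- The product `M ⊗ T_A(M) ⟶ T_A(M)`. -/
noncomputable def genMul : M.X ⊗ (freeAlg M).X ⟶ (freeAlg M).X := freeAlgShift M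

theorem freeAlgBase_mul (a : W.X ⟶ A.X) (t : W.X ⟶ (freeAlg M).X) :
    (a ≫ freeAlgBase M ⊠ t) ≫ μ[(freeAlg M).X] = (a ⊠ t) ≫ baseAct M := by
  have h : freeAlgBase M ▷ (freeAlg M).X ≫ μ[(freeAlg M).X] = baseAct M := freeAlgInl_mul M
  simpa only [← Category.assoc, pair_whiskerRight] using congrArg ((a ⊠ t) ≫ ·) h

theorem freeAlgBase_mul_ι (n : ℕ) (a : W.X ⟶ A.X) (p : W.X ⟶ (tensorPow M n).X) :
    (a ≫ freeAlgBase M ⊠ p ≫ powIncl M n) ≫ μ[(freeAlg M).X] =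
      ((a ⊠ p) ≫ (tensorPow M n).act) ≫ powIncl M n := by
  have h : A.X ◁ powIncl M n ≫ baseAct M = (tensorPow M n).act ≫ powIncl M n := freeAlgι_act M n
  rw [freeAlgBase_mul]
  simpa only [← Category.assoc, pair_whiskerLeft] using congrArg ((a ⊠ p) ≫ ·) h

theorem mul_freeAlgBase (a b : W.X ⟶ A.X) :
    ((a ⊠ b) ≫ μ[A.X]) ≫ freeAlgBase M =
      (a ≫ freeAlgBase M ⊠ b ≫ freeAlgBase M) ≫ μ[(freeAlg M).X] :=
  (freeAlgBase_mul_ι 0 a b).symm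

theorem oneEl_freeAlgBase : oneEl A W ≫ freeAlgBase M = oneEl (freeAlg M) W :=
  Category.assoc _ _ _

theorem comp_freeAlgInr (m : W.X ⟶ M.X) :
    m ≫ freeAlgInr M = (m ⊠ oneEl (freeAlg M) W) ≫ genMul M := by
  have h : freeAlgInr M = (ρ_ M.X).inv ≫ M.X ◁ η[A.X] ≫ M.X ◁ freeAlgBase M ≫ genMul M :=
    congrArg (fun k => (ρ_ M.X).inv ≫ M.X ◁ η[A.X] ≫ k) (freeAlgι_shift M 0).symm
  rw [h, ← oneEl_freeAlgBase]
  simp only [← Category.assoc, comp_rightUnitor_inv, pair_whiskerLeft, counit_comp_one]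

theorem freeAlgInr_mul (m : W.X ⟶ M.X) (t : W.X ⟶ (freeAlg M).X) :
    (m ≫ freeAlgInr M ⊠ t) ≫ μ[(freeAlg M).X] = (m ⊠ t) ≫ genMul M := by
  have h : genMul M ▷ _ ≫ μ[(freeAlg M).X] = (α_ _ _ _).hom ≫ M.X ◁ μ[(freeAlg M).X] ≫ genMul M :=
    freeAlgShift_mul M
  replace h := congrArg (((m ⊠ oneEl (freeAlg M) W) ⊠ t) ≫ ·) h
  simp only [← Category.assoc, pair_whiskerRight, pair_associator_hom, pair_whiskerLeft,
    oneEl_mul] at h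
  rw [comp_freeAlgInr, h]

theorem freeAlgInr_mul_ι (n : ℕ) (m : W.X ⟶ M.X) (p : W.X ⟶ (tensorPow M n).X) :
    (m ≫ freeAlgInr M ⊠ p ≫ powIncl M n) ≫ μ[(freeAlg M).X] =
      ((m ⊠ p) ≫ tensorPowπ M n) ≫ powIncl M (n + 1) := by
  have h : M.X ◁ powIncl M n ≫ genMul M = tensorPowπ M n ≫ powIncl M (n + 1) :=
    freeAlgι_shift M n
  rw [freeAlgInr_mul]
  simpa only [← Category.assoc, pair_whiskerLeft] using congrArg ((m ⊠ p) ≫ ·) h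

theorem actLeft_freeAlgInr (a : W.X ⟶ A.X) (m : W.X ⟶ M.X) :
    ((a ⊠ m) ≫ M.actLeft) ≫ freeAlgInr M =
      (a ≫ freeAlgBase M ⊠ m ≫ freeAlgInr M) ≫ μ[(freeAlg M).X] := by
  have h : A.X ◁ genMul M ≫ baseAct M = (α_ A.X M.X _).inv ≫ M.actLeft ▷ _ ≫ genMul M :=
    freeAlgShift_act M
  replace h := congrArg ((a ⊠ m ⊠ oneEl (freeAlg M) W) ≫ ·) h
  simp only [← Category.assoc, pair_whiskerRight, pair_associator_inv, pair_whiskerLeft] at h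
  rw [freeAlgBase_mul, comp_freeAlgInr, comp_freeAlgInr, h]

theorem actRight_freeAlgInr (m : W.X ⟶ M.X) (a : W.X ⟶ A.X) :
    ((m ⊠ a) ≫ M.actRight) ≫ freeAlgInr M =
      (m ≫ freeAlgInr M ⊠ a ≫ freeAlgBase M) ≫ μ[(freeAlg M).X] := by
  have h : (α_ M.X A.X _).hom ≫ M.X ◁ baseAct M ≫ genMul M = M.actRight ▷ _ ≫ genMul M :=
    freeAlgShift_balanced M
  replace h := congrArg (((m ⊠ a) ⊠ oneEl (freeAlg M) W) ≫ ·) h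
  simp only [← Category.assoc, pair_whiskerRight, pair_associator_hom, pair_whiskerLeft] at h
  rw [freeAlgInr_mul, comp_freeAlgInr, ← h, ← freeAlgBase_mul, mul_oneEl]

theorem freeAlg_hom_ext {Y Z : C} {g h : Y ⊗ (freeAlg M).X ⟶ Z}
    (e : ∀ n, Y ◁ powIncl M n ≫ g = Y ◁ powIncl M n ≫ h) : g = h :=
  freeAlg_hom_ext_left e

end FreeAlgebraElements

section Derivations

variable {C : Type u} [Category.{v} C] [MonoidalCategory C] [SymmetricCategory C]
  [Preadditive C]
variable {W : CommComon C} {Y Z : C}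

/-- `D : Y ⊗ T ⟶ Z` is a family of derivations, parametrized by `Y`, of the monoid `T` with values
in `Z`, for a left action `l` and a right action `r` of `T` on `Z`. -/
def IsDer {T : Mon C} (l : T.X ⊗ Z ⟶ Z) (r : Z ⊗ T.X ⟶ Z) (D : Y ⊗ T.X ⟶ Z) : Prop :=
  ∀ {W : CommComon C} (y : W.X ⟶ Y) (t t' : W.X ⟶ T.X),
    (y ⊠ (t ⊠ t') ≫ μ[T.X]) ≫ D = (t ⊠ (y ⊠ t') ≫ D) ≫ l + ((y ⊠ t) ≫ D ⊠ t') ≫ r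

variable [MonoidalPreadditive C] [HasBinaryBiproducts C] [HasCoequalizers C]
  [HasCoproductsOfShape ℕ C] [∀ X : C, PreservesColimitsOfShape (Discrete ℕ) (tensorLeft X)]
variable {A : Mon C} {M : Bimod A A} [IsTensorable M]
  {l : (freeAlg M).X ⊗ Z ⟶ Z} {r : Z ⊗ (freeAlg M).X ⟶ Z}

/-- Derivations of `T_A(M)` which agree on `A` and `M` are equal. -/
theorem IsDer.hom_ext {D D' : Y ⊗ (freeAlg M).X ⟶ Z} (hD : IsDer l r D) (hD' : IsDer l r D')
    (hA : Y ◁ freeAlgBase M ≫ D = Y ◁ freeAlgBase M ≫ D')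
    (hM : Y ◁ freeAlgInr M ≫ D = Y ◁ freeAlgInr M ≫ D') : D = D' := by
  refine freeAlg_hom_ext fun n => ?_
  induction n with
  | zero => exact hA
  | succ n ih =>
    rw [← cancel_epi (Y ◁ tensorPowπ M n)]
    refine pure_ext fun W => ?_
    intro y m p
    have h1 := congrArg ((y ⊠ m) ≫ ·) hM
    have h2 := congrArg ((y ⊠ p) ≫ ·) ih
    simp only [← Category.assoc, pair_whiskerLeft] at h1 h2 ⊢
    rw [← freeAlgInr_mul_ι]
    exact (hD _ _ _).trans (Eq.trans (by rw [h1, h2]) (hD' _ _ _).symm)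

variable {DA : Y ⊗ A.X ⟶ Z} {DM : Y ⊗ M.X ⟶ Z}

/-- Values on generators which extend to a derivation of `T_A(M)`. -/
structure IsDerData (l : (freeAlg M).X ⊗ Z ⟶ Z) (r : Z ⊗ (freeAlg M).X ⟶ Z)
    (DA : Y ⊗ A.X ⟶ Z) (DM : Y ⊗ M.X ⟶ Z) : Prop where
  biaction : IsBiaction (freeAlg M) l r
  base : ∀ {W : CommComon C} (y : W.X ⟶ Y) (a b : W.X ⟶ A.X),
    (y ⊠ (a ⊠ b) ≫ μ[A.X]) ≫ DA = (a ≫ freeAlgBase M ⊠ (y ⊠ b) ≫ DA) ≫ l +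
      ((y ⊠ a) ≫ DA ⊠ b ≫ freeAlgBase M) ≫ r
  left : ∀ {W : CommComon C} (y : W.X ⟶ Y) (a : W.X ⟶ A.X) (m : W.X ⟶ M.X),
    (y ⊠ (a ⊠ m) ≫ M.actLeft) ≫ DM = (a ≫ freeAlgBase M ⊠ (y ⊠ m) ≫ DM) ≫ l +
      ((y ⊠ a) ≫ DA ⊠ m ≫ freeAlgInr M) ≫ r
  right : ∀ {W : CommComon C} (y : W.X ⟶ Y) (m : W.X ⟶ M.X) (a : W.X ⟶ A.X),
    (y ⊠ (m ⊠ a) ≫ M.actRight) ≫ DM = (m ≫ freeAlgInr M ⊠ (y ⊠ a) ≫ DA) ≫ l +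
      ((y ⊠ m) ≫ DM ⊠ a ≫ freeAlgBase M) ≫ r

/-- The derivation property of a morphism on `M^{⊗_A n}` with respect to the action of `A`. -/
def IsDerAux (l : (freeAlg M).X ⊗ Z ⟶ Z) (r : Z ⊗ (freeAlg M).X ⟶ Z) (DA : Y ⊗ A.X ⟶ Z) (n : ℕ)
    (D : Y ⊗ (tensorPow M n).X ⟶ Z) : Prop :=
  ∀ {W : CommComon C} (y : W.X ⟶ Y) (a : W.X ⟶ A.X) (p : W.X ⟶ (tensorPow M n).X),
    (y ⊠ (a ⊠ p) ≫ (tensorPow M n).act) ≫ D = (a ≫ freeAlgBase M ⊠ (y ⊠ p) ≫ D) ≫ l +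
      ((y ⊠ a) ≫ DA ⊠ p ≫ powIncl M n) ≫ r

/-- The formula `D(m t) = m D(t) + D(m) t` on `M ⊗ M^{⊗_A n}`. -/
noncomputable def derStep (l : (freeAlg M).X ⊗ Z ⟶ Z) (r : Z ⊗ (freeAlg M).X ⟶ Z)
    (DM : Y ⊗ M.X ⟶ Z) (n : ℕ) (D : Y ⊗ (tensorPow M n).X ⟶ Z) :
    Y ⊗ (M.X ⊗ (tensorPow M n).X) ⟶ Z :=
  exch _ _ _ ≫ M.X ◁ D ≫ freeAlgInr M ▷ Z ≫ l + (α_ _ _ _).inv ≫ (DM ⊗ₘ powIncl M n) ≫ r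

omit [MonoidalPreadditive C] [HasBinaryBiproducts C] in
theorem pair_derStep (n : ℕ) (D : Y ⊗ (tensorPow M n).X ⟶ Z) (y : W.X ⟶ Y) (m : W.X ⟶ M.X)
    (p : W.X ⟶ (tensorPow M n).X) :
    (y ⊠ m ⊠ p) ≫ derStep l r DM n D = (m ≫ freeAlgInr M ⊠ (y ⊠ p) ≫ D) ≫ l +
      ((y ⊠ m) ≫ DM ⊠ p ≫ powIncl M n) ≫ r := by
  simp only [derStep, Preadditive.comp_add, ← Category.assoc, pair_exch, pair_whiskerLeft,
    pair_whiskerRight, pair_associator_inv, pair_tensorHom]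

/-- `m D(t) + D(m) t` is balanced over `A`: the terms `m D(a) t` agree. -/
theorem derStep_balanced (h : IsDerData l r DA DM) (n : ℕ) (D : Y ⊗ (tensorPow M n).X ⟶ Z)
    (hD : IsDerAux l r DA n D) :
    Y ◁ actOnRight M (tensorPow M n) ≫ derStep l r DM n D =
      Y ◁ actOnLeft M (tensorPow M n) ≫ derStep l r DM n D := by
  refine pure_ext fun W => ?_
  intro y m a p
  simp only [actOnRight, actOnLeft, whiskerLeft_comp, ← Category.assoc, pair_whiskerLeft,
    pair_whiskerRight, pair_associator_hom, pair_derStep]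
  rw [hD, h.right, ← freeAlgBase_mul_ι, actRight_freeAlgInr, h.biaction.mul_right,
    h.biaction.mul_left, pair_add, add_pair, Preadditive.add_comp, Preadditive.add_comp,
    h.biaction.left_right]
  abel

theorem isDerAux_succ (h : IsDerData l r DA DM) (n : ℕ) {D : Y ⊗ (tensorPow M n).X ⟶ Z}
    {D' : Y ⊗ (tensorPow M (n + 1)).X ⟶ Z}
    (hD' : Y ◁ tensorPowπ M n ≫ D' = derStep l r DM n D) : IsDerAux l r DA (n + 1) D' := by
  have hfac : ∀ {W : CommComon C} (y : W.X ⟶ Y) (m : W.X ⟶ M.X) (p : W.X ⟶ (tensorPow M n).X),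
      (y ⊠ (m ⊠ p) ≫ tensorPowπ M n) ≫ D' = (m ≫ freeAlgInr M ⊠ (y ⊠ p) ≫ D) ≫ l +
        ((y ⊠ m) ≫ DM ⊠ p ≫ powIncl M n) ≫ r := by
    intro W y m p
    rw [← pair_derStep, ← hD', ← Category.assoc, pair_whiskerLeft]
  have hact : ∀ {W : CommComon C} (a : W.X ⟶ A.X) (m : W.X ⟶ M.X) (p : W.X ⟶ (tensorPow M n).X),
      (a ⊠ (m ⊠ p) ≫ tensorPowπ M n) ≫ (tensorPow M (n + 1)).act =
        ((a ⊠ m) ≫ M.actLeft ⊠ p) ≫ tensorPowπ M n := by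
    intro W a m p
    simpa only [← Category.assoc, pair_whiskerLeft, pair_associator_inv, pair_whiskerRight] using
      congrArg ((a ⊠ m ⊠ p) ≫ ·) (whiskerLeft_tensorPowπ_act M n)
  have key : Y ◁ (tensorPow M (n + 1)).act ≫ D' =
      exch _ _ _ ≫ A.X ◁ D' ≫ freeAlgBase M ▷ Z ≫ l +
        (α_ _ _ _).inv ≫ (DA ⊗ₘ powIncl M (n + 1)) ≫ r := by
    have : Epi (Y ◁ A.X ◁ tensorPowπ M n) := by
      rw [show Y ◁ A.X ◁ tensorPowπ M n = (α_ _ _ _).inv ≫ (Y ⊗ A.X) ◁ tensorPowπ M n ≫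
        (α_ _ _ _).hom by simp]
      infer_instance
    rw [← cancel_epi (Y ◁ A.X ◁ tensorPowπ M n)]
    refine pure_ext fun W => ?_
    intro y a m p
    simp only [Preadditive.comp_add, ← Category.assoc, pair_exch, pair_whiskerLeft,
      pair_whiskerRight, pair_associator_inv, pair_tensorHom, hact, hfac]
    rw [h.left, ← freeAlgInr_mul_ι, actLeft_freeAlgInr, h.biaction.mul_right,
      h.biaction.mul_left, pair_add, add_pair, Preadditive.add_comp, Preadditive.add_comp,
      h.biaction.left_right]
    abel
  intro W y a p
  simpa only [Preadditive.comp_add, ← Category.assoc, pair_exch, pair_whiskerLeft,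
    pair_whiskerRight, pair_associator_inv, pair_tensorHom] using congrArg ((y ⊠ a ⊠ p) ≫ ·) key

/-- The derivation on `M^{⊗_A n}`. -/
noncomputable def derAux (h : IsDerData l r DA DM) :
    ∀ n : ℕ, { D : Y ⊗ (tensorPow M n).X ⟶ Z // IsDerAux l r DA n D }
  | 0 => ⟨DA, h.base⟩
  | n + 1 => ⟨relTensorDescLeft (M := M) (N := tensorPow M n) (derStep l r DM n (derAux h n).1)
      (derStep_balanced h n _ (derAux h n).2),
      isDerAux_succ h n (relTensorDescLeft_fac _ _)⟩

theorem tensorPowπ_derAux (h : IsDerData l r DA DM) (n : ℕ) :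
    Y ◁ tensorPowπ M n ≫ (derAux h (n + 1)).1 = derStep l r DM n (derAux h n).1 :=
  relTensorDescLeft_fac _ _

/-- The extension of its values on generators to a derivation of `T_A(M)`. -/
noncomputable def derExt (h : IsDerData l r DA DM) : Y ⊗ (freeAlg M).X ⟶ Z :=
  freeAlgDescLeft fun n => (derAux h n).1

theorem powIncl_derExt (h : IsDerData l r DA DM) (n : ℕ) :
    Y ◁ powIncl M n ≫ derExt h = (derAux h n).1 :=
  freeAlgDescLeft_fac _ n

theorem base_derExt (h : IsDerData l r DA DM) : Y ◁ freeAlgBase M ≫ derExt h = DA :=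
  powIncl_derExt h 0

theorem IsDerData.powIncl_el (h : IsDerData l r DA DM) (n : ℕ) (y : W.X ⟶ Y)
    (p : W.X ⟶ (tensorPow M n).X) : (y ⊠ p ≫ powIncl M n) ≫ derExt h = (y ⊠ p) ≫ (derAux h n).1 := by
  rw [← powIncl_derExt, ← Category.assoc, pair_whiskerLeft]

theorem IsDerData.base_el (h : IsDerData l r DA DM) (y : W.X ⟶ Y) (a : W.X ⟶ A.X) :
    (y ⊠ a ≫ freeAlgBase M) ≫ derExt h = (y ⊠ a) ≫ DA :=
  h.powIncl_el 0 y a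

theorem derExt_base_mul (h : IsDerData l r DA DM) (y : W.X ⟶ Y) (a : W.X ⟶ A.X)
    (t : W.X ⟶ (freeAlg M).X) : (y ⊠ (a ≫ freeAlgBase M ⊠ t) ≫ μ[(freeAlg M).X]) ≫ derExt h =
      (a ≫ freeAlgBase M ⊠ (y ⊠ t) ≫ derExt h) ≫ l + ((y ⊠ a) ≫ DA ⊠ t) ≫ r := by
  have key : (α_ Y A.X _).hom ≫ Y ◁ freeAlgBase M ▷ _ ≫ Y ◁ μ[(freeAlg M).X] ≫ derExt h =
      (α_ _ _ _).hom ≫ exch _ _ _ ≫ (freeAlgBase M ⊗ₘ derExt h) ≫ l + DA ▷ _ ≫ r := by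
    refine freeAlg_hom_ext fun n => pure_ext fun W => ?_
    intro y a p
    simp only [Preadditive.comp_add, ← Category.assoc, pair_exch, pair_whiskerLeft,
      pair_whiskerRight, pair_associator_hom, pair_tensorHom, freeAlgBase_mul_ι, h.powIncl_el]
    exact (derAux h n).2 y a p
  simpa only [Preadditive.comp_add, ← Category.assoc, pair_exch, pair_whiskerLeft,
    pair_whiskerRight, pair_associator_hom, pair_tensorHom] using congrArg (((y ⊠ a) ⊠ t) ≫ ·) key

theorem derExt_gen_mul (h : IsDerData l r DA DM) (y : W.X ⟶ Y) (m : W.X ⟶ M.X)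
    (t : W.X ⟶ (freeAlg M).X) : (y ⊠ (m ≫ freeAlgInr M ⊠ t) ≫ μ[(freeAlg M).X]) ≫ derExt h =
      (m ≫ freeAlgInr M ⊠ (y ⊠ t) ≫ derExt h) ≫ l + ((y ⊠ m) ≫ DM ⊠ t) ≫ r := by
  have key : (α_ Y M.X _).hom ≫ Y ◁ freeAlgInr M ▷ _ ≫ Y ◁ μ[(freeAlg M).X] ≫ derExt h =
      (α_ _ _ _).hom ≫ exch _ _ _ ≫ (freeAlgInr M ⊗ₘ derExt h) ≫ l + DM ▷ _ ≫ r := by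
    refine freeAlg_hom_ext fun n => pure_ext fun W => ?_
    intro y m p
    simp only [Preadditive.comp_add, ← Category.assoc, pair_exch, pair_whiskerLeft,
      pair_whiskerRight, pair_associator_hom, pair_tensorHom, freeAlgInr_mul_ι, h.powIncl_el]
    rw [← pair_derStep, ← tensorPowπ_derAux, ← Category.assoc, pair_whiskerLeft]
  simpa only [Preadditive.comp_add, ← Category.assoc, pair_exch, pair_whiskerLeft,
    pair_whiskerRight, pair_associator_hom, pair_tensorHom] using congrArg (((y ⊠ m) ⊠ t) ≫ ·) key

theorem gen_derExt (h : IsDerData l r DA DM) : Y ◁ freeAlgInr M ≫ derExt h = DM := by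
  refine pure_ext fun W => ?_
  intro y m
  -- a derivation kills the unit, so that `D(m) = D(m · 1)` is given by the value on `m`
  have h1 : (y ⊠ oneEl A W) ≫ DA = 0 := by
    have := h.base y (oneEl A W) (oneEl A W)
    rw [oneEl_mul, oneEl_freeAlgBase, h.biaction.one_left, h.biaction.one_right] at this
    exact left_eq_add.mp this
  have h2 := derExt_gen_mul h y m (oneEl (freeAlg M) W)
  rw [mul_oneEl, h.biaction.one_right, ← oneEl_freeAlgBase, h.base_el, h1, pair_zero,
    Limits.zero_comp, zero_add] at h2
  simpa only [← Category.assoc, pair_whiskerLeft] using h2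

/-- The derivation rule for `D(t t')` is proved by induction on the degree of `t`. -/
theorem isDer_derExt (h : IsDerData l r DA DM) : IsDer l r (derExt h) := by
  have key : (α_ Y (freeAlg M).X (freeAlg M).X).hom ≫ Y ◁ (β_ _ _).hom ≫
        Y ◁ μ[(freeAlg M).X] ≫ derExt h =
      (β_ _ _).hom ≫ (freeAlg M).X ◁ derExt h ≫ l +
        (α_ _ _ _).hom ≫ Y ◁ (β_ _ _).hom ≫ (α_ _ _ _).inv ≫ derExt h ▷ _ ≫ r := by
    refine freeAlg_hom_ext fun n => ?_
    induction n with
    | zero =>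
      change (Y ⊗ (freeAlg M).X) ◁ freeAlgBase M ≫ _ = (Y ⊗ (freeAlg M).X) ◁ freeAlgBase M ≫ _
      refine pure_ext fun W => ?_
      intro y t a
      have h1 := derExt_base_mul h y a t
      rw [← h.base_el] at h1
      simpa only [Preadditive.comp_add, ← Category.assoc, pair_whiskerLeft, pair_whiskerRight,
        pair_associator_hom, pair_associator_inv, pair_braiding_hom] using h1
    | succ n ih =>
      rw [← cancel_epi ((Y ⊗ (freeAlg M).X) ◁ tensorPowπ M n)]
      refine pure_ext fun W => ?_
      intro y t m p
      have h1 := congrArg (((y ⊠ t) ⊠ p) ≫ ·) ih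
      simp only [Preadditive.comp_add, ← Category.assoc, pair_whiskerLeft, pair_whiskerRight,
        pair_associator_hom, pair_associator_inv, pair_braiding_hom] at h1 ⊢
      rw [← freeAlgInr_mul_ι, pair_mul_assoc, derExt_gen_mul, h1, derExt_gen_mul, pair_add,
        add_pair, Preadditive.add_comp, Preadditive.add_comp, h.biaction.mul_left,
        h.biaction.left_right, h.biaction.mul_right]
      abel
  intro W y t t'
  simpa only [Preadditive.comp_add, ← Category.assoc, pair_whiskerLeft, pair_whiskerRight,
    pair_associator_hom, pair_associator_inv, pair_braiding_hom] using
    congrArg (((y ⊠ t') ⊠ t) ≫ ·) key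

end Derivations

end DoubleAlgebra

/-! ### Brackets on the free algebra which are derivations in the second variable -/

namespace DoubleAlgebra

section SuspendedDerivations

variable {C : Type u} [Category.{v} C] [MonoidalCategory C] [SymmetricCategory C]
  [Preadditive C]
variable {W : CommComon C} {S Y Z : C}

/-- `F : Y ⊗ ΣT ⟶ Z` is a derivation in its second variable, for a left action `l` and a right
action `r` of `T` on `Z`. -/
def IsSuspDer {T : Mon C} (l : T.X ⊗ Z ⟶ Z) (r : Z ⊗ T.X ⟶ Z) (F : Y ⊗ (S ⊗ T.X) ⟶ Z) : Prop :=
  ∀ {W : CommComon C} (y : W.X ⟶ Y) (s : W.X ⟶ S) (t t' : W.X ⟶ T.X),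
    (y ⊠ s ⊠ (t ⊠ t') ≫ μ[T.X]) ≫ F = (t ⊠ (y ⊠ s ⊠ t') ≫ F) ≫ l + ((y ⊠ s ⊠ t) ≫ F ⊠ t') ≫ r

/-- `F : Y ⊗ ΣT ⟶ ΣT ⊗ T` is a derivation in its second variable, for the external structure. -/
abbrev IsExtDer {T : Mon C} (F : Y ⊗ (S ⊗ T.X) ⟶ (S ⊗ T.X) ⊗ T.X) : Prop :=
  IsSuspDer (T := T) (extLeft S μ[T.X] T.X) (extRight S T.X μ[T.X]) F

theorem IsSuspDer.of_hom {T : Mon C} {l : T.X ⊗ Z ⟶ Z} {r : Z ⊗ T.X ⟶ Z} {F : Y ⊗ (S ⊗ T.X) ⟶ Z}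
    (h : Y ◁ S ◁ μ[T.X] ≫ F = pullLeft₂ Y S T.X T.X ≫ T.X ◁ F ≫ l +
      pullRight₂ Y S T.X T.X ≫ F ▷ T.X ≫ r) : IsSuspDer l r F := by
  intro W y s t t'
  simpa only [Preadditive.comp_add, ← Category.assoc, pair_whiskerLeft, pair_whiskerRight,
    pair_pullLeft₂, pair_pullRight₂] using congrArg ((y ⊠ s ⊠ t ⊠ t') ≫ ·) h

variable [MonoidalPreadditive C] [HasBinaryBiproducts C]

theorem IsSuspDer.isDer {T : Mon C} {l : T.X ⊗ Z ⟶ Z} {r : Z ⊗ T.X ⟶ Z} {F : Y ⊗ (S ⊗ T.X) ⟶ Z}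
    (h : IsSuspDer l r F) : IsDer l r ((α_ Y S T.X).hom ≫ F) := by
  have key : (Y ⊗ S) ◁ μ[T.X] ≫ (α_ Y S T.X).hom ≫ F =
      exch _ _ _ ≫ T.X ◁ (α_ Y S T.X).hom ≫ T.X ◁ F ≫ l +
        (α_ _ _ _).inv ≫ (α_ Y S T.X).hom ▷ T.X ≫ F ▷ T.X ≫ r := by
    refine pure_ext fun W => ?_
    intro y s t t'
    simp only [Preadditive.comp_add, ← Category.assoc, pair_whiskerLeft, pair_whiskerRight,
      pair_exch, pair_associator_hom, pair_associator_inv]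
    exact h y s t t'
  intro W z t t'
  simpa only [Preadditive.comp_add, ← Category.assoc, pair_whiskerLeft, pair_whiskerRight,
    pair_exch, pair_associator_inv] using congrArg ((z ⊠ t ⊠ t') ≫ ·) key

variable [HasCoequalizers C] [HasCoproductsOfShape ℕ C]
  [∀ X : C, PreservesColimitsOfShape (Discrete ℕ) (tensorLeft X)]
variable {A : Mon C} {M : Bimod A A} [IsTensorable M]

variable (M) in
/-- The inclusion `A ⊞ M ⟶ T_A(M)`. -/
noncomputable def freeAlgGen : A.X ⊞ M.X ⟶ (freeAlg M).X :=
  biprod.desc (freeAlgBase M) (freeAlgInr M)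

theorem inl_freeAlgGen : biprod.inl ≫ freeAlgGen M = freeAlgBase M := biprod.inl_desc _ _

theorem inr_freeAlgGen : biprod.inr ≫ freeAlgGen M = freeAlgInr M := biprod.inr_desc _ _

theorem comp_freeAlgGen (e : W.X ⟶ A.X ⊞ M.X) : e ≫ freeAlgGen M =
    (e ≫ biprod.fst) ≫ freeAlgBase M + (e ≫ biprod.snd) ≫ freeAlgInr M := by
  rw [freeAlgGen, biprod.desc_eq, Preadditive.comp_add, Category.assoc, Category.assoc]

theorem sqzLeft_freeAlgGen (a : W.X ⟶ A.X) (e : W.X ⟶ A.X ⊞ M.X) :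
    ((a ⊠ e) ≫ sqzLeft M) ≫ freeAlgGen M =
      (a ≫ freeAlgBase M ⊠ e ≫ freeAlgGen M) ≫ μ[(freeAlg M).X] := by
  rw [pair_sqzLeft, Preadditive.add_comp, Category.assoc _ biprod.inl, Category.assoc _ biprod.inr,
    inl_freeAlgGen, inr_freeAlgGen, mul_freeAlgBase, actLeft_freeAlgInr, comp_freeAlgGen, pair_add,
    Preadditive.add_comp]

theorem sqzRight_freeAlgGen (e : W.X ⟶ A.X ⊞ M.X) (a : W.X ⟶ A.X) :
    ((e ⊠ a) ≫ sqzRight M) ≫ freeAlgGen M =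
      (e ≫ freeAlgGen M ⊠ a ≫ freeAlgBase M) ≫ μ[(freeAlg M).X] := by
  rw [pair_sqzRight, Preadditive.add_comp, Category.assoc _ biprod.inl,
    Category.assoc _ biprod.inr, inl_freeAlgGen, inr_freeAlgGen, mul_freeAlgBase,
    actRight_freeAlgInr, comp_freeAlgGen, add_pair, Preadditive.add_comp]

variable {l : (freeAlg M).X ⊗ Z ⟶ Z} {r : Z ⊗ (freeAlg M).X ⟶ Z}

omit [SymmetricCategory C] [HasCoequalizers C] [HasCoproductsOfShape ℕ C]
  [∀ X : C, PreservesColimitsOfShape (Discrete ℕ) (tensorLeft X)] [IsTensorable M] in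
theorem whiskerLeft_biprod_hom_ext {X Y P Q : C} {g h : Y ⊗ (P ⊞ Q) ⟶ X}
    (h₁ : Y ◁ biprod.inl ≫ g = Y ◁ biprod.inl ≫ h)
    (h₂ : Y ◁ biprod.inr ≫ g = Y ◁ biprod.inr ≫ h) : g = h := by
  have tot : ∀ k : Y ⊗ (P ⊞ Q) ⟶ X, k = Y ◁ biprod.fst ≫ Y ◁ biprod.inl ≫ k +
      Y ◁ biprod.snd ≫ Y ◁ biprod.inr ≫ k := fun k => by
    rw [← whiskerLeft_comp_assoc, ← whiskerLeft_comp_assoc, ← Preadditive.add_comp,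
      ← MonoidalPreadditive.whiskerLeft_add, biprod.total, whiskerLeft_id, Category.id_comp]
  rw [tot g, tot h, h₁, h₂]

theorem IsDer.hom_ext_gen {D D' : Y ⊗ (freeAlg M).X ⟶ Z} (hD : IsDer l r D) (hD' : IsDer l r D')
    (h : Y ◁ freeAlgGen M ≫ D = Y ◁ freeAlgGen M ≫ D') : D = D' := by
  refine IsDer.hom_ext hD hD' ?_ ?_
  · rw [← inl_freeAlgGen, whiskerLeft_comp, Category.assoc, h, Category.assoc]
  · rw [← inr_freeAlgGen, whiskerLeft_comp, Category.assoc, h, Category.assoc]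

theorem IsSuspDer.hom_ext {F F' : Y ⊗ (S ⊗ (freeAlg M).X) ⟶ Z} (hF : IsSuspDer l r F)
    (hF' : IsSuspDer l r F')
    (h : Y ◁ S ◁ freeAlgGen M ≫ F = Y ◁ S ◁ freeAlgGen M ≫ F') : F = F' := by
  rw [← cancel_epi (α_ Y S _).hom]
  refine IsDer.hom_ext_gen hF.isDer hF'.isDer ?_
  rw [associator_naturality_right_assoc, h, associator_naturality_right_assoc]

variable {G : Y ⊗ (S ⊗ (A.X ⊞ M.X)) ⟶ Z}

/-- A morphism on `Y ⊗ Σ(A ⊞ M)` which extends to a derivation on `Y ⊗ ΣT_A(M)`. -/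
structure IsSuspDerData (l : (freeAlg M).X ⊗ Z ⟶ Z) (r : Z ⊗ (freeAlg M).X ⟶ Z)
    (G : Y ⊗ (S ⊗ (A.X ⊞ M.X)) ⟶ Z) : Prop where
  biaction : IsBiaction (freeAlg M) l r
  left : ∀ {W : CommComon C} (y : W.X ⟶ Y) (s : W.X ⟶ S) (a : W.X ⟶ A.X) (e : W.X ⟶ A.X ⊞ M.X),
    (y ⊠ s ⊠ (a ⊠ e) ≫ sqzLeft M) ≫ G = (a ≫ freeAlgBase M ⊠ (y ⊠ s ⊠ e) ≫ G) ≫ l +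
      ((y ⊠ s ⊠ a ≫ biprod.inl) ≫ G ⊠ e ≫ freeAlgGen M) ≫ r
  right : ∀ {W : CommComon C} (y : W.X ⟶ Y) (s : W.X ⟶ S) (e : W.X ⟶ A.X ⊞ M.X) (a : W.X ⟶ A.X),
    (y ⊠ s ⊠ (e ⊠ a) ≫ sqzRight M) ≫ G =
      (e ≫ freeAlgGen M ⊠ (y ⊠ s ⊠ a ≫ biprod.inl) ≫ G) ≫ l +
        ((y ⊠ s ⊠ e) ≫ G ⊠ a ≫ freeAlgBase M) ≫ r

/-- The suspension is absorbed in the parameters of the derivation. -/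
theorem IsSuspDerData.isDerData (h : IsSuspDerData l r G) : IsDerData l r
    ((Y ⊗ S) ◁ (biprod.inl : A.X ⟶ A.X ⊞ M.X) ≫ (α_ _ _ _).hom ≫ G)
    ((Y ⊗ S) ◁ (biprod.inr : M.X ⟶ A.X ⊞ M.X) ≫ (α_ _ _ _).hom ≫ G) := by
  have hl : (Y ⊗ S) ◁ sqzLeft M ≫ (α_ _ _ _).hom ≫ G =
      exch _ _ _ ≫ (freeAlgBase M ⊗ₘ ((α_ _ _ _).hom ≫ G)) ≫ l +
      (α_ _ _ _).inv ≫ (((Y ⊗ S) ◁ biprod.inl ≫ (α_ _ _ _).hom ≫ G) ⊗ₘ freeAlgGen M) ≫ r := by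
    refine pure_ext fun W => ?_
    intro y s a e
    simp only [Preadditive.comp_add, ← Category.assoc, pair_whiskerLeft, pair_exch,
      pair_associator_hom, pair_associator_inv, pair_tensorHom, h.left]
  have hr : (Y ⊗ S) ◁ sqzRight M ≫ (α_ _ _ _).hom ≫ G =
      exch _ _ _ ≫ (freeAlgGen M ⊗ₘ ((Y ⊗ S) ◁ biprod.inl ≫ (α_ _ _ _).hom ≫ G)) ≫ l +
      (α_ _ _ _).inv ≫ (((α_ _ _ _).hom ≫ G) ⊗ₘ freeAlgBase M) ≫ r := by
    refine pure_ext fun W => ?_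
    intro y s e a
    simp only [Preadditive.comp_add, ← Category.assoc, pair_whiskerLeft, pair_exch,
      pair_associator_hom, pair_associator_inv, pair_tensorHom, h.right]
  have hl' : ∀ {W : CommComon C} (z : W.X ⟶ Y ⊗ S) (a : W.X ⟶ A.X) (e : W.X ⟶ A.X ⊞ M.X),
      ((z ⊠ (a ⊠ e) ≫ sqzLeft M) ≫ (α_ _ _ _).hom) ≫ G =
        (a ≫ freeAlgBase M ⊠ ((z ⊠ e) ≫ (α_ _ _ _).hom) ≫ G) ≫ l +
        (((z ⊠ a ≫ biprod.inl) ≫ (α_ _ _ _).hom) ≫ G ⊠ e ≫ freeAlgGen M) ≫ r := by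
    intro W z a e
    simpa only [Preadditive.comp_add, ← Category.assoc, pair_whiskerLeft, pair_exch,
      pair_associator_inv, pair_tensorHom] using congrArg ((z ⊠ a ⊠ e) ≫ ·) hl
  have hr' : ∀ {W : CommComon C} (z : W.X ⟶ Y ⊗ S) (e : W.X ⟶ A.X ⊞ M.X) (a : W.X ⟶ A.X),
      ((z ⊠ (e ⊠ a) ≫ sqzRight M) ≫ (α_ _ _ _).hom) ≫ G =
        (e ≫ freeAlgGen M ⊠ ((z ⊠ a ≫ biprod.inl) ≫ (α_ _ _ _).hom) ≫ G) ≫ l +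
        (((z ⊠ e) ≫ (α_ _ _ _).hom) ≫ G ⊠ a ≫ freeAlgBase M) ≫ r := by
    intro W z e a
    simpa only [Preadditive.comp_add, ← Category.assoc, pair_whiskerLeft, pair_exch,
      pair_associator_inv, pair_tensorHom] using congrArg ((z ⊠ e ⊠ a) ≫ ·) hr
  have e1 : ∀ {W : CommComon C} (a b : W.X ⟶ A.X), ((a ⊠ b) ≫ μ[A.X]) ≫ biprod.inl =
      (a ⊠ b ≫ biprod.inl) ≫ sqzLeft M := by
    intro W a b
    simpa only [← Category.assoc, pair_whiskerLeft] using
      (congrArg ((a ⊠ b) ≫ ·) (inl_sqzLeft (M := M))).symm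
  have e2 : ∀ {W : CommComon C} (a : W.X ⟶ A.X) (m : W.X ⟶ M.X),
      ((a ⊠ m) ≫ M.actLeft) ≫ biprod.inr = (a ⊠ m ≫ biprod.inr) ≫ sqzLeft M := by
    intro W a m
    simpa only [← Category.assoc, pair_whiskerLeft] using
      (congrArg ((a ⊠ m) ≫ ·) (inr_sqzLeft (M := M))).symm
  have e3 : ∀ {W : CommComon C} (m : W.X ⟶ M.X) (a : W.X ⟶ A.X),
      ((m ⊠ a) ≫ M.actRight) ≫ biprod.inr = (m ≫ biprod.inr ⊠ a) ≫ sqzRight M := by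
    intro W m a
    simpa only [← Category.assoc, pair_whiskerRight] using
      (congrArg ((m ⊠ a) ≫ ·) (inr_sqzRight (M := M))).symm
  refine ⟨h.biaction, ?_, ?_, ?_⟩
  · intro W z a b
    simp only [← Category.assoc, pair_whiskerLeft, e1, hl']
    rw [Category.assoc b, inl_freeAlgGen]
  · intro W z a m
    simp only [← Category.assoc, pair_whiskerLeft, e2, hl']
    rw [Category.assoc m, inr_freeAlgGen]
  · intro W z m a
    simp only [← Category.assoc, pair_whiskerLeft, e3, hr']
    rw [Category.assoc m, inr_freeAlgGen]

/-- The extension of a morphism on `Y ⊗ Σ(A ⊞ M)` to a derivation on `Y ⊗ ΣT_A(M)`. -/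
noncomputable def suspExt (h : IsSuspDerData l r G) : Y ⊗ (S ⊗ (freeAlg M).X) ⟶ Z :=
  (α_ _ _ _).inv ≫ derExt h.isDerData

theorem isSuspDer_suspExt (h : IsSuspDerData l r G) : IsSuspDer l r (suspExt h) := by
  intro W y s t t'
  have hD : IsDer l r (derExt h.isDerData) := isDer_derExt _
  rw [suspExt]
  generalize derExt h.isDerData = D at hD
  simp only [← Category.assoc, pair_associator_inv]
  exact hD (y ⊠ s) t t'

theorem suspExt_gen (h : IsSuspDerData l r G) : Y ◁ S ◁ freeAlgGen M ≫ suspExt h = G := by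
  have hA := base_derExt h.isDerData
  have hM := gen_derExt h.isDerData
  rw [suspExt, associator_inv_naturality_right_assoc, ← cancel_epi (α_ _ _ _).hom,
    Iso.hom_inv_id_assoc]
  refine whiskerLeft_biprod_hom_ext ?_ ?_
  · refine Eq.trans ?_ hA
    rw [← whiskerLeft_comp_assoc, inl_freeAlgGen]
  · refine Eq.trans ?_ hM
    rw [← whiskerLeft_comp_assoc, inr_freeAlgGen]

theorem IsSuspDerData.gen_el (h : IsSuspDerData l r G) (y : W.X ⟶ Y) (s : W.X ⟶ S)
    (e : W.X ⟶ A.X ⊞ M.X) : (y ⊠ s ⊠ e ≫ freeAlgGen M) ≫ suspExt h = (y ⊠ s ⊠ e) ≫ G := by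
  simpa only [← Category.assoc, pair_whiskerLeft] using congrArg ((y ⊠ s ⊠ e) ≫ ·) (suspExt_gen h)

/-- A derivation rule in the first variable of brackets which are derivations in the second one
holds in general if it holds on generators: the internal structure commutes with the external
one. -/
theorem first_variable_rule {P Q R : C} {pr : P ⊗ R ⟶ Q} {jP : P ⟶ (freeAlg M).X}
    {jR : R ⟶ (freeAlg M).X}
    {F : (S ⊗ Q) ⊗ (S ⊗ (freeAlg M).X) ⟶ (S ⊗ (freeAlg M).X) ⊗ (freeAlg M).X}
    {FP : (S ⊗ P) ⊗ (S ⊗ (freeAlg M).X) ⟶ (S ⊗ (freeAlg M).X) ⊗ (freeAlg M).X}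
    {FR : (S ⊗ R) ⊗ (S ⊗ (freeAlg M).X) ⟶ (S ⊗ (freeAlg M).X) ⊗ (freeAlg M).X}
    (hF : IsExtDer F) (hP : IsExtDer FP) (hR : IsExtDer FR)
    (h : ∀ {W : CommComon C} (s : W.X ⟶ S) (p : W.X ⟶ P) (r : W.X ⟶ R) (s' : W.X ⟶ S)
      (e : W.X ⟶ A.X ⊞ M.X), ((s ⊠ (p ⊠ r) ≫ pr) ⊠ s' ⊠ e ≫ freeAlgGen M) ≫ F =
        (p ≫ jP ⊠ ((s ⊠ r) ⊠ s' ⊠ e ≫ freeAlgGen M) ≫ FR) ≫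
          intLeft S (freeAlg M).X μ[(freeAlg M).X] +
        (((s ⊠ p) ⊠ s' ⊠ e ≫ freeAlgGen M) ≫ FP ⊠ r ≫ jR) ≫
          intRight S μ[(freeAlg M).X] (freeAlg M).X)
    (s : W.X ⟶ S) (p : W.X ⟶ P) (r : W.X ⟶ R) (z : W.X ⟶ S ⊗ (freeAlg M).X) :
    ((s ⊠ (p ⊠ r) ≫ pr) ⊠ z) ≫ F =
      (p ≫ jP ⊠ ((s ⊠ r) ⊠ z) ≫ FR) ≫ intLeft S (freeAlg M).X μ[(freeAlg M).X] +
        (((s ⊠ p) ⊠ z) ≫ FP ⊠ r ≫ jR) ≫ intRight S μ[(freeAlg M).X] (freeAlg M).X := by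
  have hT : μ[(freeAlg M).X] ▷ (freeAlg M).X ≫ μ[(freeAlg M).X] =
      (α_ _ _ _).hom ≫ (freeAlg M).X ◁ μ[(freeAlg M).X] ≫ μ[(freeAlg M).X] := MonObj.mul_assoc _
  -- both sides are derivations in the second variable
  have key : (S ◁ pr) ▷ (S ⊗ (freeAlg M).X) ≫ F =
      pullLeft₁ S P R (S ⊗ (freeAlg M).X) ≫ (jP ⊗ₘ FR) ≫
        intLeft S (freeAlg M).X μ[(freeAlg M).X] +
      pullRight₁ S P R (S ⊗ (freeAlg M).X) ≫ (FP ⊗ₘ jR) ≫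
        intRight S μ[(freeAlg M).X] (freeAlg M).X := by
    refine IsSuspDer.hom_ext (l := extLeft S μ[(freeAlg M).X] (freeAlg M).X)
      (r := extRight S (freeAlg M).X μ[(freeAlg M).X]) ?_ ?_ ?_
    · refine IsSuspDer.of_hom (pure_ext fun W => ?_)
      intro s p r s' t t'
      simp only [Preadditive.comp_add, ← Category.assoc, pair_whiskerLeft, pair_whiskerRight,
        pair_pullLeft₂, pair_pullRight₂]
      exact hF _ _ _ _
    · refine IsSuspDer.of_hom (pure_ext fun W => ?_)
      intro s p r s' t t'
      simp only [Preadditive.comp_add, ← Category.assoc, pair_whiskerLeft, pair_whiskerRight,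
        pair_pullLeft₂, pair_pullRight₂, pair_pullLeft₁, pair_pullRight₁, pair_tensorHom]
      rw [hP, hR]
      simp only [pair_add, add_pair, Preadditive.add_comp, extLeft_intLeft,
        extLeft_intRight _ _ _ _ hT, extRight_intLeft _ _ _ hT, extRight_intRight]
      abel
    · refine pure_ext fun W => ?_
      intro s p r s' e
      simp only [Preadditive.comp_add, ← Category.assoc, pair_whiskerLeft, pair_whiskerRight,
        pair_pullLeft₁, pair_pullRight₁, pair_tensorHom, h]
  simpa only [Preadditive.comp_add, ← Category.assoc, pair_whiskerLeft, pair_whiskerRight,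
    pair_pullLeft₁, pair_pullRight₁, pair_tensorHom] using congrArg (((s ⊠ p ⊠ r) ⊠ z) ≫ ·) key

end SuspendedDerivations

end DoubleAlgebra

/-! ### Extension of antisymmetric brackets to the free algebra -/

namespace DoubleAlgebra

section FreeBracket

variable {C : Type u} [Category.{v} C] [MonoidalCategory C] [SymmetricCategory C]
  [Preadditive C] [MonoidalPreadditive C] [HasBinaryBiproducts C]
variable {W : CommComon C} {S : C}

theorem IsSuspDer.precomp {T : Mon C} {Y Y' Z : C} {l : T.X ⊗ Z ⟶ Z} {r : Z ⊗ T.X ⟶ Z}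
    {F : Y ⊗ (S ⊗ T.X) ⟶ Z} (h : IsSuspDer l r F) (g : Y' ⟶ Y) :
    IsSuspDer l r (g ▷ (S ⊗ T.X) ≫ F) := by
  intro W y s t t'
  simp only [← Category.assoc, pair_whiskerRight]
  exact h (y ≫ g) s t t'

variable [HasCoequalizers C] [HasCoproductsOfShape ℕ C]
  [∀ X : C, PreservesColimitsOfShape (Discrete ℕ) (tensorLeft X)]
variable {A : Mon C} {M : Bimod A A} [IsTensorable M]

/-- An antisymmetric bracket on `A ⊞ M` with values in `T_A(M)`, which extends to a derivation in
the second variable. -/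
structure IsGenBracket
    (G : (S ⊗ (A.X ⊞ M.X)) ⊗ (S ⊗ (A.X ⊞ M.X)) ⟶ (S ⊗ (freeAlg M).X) ⊗ (freeAlg M).X) : Prop where
  antisymm : ∀ {W : CommComon C} (x y : W.X ⟶ S ⊗ (A.X ⊞ M.X)),
    (x ⊠ y) ≫ G = -(((y ⊠ x) ≫ G) ≫ sigmaTau S _ _)
  data : IsSuspDerData (extLeft S μ[(freeAlg M).X] (freeAlg M).X)
    (extRight S (freeAlg M).X μ[(freeAlg M).X]) G

namespace IsGenBracket

variable {G : (S ⊗ (A.X ⊞ M.X)) ⊗ (S ⊗ (A.X ⊞ M.X)) ⟶ (S ⊗ (freeAlg M).X) ⊗ (freeAlg M).X}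
  (h : IsGenBracket G)

/-- The extension of a bracket on generators in its second variable. -/
noncomputable def ext₁ (h : IsGenBracket G) :
    (S ⊗ (A.X ⊞ M.X)) ⊗ (S ⊗ (freeAlg M).X) ⟶ (S ⊗ (freeAlg M).X) ⊗ (freeAlg M).X :=
  suspExt h.data

include h

theorem isExtDer_ext₁ : IsExtDer h.ext₁ := isSuspDer_suspExt h.data

theorem ext₁_gen (x : W.X ⟶ S ⊗ (A.X ⊞ M.X)) (s : W.X ⟶ S) (e : W.X ⟶ A.X ⊞ M.X) :
    (x ⊠ s ⊠ e ≫ freeAlgGen M) ≫ h.ext₁ = (x ⊠ s ⊠ e) ≫ G := h.data.gen_el x s e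

theorem ext₁_sqzLeft (s : W.X ⟶ S) (a : W.X ⟶ A.X) (e : W.X ⟶ A.X ⊞ M.X)
    (z : W.X ⟶ S ⊗ (freeAlg M).X) : ((s ⊠ (a ⊠ e) ≫ sqzLeft M) ⊠ z) ≫ h.ext₁ =
      (a ≫ freeAlgBase M ⊠ ((s ⊠ e) ⊠ z) ≫ h.ext₁) ≫
          intLeft S (freeAlg M).X μ[(freeAlg M).X] +
        (((s ⊠ a ≫ biprod.inl) ⊠ z) ≫ h.ext₁ ⊠ e ≫ freeAlgGen M) ≫
          intRight S μ[(freeAlg M).X] (freeAlg M).X := by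
  have := first_variable_rule (pr := sqzLeft M) (jP := freeAlgBase M) (jR := freeAlgGen M)
    h.isExtDer_ext₁ (IsSuspDer.precomp h.isExtDer_ext₁ (S ◁ biprod.inl)) h.isExtDer_ext₁
    (fun s a e s' e' => by
      simp only [← Category.assoc, pair_whiskerRight, pair_whiskerLeft, h.ext₁_gen]
      rw [h.antisymm, h.antisymm (s ⊠ e), h.antisymm (s ⊠ a ≫ biprod.inl), h.data.left]
      simp only [Preadditive.add_comp, pair_neg, neg_pair, Preadditive.neg_comp, extLeft_sigmaTau,
        extRight_sigmaTau]
      abel) s a e z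
  simpa only [← Category.assoc, pair_whiskerRight, pair_whiskerLeft] using this

theorem ext₁_sqzRight (s : W.X ⟶ S) (e : W.X ⟶ A.X ⊞ M.X) (a : W.X ⟶ A.X)
    (z : W.X ⟶ S ⊗ (freeAlg M).X) : ((s ⊠ (e ⊠ a) ≫ sqzRight M) ⊠ z) ≫ h.ext₁ =
      (e ≫ freeAlgGen M ⊠ ((s ⊠ a ≫ biprod.inl) ⊠ z) ≫ h.ext₁) ≫
          intLeft S (freeAlg M).X μ[(freeAlg M).X] +
        (((s ⊠ e) ⊠ z) ≫ h.ext₁ ⊠ a ≫ freeAlgBase M) ≫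
          intRight S μ[(freeAlg M).X] (freeAlg M).X := by
  have := first_variable_rule (pr := sqzRight M) (jP := freeAlgGen M) (jR := freeAlgBase M)
    h.isExtDer_ext₁ h.isExtDer_ext₁ (IsSuspDer.precomp h.isExtDer_ext₁ (S ◁ biprod.inl))
    (fun s e a s' e' => by
      simp only [← Category.assoc, pair_whiskerRight, pair_whiskerLeft, h.ext₁_gen]
      rw [h.antisymm, h.antisymm (s ⊠ e), h.antisymm (s ⊠ a ≫ biprod.inl), h.data.right]
      simp only [Preadditive.add_comp, pair_neg, neg_pair, Preadditive.neg_comp, extLeft_sigmaTau,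
        extRight_sigmaTau]
      abel) s e a z
  simpa only [← Category.assoc, pair_whiskerRight, pair_whiskerLeft] using this

omit h in
/-- The values of the bracket of `T_A(M)` for the second variable in `A ⊞ M`. -/
noncomputable def gen₂ (h : IsGenBracket G) :
    (S ⊗ (freeAlg M).X) ⊗ (S ⊗ (A.X ⊞ M.X)) ⟶ (S ⊗ (freeAlg M).X) ⊗ (freeAlg M).X :=
  -((β_ _ _).hom ≫ h.ext₁ ≫ sigmaTau S _ _)

theorem pair_gen₂ (z : W.X ⟶ S ⊗ (freeAlg M).X) (x : W.X ⟶ S ⊗ (A.X ⊞ M.X)) :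
    (z ⊠ x) ≫ h.gen₂ = -(((x ⊠ z) ≫ h.ext₁) ≫ sigmaTau S _ _) := by
  simp only [gen₂, Preadditive.comp_neg, ← Category.assoc, pair_braiding_hom]

theorem data₂ : IsSuspDerData (extLeft S μ[(freeAlg M).X] (freeAlg M).X)
    (extRight S (freeAlg M).X μ[(freeAlg M).X]) h.gen₂ where
  biaction := h.data.biaction
  left y s a e := by
    simp only [h.pair_gen₂, h.ext₁_sqzLeft, Preadditive.add_comp, intLeft_sigmaTau,
      intRight_sigmaTau, pair_neg, neg_pair, Preadditive.neg_comp]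
    abel
  right y s e a := by
    simp only [h.pair_gen₂, h.ext₁_sqzRight, Preadditive.add_comp, intLeft_sigmaTau,
      intRight_sigmaTau, pair_neg, neg_pair, Preadditive.neg_comp]
    abel

omit h in
/-- The extension of a bracket on generators to `T_A(M)`. -/
noncomputable def bracket (h : IsGenBracket G) :
    (S ⊗ (freeAlg M).X) ⊗ (S ⊗ (freeAlg M).X) ⟶ (S ⊗ (freeAlg M).X) ⊗ (freeAlg M).X :=
  suspExt h.data₂

theorem isExtDer_bracket : IsExtDer h.bracket := isSuspDer_suspExt h.data₂

theorem bracket_gen (z : W.X ⟶ S ⊗ (freeAlg M).X) (s : W.X ⟶ S) (e : W.X ⟶ A.X ⊞ M.X) :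
    (z ⊠ s ⊠ e ≫ freeAlgGen M) ≫ h.bracket =
      -((((s ⊠ e) ⊠ z) ≫ h.ext₁) ≫ sigmaTau S _ _) :=
  (h.data₂.gen_el z s e).trans (h.pair_gen₂ _ _)

theorem bracket_left (s : W.X ⟶ S) (t t' : W.X ⟶ (freeAlg M).X) (z : W.X ⟶ S ⊗ (freeAlg M).X) :
    ((s ⊠ (t ⊠ t') ≫ μ[(freeAlg M).X]) ⊠ z) ≫ h.bracket =
      (t ⊠ ((s ⊠ t') ⊠ z) ≫ h.bracket) ≫ intLeft S (freeAlg M).X μ[(freeAlg M).X] +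
        (((s ⊠ t) ⊠ z) ≫ h.bracket ⊠ t') ≫ intRight S μ[(freeAlg M).X] (freeAlg M).X := by
  have := first_variable_rule (pr := μ[(freeAlg M).X]) (jP := 𝟙 _) (jR := 𝟙 _)
    h.isExtDer_bracket h.isExtDer_bracket h.isExtDer_bracket
    (fun s t t' s' e => by
      rw [h.bracket_gen, h.bracket_gen, h.bracket_gen, h.isExtDer_ext₁]
      simp only [Preadditive.add_comp, pair_neg, neg_pair, Preadditive.neg_comp, extLeft_sigmaTau,
        extRight_sigmaTau, Category.comp_id]
      abel) s t t' z
  simpa only [Category.comp_id] using this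

theorem gen_bracket : (S ◁ freeAlgGen M) ▷ (S ⊗ (freeAlg M).X) ≫ h.bracket = h.ext₁ := by
  refine IsSuspDer.hom_ext (IsSuspDer.precomp h.isExtDer_bracket _) h.isExtDer_ext₁
    (pure_ext fun W => ?_)
  intro s e s' e'
  simp only [← Category.assoc, pair_whiskerLeft, pair_whiskerRight, h.bracket_gen, h.ext₁_gen]
  exact (h.antisymm _ _).symm

theorem gen_bracket_gen : (S ◁ freeAlgGen M ⊗ₘ S ◁ freeAlgGen M) ≫ h.bracket = G := by
  refine pure_ext fun W => ?_
  intro s e s' e'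
  have h1 := congrArg (((s ⊠ e) ⊠ s' ⊠ e' ≫ freeAlgGen M) ≫ ·) h.gen_bracket
  simpa only [← Category.assoc, pair_whiskerLeft, pair_whiskerRight, pair_tensorHom,
    h.ext₁_gen] using h1

theorem bracket_antisymm :
    h.bracket = -((β_ _ _).hom ≫ h.bracket ≫ sigmaTau S _ _) := by
  refine IsSuspDer.hom_ext h.isExtDer_bracket ?_ (pure_ext fun W => ?_)
  · intro W y s t t'
    simp only [Preadditive.comp_neg, ← Category.assoc, pair_braiding_hom, h.bracket_left,
      Preadditive.add_comp, intLeft_sigmaTau, intRight_sigmaTau, pair_neg, neg_pair,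
      Preadditive.neg_comp]
    abel
  · intro s t s' e
    have h1 := congrArg (((s' ⊠ e) ⊠ s ⊠ t) ≫ ·) h.gen_bracket
    simp only [← Category.assoc, pair_whiskerLeft, pair_whiskerRight] at h1
    simp only [Preadditive.comp_neg, ← Category.assoc, pair_whiskerLeft, pair_braiding_hom,
      h.bracket_gen, h1]

theorem bracket_antisymm_el (x y : W.X ⟶ S ⊗ (freeAlg M).X) :
    (x ⊠ y) ≫ h.bracket = -(((y ⊠ x) ≫ h.bracket) ≫ sigmaTau S _ _) := by
  have h1 := congrArg ((x ⊠ y) ≫ ·) h.bracket_antisymm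
  simpa only [Preadditive.comp_neg, ← Category.assoc, pair_braiding_hom] using h1

end IsGenBracket

section Jacobi

variable {X : C}

omit [HasCoequalizers C] [HasCoproductsOfShape ℕ C]
  [∀ X : C, PreservesColimitsOfShape (Discrete ℕ) (tensorLeft X)] in
/-- The Jacobi identity passes to the image of a morphism of brackets. -/
theorem jacobiOn_image {E : C} {F : (S ⊗ X) ⊗ (S ⊗ X) ⟶ (S ⊗ X) ⊗ X}
    {F₀ : (S ⊗ E) ⊗ (S ⊗ E) ⟶ (S ⊗ E) ⊗ E} {i : E ⟶ X}
    (hi : (S ◁ i ⊗ₘ S ◁ i) ≫ F = F₀ ≫ (S ◁ i ⊗ₘ i)) (hJ : jacobiator F₀ = 0) :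
    JacobiOn F (S ◁ i) (S ◁ i) (S ◁ i) := by
  have el : ∀ {W : CommComon C} (x y : W.X ⟶ S ⊗ E),
      (x ≫ S ◁ i ⊠ y ≫ S ◁ i) ≫ F = ((x ⊠ y) ≫ F₀) ≫ (S ◁ i ⊗ₘ i) := by
    intro W x y
    simpa only [← Category.assoc, pair_tensorHom] using congrArg ((x ⊠ y) ≫ ·) hi
  refine pure_ext fun W => ?_
  intro s a t b r c
  have h := congrArg (fun k => (((s ⊠ a) ⊠ (t ⊠ b) ⊠ (r ⊠ c)) ≫ k) ≫ ((S ◁ i ⊗ₘ i) ⊗ₘ i)) hJ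
  simp only [← Category.assoc, pair_jacobiator, pair_nest, pair_tensorHom, el, outer_map hi,
    whiskerRight_split, sigmaRotL_map, sigmaRotR_map, Preadditive.add_comp, comp_zero,
    Limits.zero_comp] at h ⊢
  exact h

variable [(tensorLeft S).Full] [(tensorLeft S).Faithful]

/-- If the Jacobiator vanishes when the third variable is a generator, it vanishes. -/
theorem jacobiOn_free {U V : C}
    {F : (S ⊗ (freeAlg M).X) ⊗ (S ⊗ (freeAlg M).X) ⟶ (S ⊗ (freeAlg M).X) ⊗ (freeAlg M).X}
    (hs : ∀ {W : CommComon C} (x y : W.X ⟶ S ⊗ (freeAlg M).X),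
      (x ⊠ y) ≫ F = -(((y ⊠ x) ≫ F) ≫ sigmaTau S _ _))
    (hF : IsExtDer F) {u : U ⟶ S ⊗ (freeAlg M).X} {v : V ⟶ S ⊗ (freeAlg M).X}
    (h : JacobiOn F u v (S ◁ freeAlgGen M)) : JacobiOn F u v (𝟙 _) := by
  have hmul := fun {W : CommComon C} => desusp_mul (W := W) (pr := μ[(freeAlg M).X]) (FP := F)
    (FQ := F) (F := F) (fun y s p q => hF y s p q)
  have hgen : (u ⊗ₘ (v ⊗ₘ freeAlgGen M)) ≫ jacDer F (desusp F) (desusp F) = 0 := by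
    refine pure_ext fun W => ?_
    intro x y e
    simp only [← Category.assoc, pair_tensorHom, comp_zero, h.jacDer_eq_zero hs]
  apply jacobiOn_of_jacDer hs
  -- `jacDer` is a derivation of `T_A(M)` in its third variable, so it vanishes with its values on
  -- generators
  let D := (u ⊗ₘ (v ⊗ₘ 𝟙 (freeAlg M).X)) ≫ jacDer F (desusp F) (desusp F)
  let l := outLeft μ[(freeAlg M).X] ((freeAlg M).X ⊗ (freeAlg M).X)
  let r : ((freeAlg M).X ⊗ ((freeAlg M).X ⊗ (freeAlg M).X)) ⊗ (freeAlg M).X ⟶ _ :=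
    (α_ _ _ _).hom ≫ (freeAlg M).X ◁ outRight (freeAlg M).X μ[(freeAlg M).X]
  have key : (U ⊗ V) ◁ μ[(freeAlg M).X] ≫ (α_ _ _ _).hom ≫ D =
      exch _ _ _ ≫ (freeAlg M).X ◁ (α_ _ _ _).hom ≫ (freeAlg M).X ◁ D ≫ l +
        (α_ _ _ _).inv ≫ (α_ _ _ _).hom ▷ _ ≫ D ▷ _ ≫ r := by
    refine pure_ext fun W => ?_
    intro x y t t'
    simp only [D, l, r, Preadditive.comp_add, ← Category.assoc, pair_whiskerLeft, pair_exch,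
      pair_whiskerRight, pair_associator_hom, pair_associator_inv, pair_tensorHom,
      Category.comp_id]
    exact jacDer_mul _ hmul _ _ _ _
  have hD : IsDer l r ((α_ U V (freeAlg M).X).hom ≫ D) := by
    intro W z t t'
    simpa only [Preadditive.comp_add, ← Category.assoc, pair_whiskerLeft, pair_whiskerRight,
      pair_exch, pair_associator_inv] using congrArg ((z ⊠ t ⊠ t') ≫ ·) key
  have h0 : IsDer l r (0 : (U ⊗ V) ⊗ (freeAlg M).X ⟶ _) := by
    intro W z t t'
    simp only [comp_zero, pair_zero, zero_pair, Limits.zero_comp, add_zero]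
  have hz : (α_ U V (freeAlg M).X).hom ≫ D = 0 := by
    refine IsDer.hom_ext_gen hD h0 (pure_ext fun W => ?_)
    intro x y e
    have h1 := congrArg ((x ⊠ y ⊠ e) ≫ ·) hgen
    simpa only [D, ← Category.assoc, pair_whiskerLeft, pair_associator_hom, pair_tensorHom,
      Category.comp_id, comp_zero] using h1
  rw [← cancel_epi (α_ U V (freeAlg M).X).hom, comp_zero]
  exact hz

end Jacobi

end FreeBracket

end DoubleAlgebra

/-! ### The linear double Poisson bracket of the free algebra -/

namespace DoubleAlgebra

section Linear

variable {C : Type u} [Category.{v} C] [MonoidalCategory C] [SymmetricCategory C]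
  [Preadditive C] [MonoidalPreadditive C] [HasBinaryBiproducts C]
variable {W : CommComon C} {S : C}

variable [HasCoequalizers C] [HasCoproductsOfShape ℕ C]
  [∀ X : C, PreservesColimitsOfShape (Discrete ℕ) (tensorLeft X)]
variable {A : Mon C} {M : Bimod A A} [IsTensorable M]
  {ρ : (S ⊗ M.X) ⊗ (S ⊗ A.X) ⟶ (S ⊗ A.X) ⊗ A.X}
  {B : (S ⊗ M.X) ⊗ (S ⊗ M.X) ⟶ S ⊗ ((M.X ⊗ A.X) ⊞ (A.X ⊗ M.X))}
  {F F' : (S ⊗ (freeAlg M).X) ⊗ (S ⊗ (freeAlg M).X) ⟶ (S ⊗ (freeAlg M).X) ⊗ (freeAlg M).X}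

theorem sqzLeft_gen :
    (freeAlgBase M ⊗ₘ freeAlgGen M) ≫ μ[(freeAlg M).X] = sqzLeft M ≫ freeAlgGen M := by
  refine pure_ext fun W => ?_
  intro a e
  simp only [← Category.assoc, pair_tensorHom, sqzLeft_freeAlgGen]

theorem sqzRight_gen :
    (freeAlgGen M ⊗ₘ freeAlgBase M) ≫ μ[(freeAlg M).X] = sqzRight M ≫ freeAlgGen M := by
  refine pure_ext fun W => ?_
  intro e a
  simp only [← Category.assoc, pair_tensorHom, sqzRight_freeAlgGen]

theorem sqzBracket_inl_gen (x : W.X ⟶ S ⊗ (A.X ⊞ M.X)) (s : W.X ⟶ S) (a : W.X ⟶ A.X) :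
    ((x ⊠ s ⊠ a ≫ biprod.inl) ≫ sqzBracket ρ B) ≫ (S ◁ freeAlgGen M ⊗ₘ freeAlgGen M) =
      ((x ⊠ s ⊠ a) ≫ sqzBase ρ) ≫ (S ◁ freeAlgBase M ⊗ₘ freeAlgBase M) := by
  rw [← pair_whiskerLeft, sqzBracket_inl, Category.assoc, tensorHom_comp_tensorHom,
    ← whiskerLeft_comp, inl_freeAlgGen]

theorem isGenBracket_sqzBracket (ha : IsAnchor S ρ) (hs : IsAntisymm S B)
    (hd : IsAnchorDerivation S ρ B) :
    IsGenBracket (sqzBracket ρ B ≫ (S ◁ freeAlgGen M ⊗ₘ freeAlgGen M)) where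
  antisymm x y := by
    rw [← Category.assoc, sqzBracket_antisymm hs, Preadditive.neg_comp, sigmaTau_map,
      Category.assoc (_ ⊠ _)]
  data :=
    { biaction := isBiaction_ext S (isBiaction_mul (freeAlg M)) (isBiaction_mul (freeAlg M))
      left := fun y s a e => by
        simp only [← Category.assoc, sqzBracket_inl_gen]
        rw [sqzBracket_left ha hd, Preadditive.add_comp, ← extLeft_tensorHom _ _ sqzLeft_gen,
          ← extRight_tensorHom _ _ sqzLeft_gen, Category.assoc _ ((S ◁ biprod.inl) ▷ _),
          ← tensorHom_id, tensorHom_comp_tensorHom, ← whiskerLeft_comp, inl_freeAlgGen,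
          Category.id_comp]
      right := fun y s e a => by
        simp only [← Category.assoc, sqzBracket_inl_gen]
        rw [sqzBracket_right ha hd, Preadditive.add_comp, ← extLeft_tensorHom _ _ sqzRight_gen,
          ← extRight_tensorHom _ _ sqzRight_gen, Category.assoc _ (_ ◁ biprod.inl),
          ← id_tensorHom, tensorHom_comp_tensorHom, inl_freeAlgGen, Category.id_comp] }

/-- The restriction to `A ⊞ M` of a linear bracket. -/
theorem gen_of_linear (hs : ∀ {W : CommComon C} (x y : W.X ⟶ S ⊗ (freeAlg M).X),
      (x ⊠ y) ≫ F = -(((y ⊠ x) ≫ F) ≫ sigmaTau S _ _))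
    (h0 : (S ◁ freeAlgBase M ⊗ₘ S ◁ freeAlgBase M) ≫ F = 0) (hρ : RestrictsToAnchor S F ρ)
    (hB : RestrictsToBracket S F B) : (S ◁ freeAlgGen M ⊗ₘ S ◁ freeAlgGen M) ≫ F =
      sqzBracket ρ B ≫ (S ◁ freeAlgGen M ⊗ₘ freeAlgGen M) := by
  have k0 : ∀ {W : CommComon C} (s : W.X ⟶ S) (a : W.X ⟶ A.X) (s' : W.X ⟶ S) (a' : W.X ⟶ A.X),
      ((s ⊠ a ≫ freeAlgBase M) ⊠ s' ⊠ a' ≫ freeAlgBase M) ≫ F = 0 := by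
    intro W s a s' a'
    simpa only [← Category.assoc, pair_tensorHom, pair_whiskerLeft, comp_zero] using
      congrArg (((s ⊠ a) ⊠ s' ⊠ a') ≫ ·) h0
  have k1 : ∀ {W : CommComon C} (s : W.X ⟶ S) (m : W.X ⟶ M.X) (s' : W.X ⟶ S) (a' : W.X ⟶ A.X),
      ((s ⊠ m ≫ freeAlgInr M) ⊠ s' ⊠ a' ≫ freeAlgBase M) ≫ F =
        (((s ⊠ m) ⊠ s' ⊠ a') ≫ ρ) ≫ (S ◁ freeAlgBase M ⊗ₘ freeAlgBase M) := by
    intro W s m s' a'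
    simpa only [← Category.assoc, pair_tensorHom, pair_whiskerLeft] using
      congrArg (((s ⊠ m) ⊠ s' ⊠ a') ≫ ·) hρ
  have k2 : ∀ {W : CommComon C} (s : W.X ⟶ S) (m : W.X ⟶ M.X) (s' : W.X ⟶ S) (m' : W.X ⟶ M.X),
      ((s ⊠ m ≫ freeAlgInr M) ⊠ s' ⊠ m' ≫ freeAlgInr M) ≫ F =
        (((s ⊠ m) ⊠ s' ⊠ m') ≫ compL B) ≫ (S ◁ freeAlgInr M ⊗ₘ freeAlgBase M) +
        (((s ⊠ m) ⊠ s' ⊠ m') ≫ compR B) ≫ (S ◁ freeAlgBase M ⊗ₘ freeAlgInr M) := by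
    intro W s m s' m'
    simpa only [← Category.assoc, Preadditive.comp_add, pair_tensorHom, pair_whiskerLeft] using
      congrArg (((s ⊠ m) ⊠ s' ⊠ m') ≫ ·) hB
  refine pure_ext fun W => ?_
  intro s e s' e'
  have k3 := hs (s ⊠ (e ≫ biprod.fst) ≫ freeAlgBase M) (s' ⊠ (e' ≫ biprod.snd) ≫ freeAlgInr M)
  rw [k1, ← sigmaTau_map] at k3
  simp only [← Category.assoc, pair_tensorHom, pair_whiskerLeft]
  rw [comp_freeAlgGen e, comp_freeAlgGen e']
  simp only [pair_add, add_pair, Preadditive.add_comp, k0, k1, k2, k3, pair_sqzBracket,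
    pair_whiskerLeft, pair_anchorTau, Preadditive.neg_comp]
  simp only [Category.assoc, tensorHom_comp_tensorHom, ← whiskerLeft_comp, inl_freeAlgGen,
    inr_freeAlgGen]
  abel

/-- Double Poisson brackets on `T_A(M)` which agree on `A ⊞ M` are equal. -/
theorem IsDoublePoisson.eq_of_gen (hF : IsDoublePoisson S (freeAlg M) F)
    (hF' : IsDoublePoisson S (freeAlg M) F')
    (h : (S ◁ freeAlgGen M ⊗ₘ S ◁ freeAlgGen M) ≫ F =
      (S ◁ freeAlgGen M ⊗ₘ S ◁ freeAlgGen M) ≫ F') : F = F' := by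
  have d : IsExtDer F := fun x s a b => hF.right_el x s a b
  have d' : IsExtDer F' := fun x s a b => hF'.right_el x s a b
  have h1 : (S ◁ freeAlgGen M) ▷ (S ⊗ (freeAlg M).X) ≫ F =
      (S ◁ freeAlgGen M) ▷ (S ⊗ (freeAlg M).X) ≫ F' := by
    refine IsSuspDer.hom_ext (IsSuspDer.precomp d _) (IsSuspDer.precomp d' _) ?_
    simpa only [MonoidalCategory.tensorHom_def', Category.assoc] using h
  refine IsSuspDer.hom_ext d d' (pure_ext fun W => ?_)
  intro s t s' e
  have h2 := congrArg (((s' ⊠ e) ⊠ s ⊠ t) ≫ ·) h1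
  simp only [← Category.assoc, pair_whiskerLeft, pair_whiskerRight] at h2 ⊢
  rw [hF.antisymm_el, h2, ← hF'.antisymm_el]

theorem isDoublePoisson_bracket [(tensorLeft S).Full] [(tensorLeft S).Faithful]
    {F₀ : (S ⊗ (A.X ⊞ M.X)) ⊗ (S ⊗ (A.X ⊞ M.X)) ⟶ (S ⊗ (A.X ⊞ M.X)) ⊗ (A.X ⊞ M.X)}
    (h : IsGenBracket (F₀ ≫ (S ◁ freeAlgGen M ⊗ₘ freeAlgGen M))) (hJ : jacobiator F₀ = 0) :
    IsDoublePoisson S (freeAlg M) h.bracket where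
  antisymm := h.bracket_antisymm
  left_derivation := by
    refine pure_ext fun W => ?_
    intro s t t' s' u
    simp only [Preadditive.comp_add, ← Category.assoc, pair_whiskerLeft, pair_whiskerRight,
      pair_pullLeft₁, pair_pullRight₁, h.bracket_left]
  jacobi := by
    have cl : ∀ {U V : C} {u : U ⟶ S ⊗ (freeAlg M).X} {v : V ⟶ S ⊗ (freeAlg M).X},
        JacobiOn h.bracket u v (S ◁ freeAlgGen M) → JacobiOn h.bracket u v (𝟙 _) :=
      jacobiOn_free h.bracket_antisymm_el h.isExtDer_bracket
    have h0 := jacobiOn_image h.gen_bracket_gen hJ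
    have h1 := cl (cl (cl h0).rotate.rotate).rotate.rotate
    change jacobiator h.bracket = 0
    simpa only [JacobiOn, id_tensorHom, whiskerLeft_id, Category.id_comp] using h1

/-- A bracket on `A ⊞ M` which satisfies the Jacobi identity extends uniquely to a linear double
Poisson bracket on `T_A(M)`. -/
theorem existsUnique_linear_bracket [(tensorLeft S).Full] [(tensorLeft S).Faithful]
    (ha : IsAnchor S ρ) (hs : IsAntisymm S B) (hd : IsAnchorDerivation S ρ B)
    (hJ : jacobiator (sqzBracket ρ B) = 0) :
    ∃! F : (S ⊗ (freeAlg M).X) ⊗ (S ⊗ (freeAlg M).X) ⟶ (S ⊗ (freeAlg M).X) ⊗ (freeAlg M).X,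
      IsDoublePoisson S (freeAlg M) F ∧ IsLinear S F ∧ RestrictsToAnchor S F ρ ∧
        RestrictsToBracket S F B := by
  have h := isGenBracket_sqzBracket ha hs hd
  have hg : ∀ {P Q : C} (u : P ⟶ A.X ⊞ M.X) (v : Q ⟶ A.X ⊞ M.X),
      (S ◁ (u ≫ freeAlgGen M) ⊗ₘ S ◁ (v ≫ freeAlgGen M)) ≫ h.bracket =
        ((S ◁ u ⊗ₘ S ◁ v) ≫ sqzBracket ρ B) ≫ (S ◁ freeAlgGen M ⊗ₘ freeAlgGen M) := by
    intro P Q u v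
    rw [whiskerLeft_comp, whiskerLeft_comp, ← tensorHom_comp_tensorHom, Category.assoc,
      h.gen_bracket_gen, Category.assoc]
  have h0 := hg biprod.inl biprod.inl
  have h1 := hg biprod.inr biprod.inl
  have h2 := hg biprod.inr biprod.inr
  rw [inl_inl_sqzBracket, Limits.zero_comp, inl_freeAlgGen] at h0
  rw [inr_inl_sqzBracket, Category.assoc, tensorHom_comp_tensorHom, ← whiskerLeft_comp,
    inl_freeAlgGen, inr_freeAlgGen] at h1
  rw [inr_inr_sqzBracket, Preadditive.add_comp, Category.assoc, Category.assoc,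
    tensorHom_comp_tensorHom, tensorHom_comp_tensorHom, ← whiskerLeft_comp, ← whiskerLeft_comp,
    inl_freeAlgGen, inr_freeAlgGen] at h2
  have hP := isDoublePoisson_bracket h hJ
  refine ⟨h.bracket, ⟨hP, ⟨h0, ⟨ρ, h1⟩, ⟨B, h2⟩⟩, h1, h2⟩, ?_⟩
  rintro F ⟨hF, hlin, hFρ, hFB⟩
  refine hF.eq_of_gen hP ?_
  rw [gen_of_linear (fun x y => hF.antisymm_el x y) hlin.restrict_base hFρ hFB, h.gen_bracket_gen]

end Linear

end DoubleAlgebra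

theorem mainTheorem2 {C : Type u} [Category.{v} C] [MonoidalCategory C] [SymmetricCategory C]
    [Preadditive C] [MonoidalPreadditive C] [HasZeroObject C] [HasBinaryBiproducts C]
    [HasCoequalizers C] (S S' : C) (_e : S' ⊗ S ≅ 𝟙_ C) (A : Mon C)
    (f : (S ⊗ A.X) ⊗ (S ⊗ A.X) ⟶ (S ⊗ A.X) ⊗ A.X) (_hf : IsDoublePoisson S A f) :
    ∃ (ρ : (S ⊗ (omega A).X) ⊗ (S ⊗ A.X) ⟶ (S ⊗ A.X) ⊗ A.X)
      (B : (S ⊗ (omega A).X) ⊗ (S ⊗ (omega A).X) ⟶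
        S ⊗ (((omega A).X ⊗ A.X) ⊞ (A.X ⊗ (omega A).X))),
      (IsInducedAnchor f ρ ∧ ∀ ρ', IsInducedAnchor f ρ' → ρ' = ρ) ∧
      (IsKoszulBracket f ρ B ∧ ∀ B', IsKoszulBracket f ρ B' → B' = B) ∧
      IsDoubleLieRinehart S ρ B ∧
      ∀ [HasCoproductsOfShape ℕ C]
        [∀ X : C, PreservesColimitsOfShape (Discrete ℕ) (tensorLeft X)],
        ∃! F : (S ⊗ (freeAlg (omega A)).X) ⊗ (S ⊗ (freeAlg (omega A)).X) ⟶
            (S ⊗ (freeAlg (omega A)).X) ⊗ (freeAlg (omega A)).X,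
          IsDoublePoisson S (freeAlg (omega A)) F ∧ IsLinear S F ∧
            RestrictsToAnchor S F ρ ∧ RestrictsToBracket S F B := by
  -- since `S` is invertible, tensoring with `S` is fully faithful
  have := isEquivalence_tensorLeft _e
  have hB := isKoszulBracket_koszulBracket _hf
  refine ⟨koszulAnchor f, koszulBracket f,
    ⟨isInducedAnchor_koszulAnchor _hf, fun ρ' h => ?_⟩, ⟨hB, fun B' h => h.unique hB⟩,
    isDoubleLieRinehart_koszul _hf, ?_⟩
  · exact h.linear.hom_ext (isInducedAnchor_koszulAnchor _hf).linear
      (h.univD_comp.trans (isInducedAnchor_koszulAnchor _hf).univD_comp.symm)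
  · intro _ _
    exact existsUnique_linear_bracket (isAnchor_koszulAnchor _hf) hB.antisymm hB.derivation
      (jacobiator_koszul _hf)
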